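/- Let $M$ be a smooth time-oriented manifold of dimension $n>2$ with a smooth metric $g_{\alpha\beta}$ of signature $(-,+,\dots,+)$ and Levi-Civita connection $\nabla$, and let $N$ be a (smoothly immersed, in particular any embedded) $(n-1)$-dimensional submanifold of $M$. Assume: * $N$ is null: at every point the pullback $q_{ab}$ of $g_{\alpha\beta}$ to $N$ is degenerate. Let $L\subset TN$ be the line bundle of null directions; a null field is a smooth section $\ell$ of $L$ over an open subset of $N$. * $N$ is non-expanding: at every point of $N$ the expansion of some null field $\ell$ that is non-zero there vanishes, the expansion being the trace, with respect to the positive definite metric induced by $q_{ab}$ on $TN/L$, of the tensor induced on $TN/L$ by the pullback of $\nabla_\beta\ell_\alpha$ to $N$. * At the points of $N$ the Einstein equations $G_{\alpha\beta}=-\Lambda g_{\alpha\beta}+T_{\alpha\beta}$ hold, with a constant $\Lambda$ and a tensor field $T_{\alpha\beta}$, where $G_{\alpha\beta}$ is the Einstein tensor of $g$. * $T_{\alpha\beta}\ell^\alpha\ell^\beta\ge 0$ for every null vector $\ell$ tangent to $N$. * (Stronger Energy Condition) For every future-directed null vector $\ell$ tangent to $N$, the vector $-T^{\mu}{}_{\nu}\ell^{\nu}$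 is zero, or causal and future-directed. Then $\nabla_XY$ is tangent to $N$ for all vector fields $X,Y$ on open subsets of $N$, so that $D_XY:=\nabla_XY$ defines an induced covariant derivative $D$ on $N$. For every nowhere vanishing null field $\ell$ on an open subset of $N$ there is on that subset a unique 1-form $\omega^{(\ell)}$ with $D_a\ell^b=\omega^{(\ell)}_a\ell^b$ (the rotation 1-form potential); it is smooth, and with the surface gravity $\kappa^{(\ell)}=\ell^a\omega^{(\ell)}_a$ it satisfies $$\mathcal L_\ell\,\omega^{(\ell)}_a=D_a\kappa^{(\ell)} .$$ As a consequence, the rotation 2-form $\Omega=d\omega^{(\ell)}$ is independent of $\ell$, so that it is a smooth 2-form defined on all of $N$, and it satisfies $\ell^a\Omega_{ab}=0$ and $\mathcal L_\ell\Omega_{ab}=0$ for every null field $\ell$ on an open subset of $N$ (which may have zeros). -/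

import Mathlib

set_option maxSynthPendingDepth 3

open scoped Manifold ContDiff Topology

noncomputable section

namespace NullSurface

/-- The pullback `(v, w) ↦ b(Av, Aw)` of a bilinear form. -/
def pullForm {V W : Type*} [AddCommGroup V] [Module ℝ V] [TopologicalSpace V]
    [AddCommGroup W] [Module ℝ W] [TopologicalSpace W]
    (b : W →L[ℝ] W →L[ℝ] ℝ) (A : V →L[ℝ] W) : V →L[ℝ] V →L[ℝ] ℝ :=
  ContinuousLinearMap.precomp ℝ A ∘L b ∘L A

theorem pullForm_apply {V W : Type*} [AddCommGroup V] [Module ℝ V] [TopologicalSpace V]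
    [AddCommGroup W] [Module ℝ W] [TopologicalSpace W]
    (b : W →L[ℝ] W →L[ℝ] ℝ) (A : V →L[ℝ] W) (v w : V) : pullForm b A v w = b (A v) (A w) :=
  rfl

/-- Exchanging the last two arguments of a trilinear map: `(u, v, w) ↦ D(u, w, v)`. -/
def flipLast {E G : Type*} [NormedAddCommGroup E] [NormedSpace ℝ E]
    [NormedAddCommGroup G] [NormedSpace ℝ G] (D : E →L[ℝ] E →L[ℝ] E →L[ℝ] G) :
    E →L[ℝ] E →L[ℝ] E →L[ℝ] G :=
  ContinuousLinearMap.comp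
    ((ContinuousLinearMap.flipₗᵢ ℝ E E G).toContinuousLinearEquiv.toContinuousLinearMap) D

theorem flipLast_apply {E G : Type*} [NormedAddCommGroup E] [NormedSpace ℝ E]
    [NormedAddCommGroup G] [NormedSpace ℝ G] (D : E →L[ℝ] E →L[ℝ] E →L[ℝ] G) (u v w : E) :
    flipLast D u v w = D u w v :=
  rfl

/-! ### Lorentzian metrics, time orientations -/

section Spacetime

variable (E : Type*) [NormedAddCommGroup E] [NormedSpace ℝ E]
  (M : Type*) [TopologicalSpace M] [ChartedSpace E M] [IsManifold 𝓘(ℝ, E) ∞ M]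

/-- A smooth metric tensor of signature `(-,+,…,+)` on a manifold `M` (without boundary) modelled
on `E`: a smooth symmetric `(0,2)` tensor field such that every tangent space contains a vector
`v` with `g(v,v) < 0` on whose orthogonal complement `g` is positive definite. -/
structure LorentzMetric where
  /-- The bilinear form on each tangent space. -/
  val (x : M) : TangentSpace 𝓘(ℝ, E) x →L[ℝ] TangentSpace 𝓘(ℝ, E) x →L[ℝ] ℝ
  symm (x : M) (v w : TangentSpace 𝓘(ℝ, E) x) : val x v w = val x w v
  signature (x : M) : ∃ v : TangentSpace 𝓘(ℝ, E) x, val x v v < 0 ∧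
    ∀ w : TangentSpace 𝓘(ℝ, E) x, val x v w = 0 → w ≠ 0 → 0 < val x w w
  contMDiff : ContMDiff 𝓘(ℝ, E) (𝓘(ℝ, E).prod 𝓘(ℝ, E →L[ℝ] E →L[ℝ] ℝ)) ∞
    (fun x ↦ Bundle.TotalSpace.mk' (E →L[ℝ] E →L[ℝ] ℝ)
      (E := fun x : M ↦ TangentSpace 𝓘(ℝ, E) x →L[ℝ] TangentSpace 𝓘(ℝ, E) x →L[ℝ] ℝ) x (val x))

variable {E M}

/-- A time orientation, given by a continuous timelike vector field. -/
structure TimeOrientation (g : LorentzMetric E M) where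
  /-- The timelike vector field, declared to be future directed. -/
  field (x : M) : TangentSpace 𝓘(ℝ, E) x
  timelike (x : M) : g.val x (field x) (field x) < 0
  continuous : Continuous (fun x ↦ (⟨x, field x⟩ : TangentBundle 𝓘(ℝ, E) M))

/-- The closed future cone: `v` is zero, or it is causal and future directed. -/
def IsFutureCausal {g : LorentzMetric E M} (τ : TimeOrientation g) {x : M}
    (v : TangentSpace 𝓘(ℝ, E) x) : Prop :=
  g.val x v v ≤ 0 ∧ g.val x (τ.field x) v ≤ 0

/-- Raising an index: the vector `v` with `g(v, ·) = α`. -/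
def raise (g : LorentzMetric E M) (x : M) (α : TangentSpace 𝓘(ℝ, E) x →L[ℝ] ℝ) :
    TangentSpace 𝓘(ℝ, E) x :=
  (g.val x).inverse α

/-! ### Levi-Civita connection and curvature in charts -/

/-- The components of the metric in the chart at `c`, as a function on the model space. -/
def chartMetric (g : LorentzMetric E M) (c : M) (y : E) : E →L[ℝ] E →L[ℝ] ℝ :=
  pullForm (g.val ((extChartAt 𝓘(ℝ, E) c).symm y))
    (mfderiv 𝓘(ℝ, E) 𝓘(ℝ, E) (extChartAt 𝓘(ℝ, E) c).symm y)

/-- Christoffel symbols with all indices down, in the chart at `c`: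
`(u, v, w) ↦ (∂_u g(v,w) + ∂_v g(u,w) - ∂_w g(u,v)) / 2`. -/
def christoffelLower (g : LorentzMetric E M) (c : M) (y : E) :
    E →L[ℝ] E →L[ℝ] E →L[ℝ] ℝ :=
  (2⁻¹ : ℝ) • (fderiv ℝ (chartMetric g c) y + (fderiv ℝ (chartMetric g c) y).flip
    - flipLast (fderiv ℝ (chartMetric g c) y).flip)

theorem christoffelLower_apply (g : LorentzMetric E M) (c : M) (y u v w : E) :
    christoffelLower g c y u v w = 2⁻¹ * (fderiv ℝ (chartMetric g c) y u v w
      + fderiv ℝ (chartMetric g c) y v u w - fderiv ℝ (chartMetric g c) y w u v) :=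
  rfl

/-- Christoffel symbols `Γ(u,v)` of the Levi-Civita connection in the chart at `c`. -/
def christoffel (g : LorentzMetric E M) (c : M) (y : E) : E →L[ℝ] E →L[ℝ] E :=
  ContinuousLinearMap.compL ℝ E (E →L[ℝ] ℝ) E (chartMetric g c y).inverse ∘L
    christoffelLower g c y

theorem christoffel_apply (g : LorentzMetric E M) (c : M) (y u v : E) :
    christoffel g c y u v = (chartMetric g c y).inverse (christoffelLower g c y u v) :=
  rfl

/-- Auxiliary: `(u, v, w) ↦ ∂_u Γ(v,w) + Γ(u, Γ(v,w))`. -/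
def chartRiemannAux (g : LorentzMetric E M) (c : M) (y : E) : E →L[ℝ] E →L[ℝ] E →L[ℝ] E :=
  fderiv ℝ (christoffel g c) y +
    (ContinuousLinearMap.compL ℝ E E E).bilinearComp (christoffel g c y) (christoffel g c y)

/-- The Riemann tensor `(u, v, w) ↦ R(u,v)w = [∇_u, ∇_v] w` in the chart at `c`. -/
def chartRiemann (g : LorentzMetric E M) (c : M) (y : E) : E →L[ℝ] E →L[ℝ] E →L[ℝ] E :=
  chartRiemannAux g c y - (chartRiemannAux g c y).flip

theorem chartRiemann_apply (g : LorentzMetric E M) (c : M) (y u v w : E) :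
    chartRiemann g c y u v w =
      (fderiv ℝ (christoffel g c) y u v w + christoffel g c y u (christoffel g c y v w))
      - (fderiv ℝ (christoffel g c) y v u w + christoffel g c y v (christoffel g c y u w)) :=
  rfl

variable [FiniteDimensional ℝ E]

/-- The Ricci tensor in the chart at `c`: `Ric(v,w)` is the trace of `u ↦ R(u,v)w`. -/
def chartRicci (g : LorentzMetric E M) (c : M) (y : E) : E →L[ℝ] E →L[ℝ] ℝ :=
  ContinuousLinearMap.compL ℝ E (E →L[ℝ] E) ℝ
      (LinearMap.toContinuousLinearMap
        (LinearMap.trace ℝ E ∘ₗ ContinuousLinearMap.coeLM ℝ)) ∘L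
    flipLast (chartRiemann g c y).flip

theorem chartRicci_apply (g : LorentzMetric E M) (c : M) (y v w : E) :
    chartRicci g c y v w =
      LinearMap.trace ℝ E (((chartRiemann g c y).flip v).flip w : E →L[ℝ] E) :=
  rfl

/-- The Ricci tensor of the spacetime. -/
def ricci (g : LorentzMetric E M) (x : M) :
    TangentSpace 𝓘(ℝ, E) x →L[ℝ] TangentSpace 𝓘(ℝ, E) x →L[ℝ] ℝ :=
  pullForm (chartRicci g x (extChartAt 𝓘(ℝ, E) x x))
    (mfderiv 𝓘(ℝ, E) 𝓘(ℝ, E) (extChartAt 𝓘(ℝ, E) x) x)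

/-- The scalar curvature `g^{αβ} Ric_{αβ}`. -/
def scalarCurvature (g : LorentzMetric E M) (x : M) : ℝ :=
  LinearMap.trace ℝ (TangentSpace 𝓘(ℝ, E) x)
    (((g.val x).inverse ∘L ricci g x :
      TangentSpace 𝓘(ℝ, E) x →L[ℝ] TangentSpace 𝓘(ℝ, E) x) :
      TangentSpace 𝓘(ℝ, E) x →ₗ[ℝ] TangentSpace 𝓘(ℝ, E) x)

/-- The Einstein tensor `Ric - (R/2) g`. -/
def einstein (g : LorentzMetric E M) (x : M) :
    TangentSpace 𝓘(ℝ, E) x →L[ℝ] TangentSpace 𝓘(ℝ, E) x →L[ℝ] ℝ :=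
  ricci g x - (scalarCurvature g x / 2) • g.val x

end Spacetime

/-! ### Null hypersurfaces -/

section Surface

variable {E : Type*} [NormedAddCommGroup E] [NormedSpace ℝ E]
  {M : Type*} [TopologicalSpace M] [ChartedSpace E M] [IsManifold 𝓘(ℝ, E) ∞ M]
  {F : Type*} [NormedAddCommGroup F] [NormedSpace ℝ F]
  {N : Type*} [TopologicalSpace N] [ChartedSpace F N]

/-- A vector field on `N` regarded as a vector field along `ι : N → M`. -/
def push (ι : N → M) (Y : ∀ p : N, TangentSpace 𝓘(ℝ, F) p) (p : N) :
    TangentSpace 𝓘(ℝ, E) (ι p) :=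
  mfderiv 𝓘(ℝ, F) 𝓘(ℝ, E) ι p (Y p)

/-- The induced (degenerate) metric `q_{ab}`, the pullback of `g` to `N`. -/
def inducedMetric (g : LorentzMetric E M) (ι : N → M) (p : N) :
    TangentSpace 𝓘(ℝ, F) p →L[ℝ] TangentSpace 𝓘(ℝ, F) p →L[ℝ] ℝ :=
  pullForm (g.val (ι p)) (mfderiv 𝓘(ℝ, F) 𝓘(ℝ, E) ι p)

/-- `ι : N → M` is a smooth immersion whose induced metric is degenerate at every point.
(That `N` has codimension one is stated separately.) -/
structure IsNullImmersion (g : LorentzMetric E M) (ι : N → M) : Prop where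
  contMDiff : ContMDiff 𝓘(ℝ, F) 𝓘(ℝ, E) ∞ ι
  injective (p : N) : Function.Injective (mfderiv 𝓘(ℝ, F) 𝓘(ℝ, E) ι p)
  degenerate (p : N) : ∃ v : TangentSpace 𝓘(ℝ, F) p, v ≠ 0 ∧ ∀ w, inducedMetric g ι p v w = 0

/-- `Y` is a smooth vector field on the subset `U` of `N`. -/
def IsSmoothFieldOn (U : Set N) (Y : ∀ p : N, TangentSpace 𝓘(ℝ, F) p)
    [IsManifold 𝓘(ℝ, F) ∞ N] : Prop :=
  ContMDiffOn 𝓘(ℝ, F) 𝓘(ℝ, F).tangent ∞ (fun p ↦ (⟨p, Y p⟩ : TangentBundle 𝓘(ℝ, F) N)) U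

/-- `ℓ` is a smooth null vector field defined on the open subset `U` of `N` and tangent to `N`
(zeros are allowed). -/
structure IsNullFieldOn [IsManifold 𝓘(ℝ, F) ∞ N] (g : LorentzMetric E M) (ι : N → M)
    (U : Set N) (ℓ : ∀ p : N, TangentSpace 𝓘(ℝ, F) p) : Prop where
  isOpen : IsOpen U
  smooth : IsSmoothFieldOn U ℓ
  null : ∀ p ∈ U, inducedMetric g ι p (ℓ p) (ℓ p) = 0

/-- The spacetime Levi-Civita derivative `∇_X V` at `p` of a vector field `V` along `ι : N → M`,
in the direction of a vector `X` tangent to `N`. In the chart of `M` at `ι p` it is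
`X(V^α) + Γ^α_{βγ} X^β V^γ`. For tangent `V` it is `X^β ∇_β` of any extension of `V` to `M`. -/
def covAlong (g : LorentzMetric E M) (ι : N → M) (V : ∀ p : N, TangentSpace 𝓘(ℝ, E) (ι p))
    (p : N) (X : TangentSpace 𝓘(ℝ, F) p) : TangentSpace 𝓘(ℝ, E) (ι p) :=
  -- the components of `V` and of `X` in the chart at `ι p`
  let V' (q : N) : E := mfderiv 𝓘(ℝ, E) 𝓘(ℝ, E) (extChartAt 𝓘(ℝ, E) (ι p)) (ι q) (V q)
  let X' : E := mfderiv 𝓘(ℝ, E) 𝓘(ℝ, E) (extChartAt 𝓘(ℝ, E) (ι p)) (ι p)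
    (mfderiv 𝓘(ℝ, F) 𝓘(ℝ, E) ι p X)
  let DV : E := mfderiv 𝓘(ℝ, F) 𝓘(ℝ, E) V' p X
  (mfderiv 𝓘(ℝ, E) 𝓘(ℝ, E) (extChartAt 𝓘(ℝ, E) (ι p)) (ι p)).inverse
    (DV + christoffel g (ι p) (extChartAt 𝓘(ℝ, E) (ι p) (ι p)) X' (V' p))

/-- The pullback `B_{ab}` to `N` of `∇_β ℓ_α`: `B(X,Y) = g(X, ∇_Y ℓ)`. -/
def derivTensor (g : LorentzMetric E M) (ι : N → M) (ℓ : ∀ p : N, TangentSpace 𝓘(ℝ, F) p)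
    (p : N) (X Y : TangentSpace 𝓘(ℝ, F) p) : ℝ :=
  g.val (ι p) (mfderiv 𝓘(ℝ, F) 𝓘(ℝ, E) ι p X) (covAlong g ι (push ι ℓ) p Y)

/-- `θ` is the expansion at `p` of the null field `ℓ`: the trace of `B_{ab}` with respect to the
positive definite metric that `q_{ab}` induces on the quotient of `T_p N` by the null direction.
The trace is computed in vectors `e_A` of `T_p N`, one fewer than the dimension of `N`, that
represent an orthonormal basis of the quotient; as `B` descends to the quotient, the choice is
immaterial. -/
def HasExpansion (g : LorentzMetric E M) (ι : N → M) (ℓ : ∀ p : N, TangentSpace 𝓘(ℝ, F) p)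
    (p : N) (θ : ℝ) : Prop :=
  ∃ e : Fin (Module.finrank ℝ F - 1) → TangentSpace 𝓘(ℝ, F) p,
    (∀ A B, inducedMetric g ι p (e A) (e B) = if A = B then 1 else 0) ∧
    ∑ A, derivTensor g ι ℓ p (e A) (e A) = θ

/-- The null surface is non-expanding: at every point the expansion of some non-trivial null
field tangent to `N` and defined near the point vanishes. -/
def IsNonExpanding [IsManifold 𝓘(ℝ, F) ∞ N] (g : LorentzMetric E M) (ι : N → M) : Prop :=
  ∀ p : N, ∃ (U : Set N) (ℓ : ∀ p : N, TangentSpace 𝓘(ℝ, F) p),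
    IsNullFieldOn g ι U ℓ ∧ p ∈ U ∧ ℓ p ≠ 0 ∧ HasExpansion g ι ℓ p 0

/-- The Einstein equations with cosmological constant `Λ` and energy-momentum tensor `T` hold at
the points of the surface. -/
def EinsteinOn [FiniteDimensional ℝ E] (g : LorentzMetric E M) (ι : N → M) (Λ : ℝ)
    (T : ∀ x : M, TangentSpace 𝓘(ℝ, E) x →L[ℝ] TangentSpace 𝓘(ℝ, E) x →L[ℝ] ℝ) : Prop :=
  ∀ p : N, einstein g (ι p) = -(Λ • g.val (ι p)) + T (ι p)

/-- The energy condition `T_{αβ} ℓ^α ℓ^β ≥ 0` for null vectors `ℓ` tangent to the surface. -/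
def NullEnergyCondition (g : LorentzMetric E M) (ι : N → M)
    (T : ∀ x : M, TangentSpace 𝓘(ℝ, E) x →L[ℝ] TangentSpace 𝓘(ℝ, E) x →L[ℝ] ℝ) : Prop :=
  ∀ (p : N) (v : TangentSpace 𝓘(ℝ, F) p), inducedMetric g ι p v v = 0 →
    0 ≤ T (ι p) (mfderiv 𝓘(ℝ, F) 𝓘(ℝ, E) ι p v) (mfderiv 𝓘(ℝ, F) 𝓘(ℝ, E) ι p v)

/-- The Stronger Energy Condition: `-T^μ_ν ℓ^ν` is causal and future directed (or zero) for every
future directed null vector `ℓ` tangent to the surface. (At the points of the surface `T` is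
symmetric, by the Einstein equations.) -/
def StrongerEnergyCondition (g : LorentzMetric E M) (τ : TimeOrientation g) (ι : N → M)
    (T : ∀ x : M, TangentSpace 𝓘(ℝ, E) x →L[ℝ] TangentSpace 𝓘(ℝ, E) x →L[ℝ] ℝ) : Prop :=
  ∀ (p : N) (v : TangentSpace 𝓘(ℝ, F) p), inducedMetric g ι p v v = 0 →
    g.val (ι p) (τ.field (ι p)) (mfderiv 𝓘(ℝ, F) 𝓘(ℝ, E) ι p v) < 0 →
    IsFutureCausal τ
      (-(raise g (ι p) (T (ι p) (mfderiv 𝓘(ℝ, F) 𝓘(ℝ, E) ι p v))))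

/-- The induced covariant derivative `D_X Y`: the vector tangent to `N` whose image is `∇_X Y`. -/
def inducedDeriv (g : LorentzMetric E M) (ι : N → M) (Y : ∀ p : N, TangentSpace 𝓘(ℝ, F) p)
    (p : N) (X : TangentSpace 𝓘(ℝ, F) p) : TangentSpace 𝓘(ℝ, F) p :=
  Classical.epsilon fun Z : TangentSpace 𝓘(ℝ, F) p ↦
    mfderiv 𝓘(ℝ, F) 𝓘(ℝ, E) ι p Z = covAlong g ι (push ι Y) p X

/-- The rotation 1-form potential `ω` of `ℓ`: the 1-form with `D_X ℓ = ω(X) ℓ`. -/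
def rotationForm (g : LorentzMetric E M) (ι : N → M) (ℓ : ∀ p : N, TangentSpace 𝓘(ℝ, F) p)
    (p : N) : TangentSpace 𝓘(ℝ, F) p →L[ℝ] ℝ :=
  Classical.epsilon fun α : TangentSpace 𝓘(ℝ, F) p →L[ℝ] ℝ ↦
    ∀ X, inducedDeriv g ι ℓ p X = α X • ℓ p

/-- The surface gravity `κ = ω(ℓ)`. -/
def surfaceGravity (g : LorentzMetric E M) (ι : N → M) (ℓ : ∀ p : N, TangentSpace 𝓘(ℝ, F) p)
    (p : N) : ℝ :=
  rotationForm g ι ℓ p (ℓ p)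

end Surface

/-! ### Lie derivative and exterior derivative on `N` -/

section Forms

variable {F : Type*} [NormedAddCommGroup F] [NormedSpace ℝ F]
  {N : Type*} [TopologicalSpace N] [ChartedSpace F N]

/-- A vector field in the chart at `c`. -/
def chartField (X : ∀ p : N, TangentSpace 𝓘(ℝ, F) p) (c : N) (y : F) : F :=
  mfderiv 𝓘(ℝ, F) 𝓘(ℝ, F) (extChartAt 𝓘(ℝ, F) c) ((extChartAt 𝓘(ℝ, F) c).symm y)
    (X ((extChartAt 𝓘(ℝ, F) c).symm y))

/-- A 1-form in the chart at `c`. -/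
def chartOneForm (α : ∀ p : N, TangentSpace 𝓘(ℝ, F) p →L[ℝ] ℝ) (c : N) (y : F) : F →L[ℝ] ℝ :=
  (α ((extChartAt 𝓘(ℝ, F) c).symm y)) ∘L
    (mfderiv 𝓘(ℝ, F) 𝓘(ℝ, F) (extChartAt 𝓘(ℝ, F) c).symm y)

/-- A `(0,2)` tensor field in the chart at `c`. -/
def chartTwoTensor
    (β : ∀ p : N, TangentSpace 𝓘(ℝ, F) p →L[ℝ] TangentSpace 𝓘(ℝ, F) p →L[ℝ] ℝ)
    (c : N) (y : F) : F →L[ℝ] F →L[ℝ] ℝ :=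
  pullForm (β ((extChartAt 𝓘(ℝ, F) c).symm y))
    (mfderiv 𝓘(ℝ, F) 𝓘(ℝ, F) (extChartAt 𝓘(ℝ, F) c).symm y)

/-- The Lie derivative of a 1-form: `(L_ℓ α)_a = ℓ^b ∂_b α_a + α_b ∂_a ℓ^b`. -/
def lieOneForm (ℓ : ∀ p : N, TangentSpace 𝓘(ℝ, F) p)
    (α : ∀ p : N, TangentSpace 𝓘(ℝ, F) p →L[ℝ] ℝ) (p : N) (X : TangentSpace 𝓘(ℝ, F) p) : ℝ :=
  let y : F := extChartAt 𝓘(ℝ, F) p p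
  let X' : F := mfderiv 𝓘(ℝ, F) 𝓘(ℝ, F) (extChartAt 𝓘(ℝ, F) p) p X
  fderiv ℝ (chartOneForm α p) y (chartField ℓ p y) X'
    + chartOneForm α p y (fderiv ℝ (chartField ℓ p) y X')

/-- The Lie derivative of a `(0,2)` tensor:
`(L_ℓ β)_{ab} = ℓ^c ∂_c β_{ab} + β_{cb} ∂_a ℓ^c + β_{ac} ∂_b ℓ^c`. -/
def lieTwoTensor (ℓ : ∀ p : N, TangentSpace 𝓘(ℝ, F) p)
    (β : ∀ p : N, TangentSpace 𝓘(ℝ, F) p →L[ℝ] TangentSpace 𝓘(ℝ, F) p →L[ℝ] ℝ)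
    (p : N) (X Y : TangentSpace 𝓘(ℝ, F) p) : ℝ :=
  let y : F := extChartAt 𝓘(ℝ, F) p p
  let X' : F := mfderiv 𝓘(ℝ, F) 𝓘(ℝ, F) (extChartAt 𝓘(ℝ, F) p) p X
  let Y' : F := mfderiv 𝓘(ℝ, F) 𝓘(ℝ, F) (extChartAt 𝓘(ℝ, F) p) p Y
  fderiv ℝ (chartTwoTensor β p) y (chartField ℓ p y) X' Y'
    + chartTwoTensor β p y (fderiv ℝ (chartField ℓ p) y X') Y'
    + chartTwoTensor β p y X' (fderiv ℝ (chartField ℓ p) y Y')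

/-- The exterior derivative of a 1-form: `(dα)_{ab} = ∂_a α_b - ∂_b α_a`. -/
def extDerivOneForm (α : ∀ p : N, TangentSpace 𝓘(ℝ, F) p →L[ℝ] ℝ) (p : N)
    (X Y : TangentSpace 𝓘(ℝ, F) p) : ℝ :=
  let y : F := extChartAt 𝓘(ℝ, F) p p
  let X' : F := mfderiv 𝓘(ℝ, F) 𝓘(ℝ, F) (extChartAt 𝓘(ℝ, F) p) p X
  let Y' : F := mfderiv 𝓘(ℝ, F) 𝓘(ℝ, F) (extChartAt 𝓘(ℝ, F) p) p Y
  fderiv ℝ (chartOneForm α p) y X' Y' - fderiv ℝ (chartOneForm α p) y Y' X'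

/-- `α` is a smooth 1-form on the subset `U` of `N`. -/
def IsSmoothOneFormOn [IsManifold 𝓘(ℝ, F) ∞ N] (U : Set N)
    (α : ∀ p : N, TangentSpace 𝓘(ℝ, F) p →L[ℝ] ℝ) : Prop :=
  ContMDiffOn 𝓘(ℝ, F) (𝓘(ℝ, F).prod 𝓘(ℝ, F →L[ℝ] ℝ)) ∞
    (fun p ↦ Bundle.TotalSpace.mk' (F →L[ℝ] ℝ)
      (E := fun p : N ↦ TangentSpace 𝓘(ℝ, F) p →L[ℝ] ℝ) p (α p)) U

/-- `β` is a smooth `(0,2)` tensor field on `N`. -/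
def IsSmoothTwoTensor [IsManifold 𝓘(ℝ, F) ∞ N]
    (β : ∀ p : N, TangentSpace 𝓘(ℝ, F) p →L[ℝ] TangentSpace 𝓘(ℝ, F) p →L[ℝ] ℝ) : Prop :=
  ContMDiff 𝓘(ℝ, F) (𝓘(ℝ, F).prod 𝓘(ℝ, F →L[ℝ] F →L[ℝ] ℝ)) ∞
    (fun p ↦ Bundle.TotalSpace.mk' (F →L[ℝ] F →L[ℝ] ℝ)
      (E := fun p : N ↦ TangentSpace 𝓘(ℝ, F) p →L[ℝ] TangentSpace 𝓘(ℝ, F) p →L[ℝ] ℝ) p (β p))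

end Forms

end NullSurface

end

/-! The problem is local. In charts the surface becomes an immersed hypersurface `f` with a null
field `ℓ`; put `k = f_*ℓ`. Being null, `k` is at once tangent and normal: the tangent space is the
orthogonal complement of `k`, the metric is nonnegative there, and only multiples of `k` have length
zero. Since `g(k, k) = 0`, every `∇_X k` is tangent, which defines a Weingarten endomorphism `S`,
self-adjoint for the induced metric and with `S ℓ = κ ℓ`.

Vanishing expansion says that `κ` is the trace of `S`. The trace of `X ↦ R(X, ℓ)ℓ` is then
Raychaudhuri's equation `Ric(ℓ, ℓ) = κ² - tr S²` (`ricciAt_push_null`), and the right side is minus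
the sum of the squared lengths of `S e_A` over a screen basis. The Einstein equations and the null
energy condition give the opposite sign, so `Ric(ℓ, ℓ) = 0` and `S` takes values in the null line
(`shear_free`). Hence `∇_X k = ω(X) k`, and the second form is orthogonal to `k`, that is, tangent:
the connection restricts to the surface.

Commuting derivatives of `∇k = ω k` gives `R(X, Y)k = dω(X, Y) k` (`riemann_of_rotation`). As
curvature is tensorial, `dω` is the same for all null fields. Tracing over `X` gives `Ric(Y, ℓ) =
dω(ℓ, Y)` (`ricciAt_of_rotation`). By the Einstein equations this is a component of `T(ℓ, ·)`. Since
`T(ℓ, ℓ) = 0`, the stronger energy condition makes the raised covector `-T(ℓ, ·)` causal and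
orthogonal to `k`, hence a multiple of `k`, so it annihilates tangent vectors
(`stressForm_tangent`). Thus `dω(ℓ, ·) = 0`. Cartan's formula turns this into the zeroth law, and
closedness of `dω` into the invariance of `Ω` under null fields. -/

noncomputable section

namespace NullSurface

/-! ### Linear algebra of Lorentzian forms and their null hyperplanes -/

section LinearAlgebra

variable {E : Type*} [NormedAddCommGroup E] [NormedSpace ℝ E]
  {F : Type*} [NormedAddCommGroup F] [NormedSpace ℝ F]

/-- A symmetric bilinear form of signature `(-,+,…,+)`. -/
structure IsLorentz (b : E →L[ℝ] E →L[ℝ] ℝ) : Prop where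
  symm (v w : E) : b v w = b w v
  signature : ∃ v : E, b v v < 0 ∧ ∀ w : E, b v w = 0 → w ≠ 0 → 0 < b w w

namespace IsLorentz

variable {b : E →L[ℝ] E →L[ℝ] ℝ}

/-- A vector in the kernel is orthogonal to the timelike `t`, so it would have positive square
unless it is zero. -/
theorem eq_zero (hb : IsLorentz b) {v : E} (hv : ∀ w, b v w = 0) : v = 0 := by
  obtain ⟨t, -, ht⟩ := hb.signature
  by_contra h
  have := ht v (by rw [hb.symm]; exact hv t) h
  rw [hv v] at this
  exact lt_irrefl _ this

theorem isInvertible [FiniteDimensional ℝ E] (hb : IsLorentz b) : b.IsInvertible := by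
  have hinj : Function.Injective (b : E →ₗ[ℝ] E →L[ℝ] ℝ) := by
    rw [injective_iff_map_eq_zero]
    intro v hv
    exact hb.eq_zero fun w ↦ by
      have : b v = 0 := hv
      rw [this]; rfl
  have hd : Module.finrank ℝ E = Module.finrank ℝ (E →L[ℝ] ℝ) := by
    rw [← LinearEquiv.finrank_eq (LinearMap.toContinuousLinearMap (𝕜 := ℝ) (E := E) (F' := ℝ))]
    exact (Subspace.dual_finrank_eq (K := ℝ) (V := E)).symm
  let e : E ≃L[ℝ] (E →L[ℝ] ℝ) :=
    (LinearEquiv.ofInjectiveOfFinrankEq (b : E →ₗ[ℝ] E →L[ℝ] ℝ) hinj hd).toContinuousLinearEquiv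
  refine ⟨e, ?_⟩
  ext v w
  rfl

/-- A causal vector orthogonal to a null vector is proportional to it. -/
theorem exists_smul_eq_of_null (hb : IsLorentz b) {a c : E} (ha : a ≠ 0) (haa : b a a = 0)
    (hcc : b c c ≤ 0) (hac : b a c = 0) : ∃ r : ℝ, c = r • a := by
  obtain ⟨t, -, ht⟩ := hb.signature
  have hta : b t a ≠ 0 := fun h ↦ by
    have := ht a h ha
    rw [haa] at this
    exact lt_irrefl _ this
  -- The coefficient makes `c - r • a` orthogonal to the timelike `t`, where `b` is positive
  -- definite; yet its square equals that of `c`, which is not positive.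
  refine ⟨b t c / b t a, ?_⟩
  by_contra h
  have hne : c - (b t c / b t a) • a ≠ 0 := sub_ne_zero.2 h
  have := ht _ (by simp [hta]) hne
  have hca : b c a = 0 := by rw [hb.symm]; exact hac
  simp [haa, hac, hca] at this
  linarith

theorem nonneg_of_orthogonal_null (hb : IsLorentz b) {a c : E} (ha : a ≠ 0) (haa : b a a = 0)
    (hac : b a c = 0) : 0 ≤ b c c := by
  by_contra! h
  obtain ⟨r, rfl⟩ := hb.exists_smul_eq_of_null ha haa h.le hac
  simp [haa] at h

theorem timelike_null_ne_zero (hb : IsLorentz b) {a c : E} (ha : a ≠ 0) (haa : b a a = 0)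
    (hcc : b c c < 0) : b c a ≠ 0 := fun h ↦
  (hb.nonneg_of_orthogonal_null ha haa (by rw [hb.symm]; exact h)).not_gt hcc

/-- The orthogonal complement of a null vector is any hyperplane orthogonal to it. -/
theorem mem_range_of_orthogonal [FiniteDimensional ℝ E] [FiniteDimensional ℝ F]
    (hb : IsLorentz b) {A : F →L[ℝ] E} (hA : Function.Injective A)
    (hdim : Module.finrank ℝ E = Module.finrank ℝ F + 1) {k : E} (hk : k ≠ 0)
    (hkA : ∀ X, b k (A X) = 0) {u : E} (hu : b k u = 0) : ∃ Z, A Z = u := by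
  -- The range has dimension `dim F` by injectivity, and the kernel of `b k` is proper by
  -- nondegeneracy, so the inclusion is an equality by dimension.
  have hle : LinearMap.range (A : F →ₗ[ℝ] E) ≤ LinearMap.ker (b k : E →ₗ[ℝ] ℝ) := by
    rintro _ ⟨X, rfl⟩
    exact hkA X
  have hr : Module.finrank ℝ (LinearMap.range (A : F →ₗ[ℝ] E)) = Module.finrank ℝ F :=
    LinearMap.finrank_range_of_inj hA
  have hne : LinearMap.ker (b k : E →ₗ[ℝ] ℝ) ≠ ⊤ := fun h ↦ hk <| hb.eq_zero fun w ↦ by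
    have : w ∈ LinearMap.ker (b k : E →ₗ[ℝ] ℝ) := h ▸ Submodule.mem_top
    exact this
  have hlt := Submodule.finrank_lt hne
  have heq : LinearMap.range (A : F →ₗ[ℝ] E) = LinearMap.ker (b k : E →ₗ[ℝ] ℝ) :=
    Submodule.eq_of_le_of_finrank_le hle (by omega)
  have hu' : u ∈ LinearMap.ker (b k : E →ₗ[ℝ] ℝ) := hu
  rw [← heq] at hu'
  exact hu'

end IsLorentz

/-- Serves to compute Ricci traces when a curvature operator has values tangent to the surface. With
a left inverse `P` of `A` one has `T = A (P T)`, and cyclicity of the trace leaves `(P T) A = S`. -/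
theorem trace_eq_of_comp_eq [FiniteDimensional ℝ E] [FiniteDimensional ℝ F]
    {A : F →ₗ[ℝ] E} (hA : Function.Injective A) {T : E →ₗ[ℝ] E} {S : F →ₗ[ℝ] F}
    (hT : ∀ u, ∃ Z, A Z = T u) (hTS : ∀ X, T (A X) = A (S X)) :
    LinearMap.trace ℝ E T = LinearMap.trace ℝ F S := by
  obtain ⟨P, hP⟩ := A.exists_leftInverse_of_injective (LinearMap.ker_eq_bot.2 hA)
  have hP' : ∀ X, P (A X) = X := fun X ↦ LinearMap.congr_fun hP X
  have h1 : T = A ∘ₗ (P ∘ₗ T) := by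
    ext u
    obtain ⟨Z, hZ⟩ := hT u
    simp [← hZ, hP']
  have h2 : (P ∘ₗ T) ∘ₗ A = S := by
    ext X
    simp [hTS, hP']
  rw [h1, LinearMap.trace_comp_comm', h2]

/-- The trace of an endomorphism that is skew with respect to a nondegenerate form vanishes. -/
theorem trace_eq_zero_of_skew [FiniteDimensional ℝ E] {b : E →L[ℝ] E →L[ℝ] ℝ}
    (hb : IsLorentz b) {T : E →ₗ[ℝ] E} (hT : ∀ v w, b (T v) w = -b v (T w)) :
    LinearMap.trace ℝ E T = 0 := by
  obtain ⟨e, he⟩ := hb.isInvertible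
  let e' : E ≃ₗ[ℝ] Module.Dual ℝ E := e.toLinearEquiv.trans
    (LinearMap.toContinuousLinearMap (𝕜 := ℝ) (E := E) (F' := ℝ)).symm
  have he' : ∀ v w, e' v w = b v w := fun v w ↦ by rw [← he]; rfl
  -- Identifying `E` with its dual through `b` turns `T` into minus its transpose, so the trace
  -- equals its own negative.
  have h : e'.conj T = -Module.Dual.transpose (R := ℝ) T := by
    ext φ w
    obtain ⟨v, rfl⟩ := e'.surjective φ
    simp [LinearEquiv.conj_apply, he', hT, Module.Dual.transpose_apply]
  have h1 := LinearMap.trace_conj' T e'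
  rw [h, map_neg, LinearMap.trace_transpose'] at h1
  linarith

/-- The trace of an endomorphism computed in a degenerate space `F` with null direction `ℓ`, in
terms of representatives `e` of an orthonormal basis of the quotient. -/
theorem exists_screen_decomposition [FiniteDimensional ℝ F] {q : F →L[ℝ] F →L[ℝ] ℝ}
    {ℓ : F} (hℓ : ℓ ≠ 0) (hq : ∀ X, q ℓ X = 0) {e : Fin (Module.finrank ℝ F - 1) → F}
    (he : ∀ A B, q (e A) (e B) = if A = B then 1 else 0) :
    ∃ lam : F →ₗ[ℝ] ℝ, lam ℓ = 1 ∧ (∀ A, lam (e A) = 0) ∧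
      ∀ X, X = lam X • ℓ + ∑ A, q X (e A) • e A := by
  classical
  let Φ : F →ₗ[ℝ] (Fin (Module.finrank ℝ F - 1) → ℝ) :=
    LinearMap.pi fun A ↦ ((q.flip (e A) : F →L[ℝ] ℝ) : F →ₗ[ℝ] ℝ)
  have hΦ : ∀ X A, Φ X A = q X (e A) := fun X A ↦ rfl
  have hΦs : Function.Surjective Φ := by
    intro c
    refine ⟨∑ A, c A • e A, ?_⟩
    ext B
    simp [hΦ, he]
  -- Needed for the truncated `finrank - 1` to be a true subtraction, which makes the kernel of `Φ`
  -- exactly the line of `ℓ`.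
  have hpos : 0 < Module.finrank ℝ F := Module.finrank_pos_iff_exists_ne_zero.2 ⟨ℓ, hℓ⟩
  have hker : Module.finrank ℝ (LinearMap.ker Φ) = 1 := by
    have h1 := LinearMap.finrank_range_add_finrank_ker Φ
    rw [LinearMap.range_eq_top.2 hΦs, finrank_top, Module.finrank_fin_fun] at h1
    omega
  have hℓk : ℓ ∈ LinearMap.ker Φ := by
    rw [LinearMap.mem_ker]; ext A; simp [hΦ, hq]
  have hsp : ∀ Z, Φ Z = 0 → ∃ c : ℝ, c • ℓ = Z := by
    intro Z hZ
    obtain ⟨c, hc⟩ := (finrank_eq_one_iff_of_nonzero' (⟨ℓ, hℓk⟩ : LinearMap.ker Φ)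
      (by simpa [Subtype.ext_iff] using hℓ)).1 hker ⟨Z, hZ⟩
    exact ⟨c, congrArg Subtype.val hc⟩
  obtain ⟨f, hf⟩ := SeparatingDual.exists_ne_zero (R := ℝ) hℓ
  -- A functional not vanishing at `ℓ`, corrected to vanish on the `e A` and rescaled, is the
  -- coordinate along `ℓ`.
  let lam : F →ₗ[ℝ] ℝ := (f ℓ)⁻¹ • ((f : F →ₗ[ℝ] ℝ) - ∑ A, f (e A) •
    ((q.flip (e A) : F →L[ℝ] ℝ) : F →ₗ[ℝ] ℝ))
  have hlam : ∀ X, lam X = (f ℓ)⁻¹ * (f X - ∑ A, f (e A) * q X (e A)) := fun X ↦ by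
    simp [lam]
  refine ⟨lam, ?_, fun B ↦ ?_, fun X ↦ ?_⟩
  · simp [hlam, hq, hf]
  · simp [hlam, he]
  · obtain ⟨c, hc⟩ := hsp (X - ∑ A, q X (e A) • e A) (by
      ext B
      simp [hΦ, he])
    have h1 : lam X = c := by
      rw [hlam, eq_comm, eq_inv_mul_iff_mul_eq₀ hf]
      have := congrArg f hc
      simp only [map_smul, map_sub, map_sum, smul_eq_mul] at this
      rw [mul_comm, this]
      congr 1
      exact Finset.sum_congr rfl fun A _ ↦ mul_comm _ _
    rw [h1, hc]
    abel

/-- The functionals `lam` and `q(·, e A)` are dual to the basis formed by `ℓ` and the `e A`, so `S`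
is a sum of rank-one maps. The null direction contributes `κ`; the rest is the trace on the
quotient. -/
theorem trace_eq_screen_sum [FiniteDimensional ℝ F] {q : F →L[ℝ] F →L[ℝ] ℝ}
    {ℓ : F} (hℓ : ℓ ≠ 0) (hq : ∀ X, q ℓ X = 0) {e : Fin (Module.finrank ℝ F - 1) → F}
    (he : ∀ A B, q (e A) (e B) = if A = B then 1 else 0) (S : F →L[ℝ] F) {κ : ℝ}
    (hS : S ℓ = κ • ℓ) :
    LinearMap.trace ℝ F (S : F →ₗ[ℝ] F) = κ + ∑ A, q (S (e A)) (e A) := by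
  obtain ⟨lam, h1, -, hdec⟩ := exists_screen_decomposition hℓ hq he
  have : (S : F →ₗ[ℝ] F) = lam.smulRight (S ℓ) +
      ∑ A, ((q.flip (e A) : F →L[ℝ] ℝ) : F →ₗ[ℝ] ℝ).smulRight (S (e A)) := by
    ext X
    have h := congrArg S (hdec X)
    simp only [map_add, map_smul, map_sum] at h
    simpa using h
  rw [this, map_add, map_sum]
  simp [LinearMap.trace_smulRight, hS, h1]

end LinearAlgebra

end NullSurface

end

noncomputable section

namespace NullSurface

/-! ### Levi-Civita connection and curvature of a metric on an open subset of the model space -/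

section LocalMetric

theorem minSmoothness_two_le : minSmoothness ℝ 2 ≤ (∞ : WithTop ℕ∞) := by
  rw [minSmoothness_of_isRCLikeNormedField]
  exact ENat.LEInfty.out

variable {E : Type*} [NormedAddCommGroup E] [NormedSpace ℝ E]

/-- Christoffel symbols with all indices down of a metric on the model space. -/
def lcLower (G : E → E →L[ℝ] E →L[ℝ] ℝ) (y : E) : E →L[ℝ] E →L[ℝ] E →L[ℝ] ℝ :=
  (2⁻¹ : ℝ) • (fderiv ℝ G y + (fderiv ℝ G y).flip - flipLast (fderiv ℝ G y).flip)

theorem lcLower_apply (G : E → E →L[ℝ] E →L[ℝ] ℝ) (y u v w : E) :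
    lcLower G y u v w = 2⁻¹ * (fderiv ℝ G y u v w + fderiv ℝ G y v u w - fderiv ℝ G y w u v) :=
  rfl

/-- Christoffel symbols of a metric on the model space. -/
def leviCivita (G : E → E →L[ℝ] E →L[ℝ] ℝ) (y : E) : E →L[ℝ] E →L[ℝ] E :=
  ContinuousLinearMap.compL ℝ E (E →L[ℝ] ℝ) E (G y).inverse ∘L lcLower G y

theorem leviCivita_apply (G : E → E →L[ℝ] E →L[ℝ] ℝ) (y u v : E) :
    leviCivita G y u v = (G y).inverse (lcLower G y u v) :=
  rfl

/-- Auxiliary: `(u, v, w) ↦ ∂_u Γ(v,w) + Γ(u, Γ(v,w))`. -/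
def riemannAux (G : E → E →L[ℝ] E →L[ℝ] ℝ) (y : E) : E →L[ℝ] E →L[ℝ] E →L[ℝ] E :=
  fderiv ℝ (leviCivita G) y +
    (ContinuousLinearMap.compL ℝ E E E).bilinearComp (leviCivita G y) (leviCivita G y)

/-- The Riemann tensor of a metric on the model space. -/
def riemann (G : E → E →L[ℝ] E →L[ℝ] ℝ) (y : E) : E →L[ℝ] E →L[ℝ] E →L[ℝ] E :=
  riemannAux G y - (riemannAux G y).flip

theorem riemann_apply (G : E → E →L[ℝ] E →L[ℝ] ℝ) (y u v w : E) :
    riemann G y u v w =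
      (fderiv ℝ (leviCivita G) y u v w + leviCivita G y u (leviCivita G y v w))
      - (fderiv ℝ (leviCivita G) y v u w + leviCivita G y v (leviCivita G y u w)) :=
  rfl

/-- A smooth Lorentzian metric on an open subset of the model space. -/
structure IsLorentzOn (G : E → E →L[ℝ] E →L[ℝ] ℝ) (V : Set E) : Prop where
  isOpen : IsOpen V
  contDiffOn : ContDiffOn ℝ ∞ G V
  lorentz : ∀ y ∈ V, IsLorentz (G y)

variable {G : E → E →L[ℝ] E →L[ℝ] ℝ} {V : Set E}

namespace IsLorentzOn

theorem contDiffAt (hG : IsLorentzOn G V) {y : E} (hy : y ∈ V) : ContDiffAt ℝ ∞ G y :=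
  hG.contDiffOn.contDiffAt (hG.isOpen.mem_nhds hy)

theorem hasFDerivAt (hG : IsLorentzOn G V) {y : E} (hy : y ∈ V) :
    HasFDerivAt G (fderiv ℝ G y) y :=
  ((hG.contDiffAt hy).differentiableAt (by simp)).hasFDerivAt

theorem fderiv_symm (hG : IsLorentzOn G V) {y : E} (hy : y ∈ V) (u v w : E) :
    fderiv ℝ G y u v w = fderiv ℝ G y u w v := by
  have h1 : HasFDerivAt (fun z ↦ G z v w) (((fderiv ℝ G y).flip v).flip w) y := by
    simpa using ((hG.hasFDerivAt hy).clm_apply (hasFDerivAt_const v y)).clm_apply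
      (hasFDerivAt_const w y)
  have h2 : HasFDerivAt (fun z ↦ G z w v) (((fderiv ℝ G y).flip w).flip v) y := by
    simpa using ((hG.hasFDerivAt hy).clm_apply (hasFDerivAt_const w y)).clm_apply
      (hasFDerivAt_const v y)
  have h3 : (fun z ↦ G z v w) =ᶠ[𝓝 y] fun z ↦ G z w v := by
    filter_upwards [hG.isOpen.mem_nhds hy] with z hz using (hG.lorentz z hz).symm v w
  exact DFunLike.congr_fun (h1.unique (h2.congr_of_eventuallyEq h3)) u

theorem lcLower_symm (hG : IsLorentzOn G V) {y : E} (hy : y ∈ V) (u v : E) :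
    lcLower G y u v = lcLower G y v u := by
  ext w
  rw [lcLower_apply, lcLower_apply, hG.fderiv_symm hy w u v]
  ring

theorem leviCivita_symm (hG : IsLorentzOn G V) {y : E} (hy : y ∈ V) (u v : E) :
    leviCivita G y u v = leviCivita G y v u := by
  rw [leviCivita_apply, leviCivita_apply, hG.lcLower_symm hy]

variable [FiniteDimensional ℝ E]

theorem metric_leviCivita (hG : IsLorentzOn G V) {y : E} (hy : y ∈ V) (u v w : E) :
    G y (leviCivita G y u v) w = lcLower G y u v w := by
  rw [leviCivita_apply, (hG.lorentz y hy).isInvertible.self_apply_inverse]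

/-- The Levi-Civita connection is metric. -/
theorem fderiv_metric (hG : IsLorentzOn G V) {y : E} (hy : y ∈ V) (u v w : E) :
    fderiv ℝ G y u v w = G y (leviCivita G y u v) w + G y v (leviCivita G y u w) := by
  rw [hG.metric_leviCivita hy, (hG.lorentz y hy).symm v, hG.metric_leviCivita hy,
    lcLower_apply, lcLower_apply, hG.fderiv_symm hy u w v]
  ring

/-- The Levi-Civita connection is the only symmetric metric connection. -/
theorem leviCivita_unique (hG : IsLorentzOn G V) {y : E} (hy : y ∈ V) {C : E → E → E}
    (hC : ∀ u v, C u v = C v u)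
    (hm : ∀ u v w, fderiv ℝ G y u v w = G y (C u v) w + G y v (C u w)) (u v : E) :
    C u v = leviCivita G y u v := by
  have hb := hG.lorentz y hy
  rw [← sub_eq_zero]
  refine hb.eq_zero fun w ↦ ?_
  -- Koszul's formula: three permuted instances of `hm` combine, by the symmetry of `C`, into the
  -- lowered Christoffel symbol.
  rw [map_sub, sub_apply, hG.metric_leviCivita hy, lcLower_apply, hm u v w,
    hm v u w, hm w u v, hC v u, hC w u, hC w v, hb.symm u (C v w), hb.symm v (C u w)]
  ring

theorem contDiffOn_leviCivita (hG : IsLorentzOn G V) : ContDiffOn ℝ ∞ (leviCivita G) V := by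
  intro y hy
  refine ContDiffAt.contDiffWithinAt ?_
  have hD : ContDiffAt ℝ ∞ (fderiv ℝ G) y :=
    (hG.contDiffAt hy).fderiv_right (m := ∞) (by simp)
  have hflip : ContDiffAt ℝ ∞ (fun y ↦ (fderiv ℝ G y).flip) y :=
    (ContinuousLinearMap.flipₗᵢ ℝ E E (E →L[ℝ] ℝ)).contDiff.contDiffAt.comp y hD
  have hflip2 : ContDiffAt ℝ ∞ (fun y ↦ flipLast (fderiv ℝ G y).flip) y :=
    contDiffAt_const.clm_comp hflip
  have hlow : ContDiffAt ℝ ∞ (lcLower G) y := ((hD.add hflip).sub hflip2).const_smul _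
  have hinv : ContDiffAt ℝ ∞ (fun y ↦ (G y).inverse) y := by
    obtain ⟨e, he⟩ := (hG.lorentz y hy).isInvertible
    have : ContDiffAt ℝ ∞ ContinuousLinearMap.inverse (G y) := he ▸ contDiffAt_map_inverse e
    exact this.comp y (hG.contDiffAt hy)
  exact ((ContinuousLinearMap.compL ℝ E (E →L[ℝ] ℝ) E).contDiff.contDiffAt.comp y hinv).clm_comp
    hlow

theorem hasFDerivAt_leviCivita (hG : IsLorentzOn G V) {y : E} (hy : y ∈ V) :
    HasFDerivAt (leviCivita G) (fderiv ℝ (leviCivita G) y) y :=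
  ((hG.contDiffOn_leviCivita.contDiffAt (hG.isOpen.mem_nhds hy)).differentiableAt
    (by simp)).hasFDerivAt

theorem fderiv_leviCivita_symm (hG : IsLorentzOn G V) {y : E} (hy : y ∈ V) (u v w : E) :
    fderiv ℝ (leviCivita G) y u v w = fderiv ℝ (leviCivita G) y u w v := by
  have h1 : ∀ v w, HasFDerivAt (fun z ↦ leviCivita G z v w)
      (((fderiv ℝ (leviCivita G) y).flip v).flip w) y := fun v w ↦ by
    simpa using ((hG.hasFDerivAt_leviCivita hy).clm_apply (hasFDerivAt_const v y)).clm_apply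
      (hasFDerivAt_const w y)
  have h3 : (fun z ↦ leviCivita G z v w) =ᶠ[𝓝 y] fun z ↦ leviCivita G z w v := by
    filter_upwards [hG.isOpen.mem_nhds hy] with z hz using hG.leviCivita_symm hz v w
  exact DFunLike.congr_fun ((h1 v w).unique ((h1 w v).congr_of_eventuallyEq h3)) u

/-- The Riemann tensor is skew in its last two arguments. -/
theorem metric_riemann (hG : IsLorentzOn G V) {y : E} (hy : y ∈ V) (t u v w : E) :
    G y (riemann G y t u v) w = -G y v (riemann G y t u w) := by
  have hΓ : ∀ u v, HasFDerivAt (fun z ↦ leviCivita G z u v)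
      (((fderiv ℝ (leviCivita G) y).flip u).flip v) y := fun u v ↦ by
    simpa using ((hG.hasFDerivAt_leviCivita hy).clm_apply (hasFDerivAt_const u y)).clm_apply
      (hasFDerivAt_const v y)
  have hG' : ∀ {a b : E → E} {a' b' : E →L[ℝ] E}, HasFDerivAt a a' y → HasFDerivAt b b' y →
      ∀ t, fderiv ℝ (fun z ↦ G z (a z) (b z)) y t =
        fderiv ℝ G y t (a y) (b y) + G y (a' t) (b y) + G y (a y) (b' t) := by
    intro a b a' b' ha hb t
    rw [(((hG.hasFDerivAt hy).clm_apply ha).clm_apply hb).fderiv]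
    simp
    ring
  have hD : ∀ t u, fderiv ℝ (fun z ↦ fderiv ℝ G z u v w) y t =
      fderiv ℝ (fderiv ℝ G) y t u v w := fun t u ↦ by
    have h2 : HasFDerivAt (fderiv ℝ G) (fderiv ℝ (fderiv ℝ G) y) y :=
      (((hG.contDiffAt hy).fderiv_right (m := ∞) (by simp)).differentiableAt
        (by simp)).hasFDerivAt
    rw [(((h2.clm_apply (hasFDerivAt_const u y)).clm_apply (hasFDerivAt_const v y)).clm_apply
      (hasFDerivAt_const w y)).fderiv]
    simp
  -- Differentiating metric compatibility expresses the second derivative of the metric through `Γ`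
  -- and its derivative; its symmetry in `t` and `u` is the skewness of the curvature.
  have key : ∀ t u, fderiv ℝ (fderiv ℝ G) y t u v w =
      (fderiv ℝ G y t (leviCivita G y u v) w
        + G y (fderiv ℝ (leviCivita G) y t u v) w)
      + (fderiv ℝ G y t v (leviCivita G y u w)
        + G y v (fderiv ℝ (leviCivita G) y t u w)) := fun t u ↦ by
    have h3 : (fun z ↦ fderiv ℝ G z u v w) =ᶠ[𝓝 y] fun z ↦
        G z (leviCivita G z u v) w + G z v (leviCivita G z u w) := by
      filter_upwards [hG.isOpen.mem_nhds hy] with z hz using hG.fderiv_metric hz u v w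
    rw [← hD, h3.fderiv_eq]
    have d1 := ((hG.hasFDerivAt hy).clm_apply (hΓ u v)).clm_apply (hasFDerivAt_const w y)
    have d2 := ((hG.hasFDerivAt hy).clm_apply (hasFDerivAt_const v y)).clm_apply (hΓ u w)
    rw [fderiv_fun_add d1.differentiableAt d2.differentiableAt, add_apply,
      hG' (hΓ u v) (hasFDerivAt_const w y), hG' (hasFDerivAt_const v y) (hΓ u w)]
    simp
  have hs : fderiv ℝ (fderiv ℝ G) y t u v w = fderiv ℝ (fderiv ℝ G) y u t v w := by
    rw [((hG.contDiffAt hy).isSymmSndFDerivAt minSmoothness_two_le) t u]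
  rw [key, key] at hs
  simp only [hG.fderiv_metric hy] at hs
  simp only [riemann_apply, map_sub, map_add, sub_apply, add_apply]
  linarith

/-- First Bianchi identity, in the form needed for the symmetry of the Ricci tensor. The terms pair
off because `Γ` and its derivative are symmetric in the lower arguments. -/
theorem riemann_bianchi (hG : IsLorentzOn G V) {y : E} (hy : y ∈ V) (u v w : E) :
    riemann G y u v w - riemann G y u w v = -riemann G y v w u := by
  simp only [riemann_apply]
  rw [hG.fderiv_leviCivita_symm hy u v w, hG.fderiv_leviCivita_symm hy v u w,
    hG.fderiv_leviCivita_symm hy w v u, hG.leviCivita_symm hy v w, hG.leviCivita_symm hy u w,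
    hG.leviCivita_symm hy v u]
  abel

end IsLorentzOn

/-- The Ricci tensor of a metric on the model space. -/
def ricciAt (G : E → E →L[ℝ] E →L[ℝ] ℝ) (y v w : E) : ℝ :=
  LinearMap.trace ℝ E (((riemann G y).flip v).flip w : E →L[ℝ] E)

/-- By the Bianchi identity the difference of the two sides is the trace of `-R(v, w)`, an operator
skew for the metric. -/
theorem IsLorentzOn.ricciAt_symm [FiniteDimensional ℝ E] (hG : IsLorentzOn G V) {y : E}
    (hy : y ∈ V) (v w : E) : ricciAt G y v w = ricciAt G y w v := by
  have h : ((((riemann G y).flip v).flip w : E →L[ℝ] E) : E →ₗ[ℝ] E) -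
      (((riemann G y).flip w).flip v : E →L[ℝ] E) = -((riemann G y v w : E →L[ℝ] E) :) := by
    ext u
    exact hG.riemann_bianchi hy u v w
  rw [ricciAt, ricciAt, ← sub_eq_zero, ← map_sub, h, map_neg, neg_eq_zero]
  exact trace_eq_zero_of_skew (hG.lorentz y hy) fun a b ↦ hG.metric_riemann hy v w a b

end LocalMetric

end NullSurface

end

noncomputable section

namespace NullSurface

/-! ### Covariant derivative along a map, second form and Weingarten map of a hypersurface -/

section LocalHypersurface

variable {E : Type*} [NormedAddCommGroup E] [NormedSpace ℝ E]
  {F : Type*} [NormedAddCommGroup F] [NormedSpace ℝ F]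

/-- The covariant derivative along `f : F → E` of a vector field `V` along `f`. -/
def covD (G : E → E →L[ℝ] E →L[ℝ] ℝ) (f : F → E) (V : F → E) (y : F) : F →L[ℝ] E :=
  fderiv ℝ V y + (leviCivita G (f y)).flip (V y) ∘L fderiv ℝ f y

theorem covD_apply (G : E → E →L[ℝ] E →L[ℝ] ℝ) (f : F → E) (V : F → E) (y X : F) :
    covD G f V y X = fderiv ℝ V y X + leviCivita G (f y) (fderiv ℝ f y X) (V y) :=
  rfl

/-- The derivative `∇_X f_* Y` of the push-forward of a constant field `Y`. -/
def secondForm (G : E → E →L[ℝ] E →L[ℝ] ℝ) (f : F → E) (y : F) : F →L[ℝ] F →L[ℝ] E :=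
  fderiv ℝ (fderiv ℝ f) y +
    (ContinuousLinearMap.precomp E (fderiv ℝ f y)) ∘L leviCivita G (f y) ∘L fderiv ℝ f y

theorem secondForm_apply (G : E → E →L[ℝ] E →L[ℝ] ℝ) (f : F → E) (y X Y : F) :
    secondForm G f y X Y = fderiv ℝ (fderiv ℝ f) y X Y +
      leviCivita G (f y) (fderiv ℝ f y X) (fderiv ℝ f y Y) :=
  rfl

/-- A smooth map `f` from an open set `W` to a Lorentzian domain. -/
structure IsMapInto (G : E → E →L[ℝ] E →L[ℝ] ℝ) (V : Set E) (f : F → E) (W : Set F) :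
    Prop where
  metric : IsLorentzOn G V
  isOpen : IsOpen W
  mapsTo : ∀ y ∈ W, f y ∈ V
  contDiffOn : ContDiffOn ℝ ∞ f W

/-- A smooth immersed hypersurface `f`, defined on the open set `W`, of a Lorentzian domain. -/
structure IsHypersurface (G : E → E →L[ℝ] E →L[ℝ] ℝ) (V : Set E) (f : F → E) (W : Set F) :
    Prop extends IsMapInto G V f W where
  injective : ∀ y ∈ W, Function.Injective (fderiv ℝ f y)
  finrank : Module.finrank ℝ E = Module.finrank ℝ F + 1

/-- A nowhere vanishing null field of a hypersurface. -/
structure IsNullFieldIn (G : E → E →L[ℝ] E →L[ℝ] ℝ) (f : F → E) (W : Set F) (ℓ : F → F) :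
    Prop where
  contDiffOn : ContDiffOn ℝ ∞ ℓ W
  ne_zero : ∀ y ∈ W, ℓ y ≠ 0
  null : ∀ y ∈ W, ∀ X, G (f y) (fderiv ℝ f y (ℓ y)) (fderiv ℝ f y X) = 0

variable {G : E → E →L[ℝ] E →L[ℝ] ℝ} {V : Set E} {f : F → E} {W : Set F} {ℓ : F → F}

namespace IsMapInto

theorem contDiffAt (hS : IsMapInto G V f W) {y : F} (hy : y ∈ W) : ContDiffAt ℝ ∞ f y :=
  hS.contDiffOn.contDiffAt (hS.isOpen.mem_nhds hy)

theorem contDiffAt_fderiv (hS : IsMapInto G V f W) {y : F} (hy : y ∈ W) :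
    ContDiffAt ℝ ∞ (fderiv ℝ f) y :=
  (hS.contDiffAt hy).fderiv_right (m := ∞) (by simp)

theorem hasFDerivAt (hS : IsMapInto G V f W) {y : F} (hy : y ∈ W) :
    HasFDerivAt f (fderiv ℝ f y) y :=
  ((hS.contDiffAt hy).differentiableAt (by simp)).hasFDerivAt

theorem hasFDerivAt_fderiv (hS : IsMapInto G V f W) {y : F} (hy : y ∈ W) :
    HasFDerivAt (fderiv ℝ f) (fderiv ℝ (fderiv ℝ f) y) y :=
  ((hS.contDiffAt_fderiv hy).differentiableAt (by simp)).hasFDerivAt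

theorem secondForm_symm (hS : IsMapInto G V f W) {y : F} (hy : y ∈ W) (X Y : F) :
    secondForm G f y X Y = secondForm G f y Y X := by
  rw [secondForm_apply, secondForm_apply, hS.metric.leviCivita_symm (hS.mapsTo y hy),
    ((hS.contDiffAt hy).isSymmSndFDerivAt minSmoothness_two_le) X Y]

/-- Leibniz rule: `∇_X f_*Y` is a visibly tangent term plus a term tensorial in `Y`, the only one
that can leave the tangent space. -/
theorem covD_push (hS : IsMapInto G V f W) {y : F} (hy : y ∈ W) {Y : F → F}
    (hY : DifferentiableAt ℝ Y y) (X : F) :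
    covD G f (fun z ↦ fderiv ℝ f z (Y z)) y X =
      fderiv ℝ f y (fderiv ℝ Y y X) + secondForm G f y X (Y y) := by
  rw [covD_apply, secondForm_apply,
    ((hS.hasFDerivAt_fderiv hy).clm_apply hY.hasFDerivAt).fderiv]
  simp
  abel

variable [FiniteDimensional ℝ E]

theorem contDiffAt_leviCivita (hS : IsMapInto G V f W) {y : F} (hy : y ∈ W) :
    ContDiffAt ℝ ∞ (fun z ↦ leviCivita G (f z)) y :=
  ContDiffAt.comp y (hS.metric.contDiffOn_leviCivita.contDiffAt
    (hS.metric.isOpen.mem_nhds (hS.mapsTo y hy))) (hS.contDiffAt hy)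

theorem contDiffAt_covD (hS : IsMapInto G V f W) {y : F} (hy : y ∈ W) {U : F → E}
    (hU : ContDiffAt ℝ ∞ U y) : ContDiffAt ℝ ∞ (covD G f U) y := by
  have h1 : ContDiffAt ℝ ∞ (fun z ↦ (leviCivita G (f z)).flip) y :=
    (ContinuousLinearMap.flipₗᵢ ℝ E E E).contDiff.contDiffAt.comp y (hS.contDiffAt_leviCivita hy)
  exact (hU.fderiv_right (m := ∞) (by simp)).add
    ((h1.clm_apply hU).clm_comp (hS.contDiffAt_fderiv hy))

/-- The covariant derivative along a hypersurface is metric. -/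
theorem fderiv_metric (hS : IsMapInto G V f W) {y : F} (hy : y ∈ W) {U U' : F → E}
    (hU : DifferentiableAt ℝ U y) (hU' : DifferentiableAt ℝ U' y) (X : F) :
    fderiv ℝ (fun z ↦ G (f z) (U z) (U' z)) y X =
      G (f y) (covD G f U y X) (U' y) + G (f y) (U y) (covD G f U' y X) := by
  have h := (((hS.metric.hasFDerivAt (hS.mapsTo y hy)).comp y (hS.hasFDerivAt hy)).clm_apply
    hU.hasFDerivAt).clm_apply hU'.hasFDerivAt
  have h' : fderiv ℝ (fun z ↦ G (f z) (U z) (U' z)) y = _ := h.fderiv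
  rw [h', covD_apply, covD_apply]
  simp [hS.metric.fderiv_metric (hS.mapsTo y hy)]
  ring

/-- The commutator of covariant derivatives is the curvature. -/
theorem covD_covD_sub (hS : IsMapInto G V f W) {y : F} (hy : y ∈ W) {U : F → E}
    (hU : ContDiffAt ℝ ∞ U y) (X Y : F) :
    covD G f (fun z ↦ covD G f U z Y) y X - covD G f (fun z ↦ covD G f U z X) y Y =
      riemann G (f y) (fderiv ℝ f y X) (fderiv ℝ f y Y) (U y) := by
  have hU1 : HasFDerivAt U (fderiv ℝ U y) y := (hU.differentiableAt (by simp)).hasFDerivAt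
  have hU2 : HasFDerivAt (fderiv ℝ U) (fderiv ℝ (fderiv ℝ U) y) y :=
    ((hU.fderiv_right (m := ∞) (by simp)).differentiableAt (by simp)).hasFDerivAt
  -- `X` and `Y` are constant fields, so no bracket enters. In the commutator the second derivatives
  -- of `U` and `f` cancel by symmetry, and the cross terms cancel against those of the outer
  -- connection.
  have key : ∀ X Y, fderiv ℝ (fun z ↦ covD G f U z Y) y X =
      fderiv ℝ (fderiv ℝ U) y X Y
      + (fderiv ℝ (leviCivita G) (f y) (fderiv ℝ f y X) (fderiv ℝ f y Y) (U y)
      + leviCivita G (f y) (fderiv ℝ (fderiv ℝ f) y X Y) (U y)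
      + leviCivita G (f y) (fderiv ℝ f y Y) (fderiv ℝ U y X)) := by
    intro X Y
    have d1 := hU2.clm_apply (hasFDerivAt_const Y y)
    have d2 := (((hS.metric.hasFDerivAt_leviCivita (hS.mapsTo y hy)).comp y
      (hS.hasFDerivAt hy)).clm_apply ((hS.hasFDerivAt_fderiv hy).clm_apply
      (hasFDerivAt_const Y y))).clm_apply hU1
    have h : fderiv ℝ (fun z ↦ covD G f U z Y) y = _ := (d1.add d2).fderiv
    rw [h]
    simp
    abel
  rw [covD_apply G f (fun z ↦ covD G f U z Y), covD_apply G f (fun z ↦ covD G f U z X), key, key,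
    riemann_apply]
  simp only [covD_apply, map_add]
  rw [((hS.contDiffAt hy).isSymmSndFDerivAt minSmoothness_two_le) X Y,
    (hU.isSymmSndFDerivAt minSmoothness_two_le) X Y]
  abel

end IsMapInto

namespace IsHypersurface

theorem push_ne_zero (hS : IsHypersurface G V f W) (hℓ : IsNullFieldIn G f W ℓ) {y : F}
    (hy : y ∈ W) : fderiv ℝ f y (ℓ y) ≠ 0 := fun h ↦
  hℓ.ne_zero y hy (hS.injective y hy (by rw [h, map_zero]))

theorem contDiffAt_push (hS : IsHypersurface G V f W) (hℓ : IsNullFieldIn G f W ℓ) {y : F}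
    (hy : y ∈ W) : ContDiffAt ℝ ∞ (fun z ↦ fderiv ℝ f z (ℓ z)) y :=
  (hS.contDiffAt_fderiv hy).clm_apply (hℓ.contDiffOn.contDiffAt (hS.isOpen.mem_nhds hy))

/-- A tangent vector orthogonal to the hypersurface is proportional to the null field. -/
theorem exists_smul_of_orthogonal (hS : IsHypersurface G V f W) (hℓ : IsNullFieldIn G f W ℓ)
    {y : F} (hy : y ∈ W) {Z : F} (hZ : G (f y) (fderiv ℝ f y Z) (fderiv ℝ f y Z) = 0) :
    ∃ r : ℝ, Z = r • ℓ y := by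
  obtain ⟨r, hr⟩ := (hS.metric.lorentz _ (hS.mapsTo y hy)).exists_smul_eq_of_null
    (hS.push_ne_zero hℓ hy) (hℓ.null y hy _) hZ.le (hℓ.null y hy _)
  exact ⟨r, hS.injective y hy (by rw [hr, map_smul])⟩

variable [FiniteDimensional ℝ E]

/-- Differentiate `g(f_*ℓ, f_*Y) = 0` with `Y` constant. The right side shows that the tensor is
symmetric in `X`, `Y` and depends on `ℓ` only through its value at `y`. -/
theorem metric_covD_push (hS : IsHypersurface G V f W) (hℓ : IsNullFieldIn G f W ℓ) {y : F}
    (hy : y ∈ W) (X Y : F) :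
    G (f y) (covD G f (fun z ↦ fderiv ℝ f z (ℓ z)) y X) (fderiv ℝ f y Y) =
      -G (f y) (fderiv ℝ f y (ℓ y)) (secondForm G f y X Y) := by
  have h := hS.fderiv_metric hy ((hS.contDiffAt_push hℓ hy).differentiableAt (by simp))
    (((hS.contDiffAt_fderiv hy).differentiableAt (by simp)).clm_apply
      (differentiableAt_const Y)) X
  have h0 : (fun z ↦ G (f z) (fderiv ℝ f z (ℓ z)) (fderiv ℝ f z Y)) =ᶠ[𝓝 y] fun _ ↦ 0 := by
    filter_upwards [hS.isOpen.mem_nhds hy] with z hz using hℓ.null z hz Y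
  have hc := hS.covD_push hy (differentiableAt_const (x := y) Y) X
  simp only [fderiv_fun_const, Pi.zero_apply, zero_apply, map_zero, zero_add] at hc
  rw [h0.fderiv_eq, hc] at h
  simp at h
  linarith

/-- Half the derivative of `g(k, k) = 0`, where `k = f_*ℓ`. -/
theorem metric_covD_push_self (hS : IsHypersurface G V f W) (hℓ : IsNullFieldIn G f W ℓ) {y : F}
    (hy : y ∈ W) (X : F) :
    G (f y) (covD G f (fun z ↦ fderiv ℝ f z (ℓ z)) y X) (fderiv ℝ f y (ℓ y)) = 0 := by
  have hk := (hS.contDiffAt_push hℓ hy).differentiableAt (by simp)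
  have h := hS.fderiv_metric hy hk hk X
  have h0 : (fun z ↦ G (f z) (fderiv ℝ f z (ℓ z)) (fderiv ℝ f z (ℓ z))) =ᶠ[𝓝 y] fun _ ↦ 0 := by
    filter_upwards [hS.isOpen.mem_nhds hy] with z hz using hℓ.null z hz _
  rw [h0.fderiv_eq, (hS.metric.lorentz _ (hS.mapsTo y hy)).symm (fderiv ℝ f y (ℓ y))] at h
  simp at h
  linarith

variable [FiniteDimensional ℝ F]

/-- The null normal is itself tangent, and by dimension the tangent space is exactly its orthogonal
complement. -/
theorem exists_eq_of_orthogonal (hS : IsHypersurface G V f W) (hℓ : IsNullFieldIn G f W ℓ)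
    {y : F} (hy : y ∈ W) {u : E} (hu : G (f y) (fderiv ℝ f y (ℓ y)) u = 0) :
    ∃ Z, fderiv ℝ f y Z = u :=
  (hS.metric.lorentz _ (hS.mapsTo y hy)).mem_range_of_orthogonal (hS.injective y hy) hS.finrank
    (hS.push_ne_zero hℓ hy) (hℓ.null y hy) hu

theorem exists_covD_eq (hS : IsHypersurface G V f W) (hℓ : IsNullFieldIn G f W ℓ)
    {y : F} (hy : y ∈ W) (X : F) :
    ∃ Z, fderiv ℝ f y Z = covD G f (fun z ↦ fderiv ℝ f z (ℓ z)) y X :=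
  hS.exists_eq_of_orthogonal hℓ hy (by
    rw [(hS.metric.lorentz _ (hS.mapsTo y hy)).symm, hS.metric_covD_push_self hℓ hy])

/-- The Weingarten map of a null field. -/
theorem exists_weingarten (hS : IsHypersurface G V f W) (hℓ : IsNullFieldIn G f W ℓ)
    {y : F} (hy : y ∈ W) : ∃ S : F → F →L[ℝ] F, ContDiffAt ℝ ∞ S y ∧
      ∀ᶠ z in 𝓝 y, ∀ X, fderiv ℝ f z (S z X) = covD G f (fun z ↦ fderiv ℝ f z (ℓ z)) z X := by
  -- `P` is a left inverse of the derivative of `f` at `y` only. Nearby `P ∘L fderiv ℝ f z` stays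
  -- invertible, and its inverse corrects `P` to a left inverse depending smoothly on `z`.
  obtain ⟨P₀, hP₀⟩ := LinearMap.exists_leftInverse_of_injective (fderiv ℝ f y : F →ₗ[ℝ] E)
    (LinearMap.ker_eq_bot.2 (hS.injective y hy))
  let P : E →L[ℝ] F := LinearMap.toContinuousLinearMap P₀
  have hP : P ∘L fderiv ℝ f y = ContinuousLinearMap.id ℝ F := by
    ext X
    exact LinearMap.congr_fun hP₀ X
  have hcomp : ContDiffAt ℝ ∞ (fun z ↦ P ∘L fderiv ℝ f z) y :=
    contDiffAt_const.clm_comp (hS.contDiffAt_fderiv hy)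
  have hinv : ContDiffAt ℝ ∞ (fun z ↦ (P ∘L fderiv ℝ f z).inverse) y := by
    have h1 : ContDiffAt ℝ ∞ ContinuousLinearMap.inverse (P ∘L fderiv ℝ f y) := by
      rw [hP]
      exact contDiffAt_map_inverse (ContinuousLinearEquiv.refl ℝ F)
    exact h1.comp y hcomp
  have hev : ∀ᶠ z in 𝓝 y, (P ∘L fderiv ℝ f z).IsInvertible := by
    have h1 : ∀ᶠ A in 𝓝 (P ∘L fderiv ℝ f y), A.IsInvertible := by
      rw [hP]
      exact (ContinuousLinearEquiv.nhds (ContinuousLinearEquiv.refl ℝ F))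
    exact hcomp.continuousAt.eventually h1
  refine ⟨fun z ↦ (P ∘L fderiv ℝ f z).inverse ∘L P ∘L
    covD G f (fun z ↦ fderiv ℝ f z (ℓ z)) z, hinv.clm_comp (contDiffAt_const.clm_comp
      (hS.contDiffAt_covD hy (hS.contDiffAt_push hℓ hy))), ?_⟩
  filter_upwards [hev, hS.isOpen.mem_nhds hy] with z hz hzW X
  obtain ⟨Z, hZ⟩ := hS.exists_covD_eq hℓ hzW X
  rw [← hZ]
  congr 1
  change (P ∘L fderiv ℝ f z).inverse (P (covD G f (fun z ↦ fderiv ℝ f z (ℓ z)) z X)) = Z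
  rw [← hZ]
  exact hz.inverse_apply_self Z

end IsHypersurface

end LocalHypersurface

end NullSurface

end

noncomputable section

namespace NullSurface

/-! ### Raychaudhuri's equation, absence of shear, and curvature of the rotation potential -/

section Raychaudhuri

variable {E : Type*} [NormedAddCommGroup E] [NormedSpace ℝ E]
  {F : Type*} [NormedAddCommGroup F] [NormedSpace ℝ F]
  {G : E → E →L[ℝ] E →L[ℝ] ℝ} {V : Set E} {f : F → E} {W : Set F} {ℓ : F → F}

theorem covD_congr {U U' : F → E} {y : F} (h : U =ᶠ[𝓝 y] U') : covD G f U y = covD G f U' y := by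
  rw [covD, covD, h.fderiv_eq, h.eq_of_nhds]

namespace IsHypersurface

variable [FiniteDimensional ℝ E]

/-- The null generators are pregeodesic. By symmetry of the second form, `∇_ℓ k` pairs with a
tangent vector `Y` as `∇_Y k` pairs with `k`, that is, to zero; so `S ℓ` is null and therefore a
multiple of `ℓ`. -/
theorem exists_weingarten_apply_null (hS : IsHypersurface G V f W)
    (hℓ : IsNullFieldIn G f W ℓ) {y : F} (hy : y ∈ W) {S : F →L[ℝ] F}
    (hSA : ∀ X, fderiv ℝ f y (S X) = covD G f (fun z ↦ fderiv ℝ f z (ℓ z)) y X) :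
    ∃ κ : ℝ, S (ℓ y) = κ • ℓ y := by
  refine hS.exists_smul_of_orthogonal hℓ hy ?_
  nth_rewrite 1 [hSA]
  rw [hS.metric_covD_push hℓ hy, hS.secondForm_symm hy, ← hS.metric_covD_push hℓ hy,
    hS.metric_covD_push_self hℓ hy]

/-- The curvature in terms of the rotation potential. -/
theorem riemann_of_rotation (hS : IsHypersurface G V f W) (hℓ : IsNullFieldIn G f W ℓ) {y : F}
    (hy : y ∈ W) {η : F → F →L[ℝ] ℝ} (hηd : DifferentiableAt ℝ η y)
    (hη : ∀ᶠ z in 𝓝 y, ∀ X, covD G f (fun z ↦ fderiv ℝ f z (ℓ z)) z X =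
      η z X • fderiv ℝ f z (ℓ z)) (X Y : F) :
    riemann G (f y) (fderiv ℝ f y X) (fderiv ℝ f y Y) (fderiv ℝ f y (ℓ y)) =
      (fderiv ℝ η y X Y - fderiv ℝ η y Y X) • fderiv ℝ f y (ℓ y) := by
  set k : F → E := fun z ↦ fderiv ℝ f z (ℓ z) with hk
  have hkd : ContDiffAt ℝ ∞ k y := hS.contDiffAt_push hℓ hy
  -- The product of the two values of `η` is symmetric and drops out of the commutator, leaving the
  -- exterior derivative of `η`.
  have key : ∀ X Y, covD G f (fun z ↦ covD G f k z Y) y X =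
      fderiv ℝ η y X Y • k y + (η y Y * η y X) • k y := fun X Y ↦ by
    have e1 : (fun z ↦ covD G f k z Y) =ᶠ[𝓝 y] fun z ↦ η z Y • k z := by
      filter_upwards [hη] with z hz using hz Y
    rw [mul_smul, ← hη.self_of_nhds X, covD_congr e1, covD_apply,
      ((hηd.hasFDerivAt.clm_apply (hasFDerivAt_const Y y)).fun_smul
        (hkd.differentiableAt (by simp)).hasFDerivAt).fderiv, covD_apply]
    simp
    abel
  rw [← hS.covD_covD_sub hy hkd, key, key, sub_smul, mul_comm (η y Y)]
  abel

/-- Riccati equation of the Weingarten map, written as the image of a tangent endomorphism so that a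
trace can be taken. It is the commutator of `∇_X` and `∇_ℓ` on `k`, with `X` and `ℓ y` frozen to
constant fields; the freezing accounts for the derivatives of `ℓ`. -/
theorem riemann_push_null (hS : IsHypersurface G V f W) (hℓ : IsNullFieldIn G f W ℓ) {y : F}
    (hy : y ∈ W) {S : F → F →L[ℝ] F} (hSd : ContDiffAt ℝ ∞ S y)
    (hSA : ∀ᶠ z in 𝓝 y, ∀ X, fderiv ℝ f z (S z X) = covD G f (fun z ↦ fderiv ℝ f z (ℓ z)) z X)
    {κ : F → ℝ} (hκ : DifferentiableAt ℝ κ y) (hSκ : ∀ᶠ z in 𝓝 y, S z (ℓ z) = κ z • ℓ z) (X : F) :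
    riemann G (f y) (fderiv ℝ f y X) (fderiv ℝ f y (ℓ y)) (fderiv ℝ f y (ℓ y)) =
      fderiv ℝ f y (fderiv ℝ κ y X • ℓ y + κ y • S y X - S y (fderiv ℝ ℓ y X)
        - fderiv ℝ S y (ℓ y) X - S y (S y X) + fderiv ℝ ℓ y (S y X)) := by
  set k : F → E := fun z ↦ fderiv ℝ f z (ℓ z) with hk
  have hkd : ContDiffAt ℝ ∞ k y := hS.contDiffAt_push hℓ hy
  have hℓd : HasFDerivAt ℓ (fderiv ℝ ℓ y) y :=
    ((hℓ.contDiffOn.contDiffAt (hS.isOpen.mem_nhds hy)).differentiableAt (by simp)).hasFDerivAt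
  have hA : HasFDerivAt (covD G f k) (fderiv ℝ (covD G f k) y) y :=
    ((hS.contDiffAt_covD hy hkd).differentiableAt (by simp)).hasFDerivAt
  have hSy := hSA.self_of_nhds
  have hκy := hSκ.self_of_nhds
  have hAk : covD G f k y (ℓ y) = κ y • k y := by rw [← hSy, hκy, map_smul]
  have h1 : covD G f (fun z ↦ covD G f k z (ℓ y)) y X =
      fderiv ℝ κ y X • k y + κ y • covD G f k y X - covD G f k y (fderiv ℝ ℓ y X) := by
    -- The relation `∇_ℓ k = κ k` has a varying `ℓ`; freezing it at `y` costs the term in `fderiv ℝ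
    -- ℓ y X`.
    have e1 : (fun z ↦ covD G f k z (ℓ z)) =ᶠ[𝓝 y] fun z ↦ κ z • k z := by
      filter_upwards [hSA, hSκ] with z hz hz'
      rw [← hz, hz']
      exact ContinuousLinearMap.map_smul _ _ _
    have e2 := e1.fderiv_eq (𝕜 := ℝ)
    rw [(hA.clm_apply hℓd).fderiv,
      (hκ.hasFDerivAt.fun_smul (hkd.differentiableAt (by simp)).hasFDerivAt).fderiv] at e2
    have e3 := DFunLike.congr_fun e2 X
    simp at e3
    rw [covD_apply, (hA.clm_apply (hasFDerivAt_const (ℓ y) y)).fderiv, hAk]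
    simp [covD_apply G f k y X]
    rw [eq_sub_of_add_eq e3]
    module
  -- Symmetry of the second form trades `∇_ℓ f_*(S X)` for `∇_{S X} k`, up to derivatives of
  -- components.
  have h2 : covD G f (fun z ↦ covD G f k z X) y (ℓ y) =
      fderiv ℝ f y (fderiv ℝ S y (ℓ y) X) + covD G f k y (S y X)
        - fderiv ℝ f y (fderiv ℝ ℓ y (S y X)) := by
    have e1 : (fun z ↦ covD G f k z X) =ᶠ[𝓝 y] fun z ↦ fderiv ℝ f z (S z X) := by
      filter_upwards [hSA] with z hz using (hz X).symm
    have hSX := (hSd.differentiableAt (by simp)).hasFDerivAt.clm_apply (hasFDerivAt_const X y)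
    rw [covD_congr e1, hS.covD_push hy hSX.differentiableAt, hSX.fderiv,
      hS.secondForm_symm hy, hS.covD_push hy hℓd.differentiableAt (S y X)]
    simp
    abel
  rw [← hS.covD_covD_sub hy hkd, h1, h2]
  simp only [map_add, map_sub, map_smul, hSy]
  abel

variable [FiniteDimensional ℝ F]

/-- For a non-expanding null field, the trace of the Weingarten map is the surface gravity. -/
theorem weingarten_apply_null (hS : IsHypersurface G V f W)
    (hℓ : IsNullFieldIn G f W ℓ) {y : F} (hy : y ∈ W) {S : F →L[ℝ] F}
    (hSA : ∀ X, fderiv ℝ f y (S X) = covD G f (fun z ↦ fderiv ℝ f z (ℓ z)) y X)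
    {e : Fin (Module.finrank ℝ F - 1) → F}
    (he : ∀ A B, G (f y) (fderiv ℝ f y (e A)) (fderiv ℝ f y (e B)) = if A = B then 1 else 0)
    (hθ : ∑ A, G (f y) (fderiv ℝ f y (ℓ y)) (secondForm G f y (e A) (e A)) = 0) :
    S (ℓ y) = LinearMap.trace ℝ F (S : F →ₗ[ℝ] F) • ℓ y := by
  obtain ⟨κ, hκ⟩ := hS.exists_weingarten_apply_null hℓ hy hSA
  -- The screen part of the trace of `S` is the expansion, which vanishes.
  have h := trace_eq_screen_sum (q := pullForm (G (f y)) (fderiv ℝ f y)) (hℓ.ne_zero y hy)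
    (fun X ↦ hℓ.null y hy X) (e := e) he S hκ
  simp only [pullForm_apply, hSA, hS.metric_covD_push hℓ hy, Finset.sum_neg_distrib, hθ] at h
  rw [hκ, h]
  simp

/-- The Raychaudhuri equation of a non-expanding null field. -/
theorem ricciAt_push_null (hS : IsHypersurface G V f W) (hℓ : IsNullFieldIn G f W ℓ) {y : F}
    (hy : y ∈ W) {S : F → F →L[ℝ] F} (hSd : ContDiffAt ℝ ∞ S y)
    (hSA : ∀ᶠ z in 𝓝 y, ∀ X, fderiv ℝ f z (S z X) = covD G f (fun z ↦ fderiv ℝ f z (ℓ z)) z X)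
    (hSκ : ∀ᶠ z in 𝓝 y, S z (ℓ z) = LinearMap.trace ℝ F (S z : F →ₗ[ℝ] F) • ℓ z) :
    ricciAt G (f y) (fderiv ℝ f y (ℓ y)) (fderiv ℝ f y (ℓ y)) =
      LinearMap.trace ℝ F (S y : F →ₗ[ℝ] F) ^ 2
        - LinearMap.trace ℝ F ((S y ∘L S y : F →L[ℝ] F) : F →ₗ[ℝ] F) := by
  let tr : (F →L[ℝ] F) →L[ℝ] ℝ := LinearMap.toContinuousLinearMap
    (LinearMap.trace ℝ F ∘ₗ ContinuousLinearMap.coeLM ℝ)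
  have htr : ∀ A : F →L[ℝ] F, tr A = LinearMap.trace ℝ F (A : F →ₗ[ℝ] F) := fun A ↦ rfl
  have hS' := (hSd.differentiableAt (by simp)).hasFDerivAt
  have hκ : HasFDerivAt (fun z ↦ tr (S z)) (tr ∘L fderiv ℝ S y) y :=
    tr.hasFDerivAt.comp y hS'
  have hR := hS.riemann_push_null hℓ hy hSd hSA hκ.differentiableAt hSκ
  let Q : F →L[ℝ] F := (tr ∘L fderiv ℝ S y).smulRight (ℓ y) + tr (S y) • S y
    - S y ∘L fderiv ℝ ℓ y - fderiv ℝ S y (ℓ y) - S y ∘L S y + fderiv ℝ ℓ y ∘L S y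
  have hb := hS.metric.lorentz _ (hS.mapsTo y hy)
  have hric : ricciAt G (f y) (fderiv ℝ f y (ℓ y)) (fderiv ℝ f y (ℓ y)) =
      LinearMap.trace ℝ F (Q : F →ₗ[ℝ] F) := by
    -- The values of `u ↦ R(u, k)k` are orthogonal to `k` by skewness, hence tangent, so the Ricci
    -- trace over `E` reduces to a trace over `F`.
    refine trace_eq_of_comp_eq (A := (fderiv ℝ f y : F →ₗ[ℝ] E)) (hS.injective y hy)
      (fun u ↦ ?_) (fun X ↦ ?_)
    · refine hS.exists_eq_of_orthogonal hℓ hy ?_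
      have h := hS.metric.metric_riemann (hS.mapsTo y hy) u (fderiv ℝ f y (ℓ y))
        (fderiv ℝ f y (ℓ y)) (fderiv ℝ f y (ℓ y))
      rw [hb.symm] at h
      change G (f y) (fderiv ℝ f y (ℓ y))
        (riemann G (f y) u (fderiv ℝ f y (ℓ y)) (fderiv ℝ f y (ℓ y))) = 0
      linarith
    · change riemann G (f y) (fderiv ℝ f y X) (fderiv ℝ f y (ℓ y)) (fderiv ℝ f y (ℓ y)) = _
      rw [hR, hκ.fderiv]
      rfl
  -- Under the trace the two products of `S` with `fderiv ℝ ℓ y` cancel. As `κ` is the trace of `S`,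
  -- the term `dκ ⊗ ℓ` cancels the derivative of `S` along `ℓ`, and no derivative survives.
  have hcomm : tr (S y ∘L fderiv ℝ ℓ y) = tr (fderiv ℝ ℓ y ∘L S y) :=
    LinearMap.trace_mul_comm ℝ (S y : F →ₗ[ℝ] F) (fderiv ℝ ℓ y : F →ₗ[ℝ] F)
  have hsm : tr ((tr ∘L fderiv ℝ S y).smulRight (ℓ y)) = tr (fderiv ℝ S y (ℓ y)) :=
    LinearMap.trace_smulRight ((tr ∘L fderiv ℝ S y : F →L[ℝ] ℝ) : F →ₗ[ℝ] ℝ) (ℓ y)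
  rw [hric, ← htr, ← htr, ← htr]
  simp only [Q, map_add, map_sub, map_smul, hcomm, hsm, smul_eq_mul]
  ring

/-- A non-expanding null hypersurface along which the Ricci tensor satisfies the null energy
condition is shear free. -/
theorem shear_free (hS : IsHypersurface G V f W) (hℓ : IsNullFieldIn G f W ℓ) {y : F}
    (hy : y ∈ W)
    (hθ : ∀ᶠ z in 𝓝 y, ∃ e : Fin (Module.finrank ℝ F - 1) → F,
      (∀ A B, G (f z) (fderiv ℝ f z (e A)) (fderiv ℝ f z (e B)) = if A = B then 1 else 0) ∧
      ∑ A, G (f z) (fderiv ℝ f z (ℓ z)) (secondForm G f z (e A) (e A)) = 0)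
    (hR : 0 ≤ ricciAt G (f y) (fderiv ℝ f y (ℓ y)) (fderiv ℝ f y (ℓ y))) :
    ricciAt G (f y) (fderiv ℝ f y (ℓ y)) (fderiv ℝ f y (ℓ y)) = 0 ∧
      ∀ X Y, G (f y) (fderiv ℝ f y (ℓ y)) (secondForm G f y X Y) = 0 := by
  obtain ⟨S, hSd, hSA⟩ := hS.exists_weingarten hℓ hy
  have hSκ : ∀ᶠ z in 𝓝 y, S z (ℓ z) = LinearMap.trace ℝ F (S z : F →ₗ[ℝ] F) • ℓ z := by
    filter_upwards [hSA, hθ, hS.isOpen.mem_nhds hy] with z hz ⟨e, he, heθ⟩ hzW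
    exact hS.weingarten_apply_null hℓ hzW hz he heθ
  have hric := hS.ricciAt_push_null hℓ hy hSd hSA hSκ
  obtain ⟨e, he, heθ⟩ := hθ.self_of_nhds
  have hSy := hSA.self_of_nhds
  have hκ := hSκ.self_of_nhds
  set κ := LinearMap.trace ℝ F (S y : F →ₗ[ℝ] F)
  have hb := hS.metric.lorentz _ (hS.mapsTo y hy)
  have hsym : ∀ X Y, G (f y) (fderiv ℝ f y (S y X)) (fderiv ℝ f y Y) =
      G (f y) (fderiv ℝ f y X) (fderiv ℝ f y (S y Y)) := fun X Y ↦ by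
    rw [hb.symm (fderiv ℝ f y X), hSy, hSy, hS.metric_covD_push hℓ hy,
      hS.metric_covD_push hℓ hy, hS.secondForm_symm hy]
  -- `S` is self-adjoint for the induced metric, so the trace of `S²` is `κ²` plus the squared
  -- lengths of the `S (e A)`; the Ricci term is minus the sum of these lengths.
  have htr := trace_eq_screen_sum (q := pullForm (G (f y)) (fderiv ℝ f y)) (hℓ.ne_zero y hy)
    (fun X ↦ hℓ.null y hy X) (e := e) he (S y ∘L S y) (κ := κ ^ 2) (by
      simp only [ContinuousLinearMap.comp_apply, hκ, map_smul, smul_smul, sq])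
  simp only [pullForm_apply, ContinuousLinearMap.comp_apply, hsym (S y _)] at htr
  have hnn : ∀ Z, 0 ≤ G (f y) (fderiv ℝ f y Z) (fderiv ℝ f y Z) := fun Z ↦
    hb.nonneg_of_orthogonal_null (hS.push_ne_zero hℓ hy) (hℓ.null y hy _) (hℓ.null y hy _)
  have hsum : ∑ A, G (f y) (fderiv ℝ f y (S y (e A))) (fderiv ℝ f y (S y (e A))) = 0 :=
    le_antisymm (by linarith) (Finset.sum_nonneg fun A _ ↦ hnn _)
  refine ⟨by linarith, fun X Y ↦ ?_⟩
  -- Length zero forces proportionality to `ℓ`. Together with `S ℓ = κ ℓ`, the whole image of `S` is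
  -- null, hence orthogonal to the surface.
  have hSe : ∀ A, ∃ r : ℝ, S y (e A) = r • ℓ y := fun A ↦
    hS.exists_smul_of_orthogonal hℓ hy
      ((Finset.sum_eq_zero_iff_of_nonneg fun A _ ↦ hnn _).1 hsum A (Finset.mem_univ A))
  obtain ⟨lam, -, -, hdec⟩ := exists_screen_decomposition (hℓ.ne_zero y hy)
    (q := pullForm (G (f y)) (fderiv ℝ f y)) (fun X ↦ hℓ.null y hy X) (e := e) he
  rw [← neg_eq_zero, ← hS.metric_covD_push hℓ hy, ← hSy, hdec X]
  simp only [map_add, map_smul, map_sum, hκ, add_apply, smul_apply, sum_apply, hℓ.null y hy]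
  simp only [smul_zero, zero_add]
  refine Finset.sum_eq_zero fun A _ ↦ ?_
  obtain ⟨r, hr⟩ := hSe A
  simp [hr, hℓ.null y hy]

/-- On tangent vectors `X ↦ R(X, Y)ℓ` is `X ↦ dη(X, Y) ℓ`, of rank at most one, so its trace is
`dη(ℓ, Y)`. As before, skewness of the curvature makes the trace over `E` one over `F`. -/
theorem ricciAt_of_rotation (hS : IsHypersurface G V f W) (hℓ : IsNullFieldIn G f W ℓ) {y : F}
    (hy : y ∈ W) {η : F → F →L[ℝ] ℝ} (hηd : DifferentiableAt ℝ η y)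
    (hη : ∀ᶠ z in 𝓝 y, ∀ X, covD G f (fun z ↦ fderiv ℝ f z (ℓ z)) z X =
      η z X • fderiv ℝ f z (ℓ z)) (Y : F) :
    ricciAt G (f y) (fderiv ℝ f y Y) (fderiv ℝ f y (ℓ y)) =
      fderiv ℝ η y (ℓ y) Y - fderiv ℝ η y Y (ℓ y) := by
  let α : F →L[ℝ] ℝ := (fderiv ℝ η y).flip Y - fderiv ℝ η y Y
  have hb := hS.metric.lorentz _ (hS.mapsTo y hy)
  have h : ricciAt G (f y) (fderiv ℝ f y Y) (fderiv ℝ f y (ℓ y)) =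
      LinearMap.trace ℝ F ((α : F →ₗ[ℝ] ℝ).smulRight (ℓ y)) := by
    refine trace_eq_of_comp_eq (A := (fderiv ℝ f y : F →ₗ[ℝ] E)) (hS.injective y hy)
      (fun u ↦ ?_) (fun X ↦ ?_)
    · refine hS.exists_eq_of_orthogonal hℓ hy ?_
      have h := hS.metric.metric_riemann (hS.mapsTo y hy) u (fderiv ℝ f y Y)
        (fderiv ℝ f y (ℓ y)) (fderiv ℝ f y (ℓ y))
      rw [hb.symm] at h
      change G (f y) (fderiv ℝ f y (ℓ y))
        (riemann G (f y) u (fderiv ℝ f y Y) (fderiv ℝ f y (ℓ y))) = 0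
      linarith
    · change riemann G (f y) (fderiv ℝ f y X) (fderiv ℝ f y Y) (fderiv ℝ f y (ℓ y)) = _
      rw [hS.riemann_of_rotation hℓ hy hηd hη]
      simp [α]
  rw [h, LinearMap.trace_smulRight]
  simp [α]

end IsHypersurface

end Raychaudhuri

end NullSurface

end

noncomputable section

namespace NullSurface

/-! ### Maps and metrics expressed in charts -/

section Charts

variable {E : Type*} [NormedAddCommGroup E] [NormedSpace ℝ E]
  {M : Type*} [TopologicalSpace M] [ChartedSpace E M] [IsManifold 𝓘(ℝ, E) ∞ M]
  {F : Type*} [NormedAddCommGroup F] [NormedSpace ℝ F]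
  {N : Type*} [TopologicalSpace N] [ChartedSpace F N] [IsManifold 𝓘(ℝ, F) ∞ N]

/-- The derivative at `x` of the chart at `c`. -/
def chartD (c x : M) : E →L[ℝ] E := mfderiv 𝓘(ℝ, E) 𝓘(ℝ, E) (extChartAt 𝓘(ℝ, E) c) x

/-- The derivative at `y` of the inverse of the chart at `c`. -/
def chartDsymm (c : M) (y : E) : E →L[ℝ] E :=
  mfderiv 𝓘(ℝ, E) 𝓘(ℝ, E) (extChartAt 𝓘(ℝ, E) c).symm y

theorem chartD_chartDsymm {c : M} {y : E} (hy : y ∈ (extChartAt 𝓘(ℝ, E) c).target) (v : E) :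
    chartD c ((extChartAt 𝓘(ℝ, E) c).symm y) (chartDsymm c y v) = v := by
  have h := mfderiv_extChartAt_comp_mfderivWithin_extChartAt_symm (I := 𝓘(ℝ, E)) hy
  simp only [ModelWithCorners.range_eq_univ, mfderivWithin_univ] at h
  exact DFunLike.congr_fun h v

theorem chartDsymm_chartD {c x : M} (hx : x ∈ (chartAt E c).source) (v : E) :
    chartDsymm c (extChartAt 𝓘(ℝ, E) c x) (chartD c x v) = v := by
  have h := mfderivWithin_extChartAt_symm_comp_mfderiv_extChartAt' (I := 𝓘(ℝ, E)) (x := c) (y := x)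
    (by simpa using hx)
  simp only [ModelWithCorners.range_eq_univ, mfderivWithin_univ] at h
  exact DFunLike.congr_fun h v

theorem chartD_chartDsymm' {c x : M} (hx : x ∈ (chartAt E c).source) (v : E) :
    chartD c x (chartDsymm c (extChartAt 𝓘(ℝ, E) c x) v) = v := by
  have hx' : x ∈ (extChartAt 𝓘(ℝ, E) c).source := by simpa using hx
  have h := chartD_chartDsymm ((extChartAt 𝓘(ℝ, E) c).map_source hx') v
  rwa [(extChartAt 𝓘(ℝ, E) c).left_inv hx'] at h

theorem chartD_self (x : M) (v : E) : chartD x x v = v :=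
  DFunLike.congr_fun (mfderiv_extChartAt_self (I := 𝓘(ℝ, E)) (x := x)) v

theorem hasMFDerivAt_chart {c x : M} (hx : x ∈ (chartAt E c).source) :
    HasMFDerivAt 𝓘(ℝ, E) 𝓘(ℝ, E) (extChartAt 𝓘(ℝ, E) c) x (chartD (E := E) c x) :=
  (mdifferentiableAt_extChartAt hx).hasMFDerivAt

theorem contMDiffAt_chart_symm {c : M} {y : E} (hy : y ∈ (extChartAt 𝓘(ℝ, E) c).target) :
    ContMDiffAt 𝓘(ℝ, E) 𝓘(ℝ, E) ∞ (extChartAt 𝓘(ℝ, E) c).symm y :=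
  (contMDiffOn_extChartAt_symm c).contMDiffAt ((isOpen_extChartAt_target c).mem_nhds hy)

/-- The derivative of a map between manifolds, as a map between the model spaces. -/
def mapD (h : N → M) (q : N) : F →L[ℝ] E := mfderiv 𝓘(ℝ, F) 𝓘(ℝ, E) h q

/-- The derivative of a vector valued function, computed in a chart. -/
theorem mfderiv_eq_fderiv_chart {u : N → E} {c q : N} (hq : q ∈ (chartAt F c).source)
    (hu : DifferentiableAt ℝ (fun y ↦ u ((extChartAt 𝓘(ℝ, F) c).symm y)) (extChartAt 𝓘(ℝ, F) c q))
    (X : F) :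
    mapD (E := E) u q X =
      fderiv ℝ (fun y ↦ u ((extChartAt 𝓘(ℝ, F) c).symm y)) (extChartAt 𝓘(ℝ, F) c q)
        (chartD c q X) := by
  have h1 := HasMFDerivAt.comp q hu.hasFDerivAt.hasMFDerivAt (hasMFDerivAt_chart hq)
  have h2 : u =ᶠ[𝓝 q] (fun y ↦ u ((extChartAt 𝓘(ℝ, F) c).symm y)) ∘ extChartAt 𝓘(ℝ, F) c := by
    filter_upwards [extChartAt_source_mem_nhds' (I := 𝓘(ℝ, F)) (by simpa using hq)] with z hz
    rw [Function.comp_apply, (extChartAt 𝓘(ℝ, F) c).left_inv hz]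
  exact DFunLike.congr_fun (h1.congr_of_eventuallyEq h2).mfderiv X

/-- The expression of a map `h` in the charts at `p` and at `c`. -/
def chartRep (h : N → M) (p : N) (c : M) (y : F) : E :=
  extChartAt 𝓘(ℝ, E) c (h ((extChartAt 𝓘(ℝ, F) p).symm y))

theorem contDiffAt_chartRep {h : N → M} (hh : ContMDiff 𝓘(ℝ, F) 𝓘(ℝ, E) ∞ h) {p : N} {c : M}
    {y : F} (hy : y ∈ (extChartAt 𝓘(ℝ, F) p).target)
    (hc : h ((extChartAt 𝓘(ℝ, F) p).symm y) ∈ (chartAt E c).source) :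
    ContDiffAt ℝ ∞ (chartRep (E := E) h p c) y :=
  contMDiffAt_iff_contDiffAt.1 (((contMDiffAt_extChartAt' (I := 𝓘(ℝ, E)) hc).comp _ (hh _)).comp y
    (contMDiffAt_chart_symm hy))

theorem fderiv_chartRep {h : N → M} (hh : ContMDiff 𝓘(ℝ, F) 𝓘(ℝ, E) ∞ h) {p q : N} {c : M}
    (hq : q ∈ (chartAt F p).source) (hc : h q ∈ (chartAt E c).source) (X : F) :
    fderiv ℝ (chartRep (E := E) h p c) (extChartAt 𝓘(ℝ, F) p q) (chartD p q X) =
      chartD c (h q) (mapD h q X) := by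
  have hq' : q ∈ (extChartAt 𝓘(ℝ, F) p).source := by simpa using hq
  have hd : ContDiffAt ℝ ∞ (chartRep (E := E) h p c) (extChartAt 𝓘(ℝ, F) p q) :=
    contDiffAt_chartRep hh ((extChartAt 𝓘(ℝ, F) p).map_source hq')
      (by rwa [(extChartAt 𝓘(ℝ, F) p).left_inv hq'])
  have h1 := mfderiv_eq_fderiv_chart (u := fun z ↦ extChartAt 𝓘(ℝ, E) c (h z)) hq
    (hd.differentiableAt (by simp)) X
  have h2 := HasMFDerivAt.comp q (hasMFDerivAt_chart hc)
    ((hh q).mdifferentiableAt (by simp)).hasMFDerivAt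
  exact h1.symm.trans (DFunLike.congr_fun h2.mfderiv X)

/-- The metric as a bilinear form on the model space. -/
def LorentzMetric.form (g : LorentzMetric E M) (x : M) : E →L[ℝ] E →L[ℝ] ℝ := g.val x

theorem LorentzMetric.isLorentz (g : LorentzMetric E M) (x : M) : IsLorentz (g.form x) :=
  ⟨g.symm x, g.signature x⟩

theorem chartMetric_chartD (g : LorentzMetric E M) {c x : M} (hx : x ∈ (chartAt E c).source)
    (v w : E) :
    chartMetric g c (extChartAt 𝓘(ℝ, E) c x) (chartD c x v) (chartD c x w) = g.form x v w := by
  change g.form ((extChartAt 𝓘(ℝ, E) c).symm (extChartAt 𝓘(ℝ, E) c x))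
    (chartDsymm c (extChartAt 𝓘(ℝ, E) c x) (chartD c x v))
    (chartDsymm c (extChartAt 𝓘(ℝ, E) c x) (chartD c x w)) = _
  rw [chartDsymm_chartD hx, chartDsymm_chartD hx,
    (extChartAt 𝓘(ℝ, E) c).left_inv (by simpa using hx)]

theorem IsLorentz.pull {b : E →L[ℝ] E →L[ℝ] ℝ} (hb : IsLorentz b) {A B : E →L[ℝ] E}
    (hBA : ∀ v, B (A v) = v) (hAB : ∀ v, A (B v) = v) : IsLorentz (pullForm b A) := by
  refine ⟨fun v w ↦ hb.symm _ _, ?_⟩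
  obtain ⟨t, ht, ht'⟩ := hb.signature
  refine ⟨B t, by simpa [pullForm_apply, hAB] using ht, fun w hw hw0 ↦ ?_⟩
  refine ht' (A w) (by simpa [pullForm_apply, hAB] using hw) fun h ↦ hw0 ?_
  rw [← hBA w, h, map_zero]

/-- The vector field with constant components in the chart at `c`. -/
def constField (c : M) (v : E) (z : M) : TangentSpace 𝓘(ℝ, E) z :=
  chartDsymm (E := E) c (extChartAt 𝓘(ℝ, E) c z) v

/-- Evaluating the bundle section `g` on two such fields gives its components in the chart, which is
how smoothness of the section passes to `chartMetric`. -/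
theorem contMDiffAt_const_field (c : M) {x : M} (hx : x ∈ (chartAt E c).source) (v : E) :
    ContMDiffAt 𝓘(ℝ, E) 𝓘(ℝ, E).tangent ∞
      (fun z ↦ (⟨z, constField c v z⟩ : TangentBundle 𝓘(ℝ, E) M)) x := by
  refine ((trivializationAt E (TangentSpace 𝓘(ℝ, E)) c).contMDiffAt_section_iff (IB := 𝓘(ℝ, E))
    (by simpa using hx)).2 ?_
  refine (contMDiffAt_const (c := v)).congr_of_eventuallyEq ?_
  filter_upwards [(chartAt E c).open_source.mem_nhds hx] with z hz
  have h := TangentBundle.continuousLinearMapAt_trivializationAt (I := 𝓘(ℝ, E)) hz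
  have h' := DFunLike.congr_fun h (constField c v z)
  rw [Bundle.Trivialization.continuousLinearMapAt_apply,
    Bundle.Trivialization.coe_linearMapAt_of_mem _ (by simpa using hz)] at h'
  exact h'.trans (chartD_chartDsymm' hz v)

variable [FiniteDimensional ℝ E]

theorem isLorentzOn_chartMetric (g : LorentzMetric E M) (c : M) :
    IsLorentzOn (chartMetric g c) (extChartAt 𝓘(ℝ, E) c).target := by
  refine ⟨isOpen_extChartAt_target c, ?_, fun y hy ↦ ?_⟩
  · rw [contDiffOn_clm_apply]
    intro v
    rw [contDiffOn_clm_apply]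
    intro w y hy
    refine ContDiffAt.contDiffWithinAt ?_
    have hs : (extChartAt 𝓘(ℝ, E) c).symm y ∈ (chartAt E c).source := by
      simpa using (extChartAt 𝓘(ℝ, E) c).map_target hy
    have h := ContMDiffAt.clm_bundle_apply₂ (F₁ := E) (F₂ := E) (F₃ := ℝ)
      (E₁ := fun x : M ↦ TangentSpace 𝓘(ℝ, E) x) (E₂ := fun x : M ↦ TangentSpace 𝓘(ℝ, E) x)
      (E₃ := Bundle.Trivial M ℝ)
      (b := fun x : M ↦ x) (g.contMDiff ((extChartAt 𝓘(ℝ, E) c).symm y))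
      (contMDiffAt_const_field c hs v) (contMDiffAt_const_field c hs w)
    have h2 := (Bundle.contMDiffAt_section _).1 h
    have h3 := h2.comp y (contMDiffAt_chart_symm hy)
    refine (contMDiffAt_iff_contDiffAt.1 h3).congr_of_eventuallyEq ?_
    filter_upwards [(isOpen_extChartAt_target (I := 𝓘(ℝ, E)) c).mem_nhds hy] with z hz
    have hz' := (extChartAt 𝓘(ℝ, E) c).right_inv hz
    simp only [Function.comp_apply]
    change _ = g.form ((extChartAt 𝓘(ℝ, E) c).symm z)
      (chartDsymm c (extChartAt 𝓘(ℝ, E) c ((extChartAt 𝓘(ℝ, E) c).symm z)) v)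
      (chartDsymm c (extChartAt 𝓘(ℝ, E) c ((extChartAt 𝓘(ℝ, E) c).symm z)) w)
    rw [hz']
    rfl
  · have hs : (extChartAt 𝓘(ℝ, E) c).symm y ∈ (chartAt E c).source := by
      simpa using (extChartAt 𝓘(ℝ, E) c).map_target hy
    refine IsLorentz.pull (b := g.form ((extChartAt 𝓘(ℝ, E) c).symm y)) (A := chartDsymm c y)
      (B := chartD c ((extChartAt 𝓘(ℝ, E) c).symm y)) (g.isLorentz _)
      (chartD_chartDsymm hy) fun v ↦ ?_
    have h := chartDsymm_chartD hs v
    rwa [(extChartAt 𝓘(ℝ, E) c).right_inv hy] at h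

end Charts

end NullSurface

end

noncomputable section

namespace NullSurface

/-! ### Independence of the covariant derivative from the charts -/

section ChangeOfCharts

variable {E : Type*} [NormedAddCommGroup E] [NormedSpace ℝ E]
  {M : Type*} [TopologicalSpace M] [ChartedSpace E M]
  {F : Type*} [NormedAddCommGroup F] [NormedSpace ℝ F]
  {N : Type*} [TopologicalSpace N] [ChartedSpace F N]

theorem isOpen_preimage_chart {c : N} {U : Set N} (hU : IsOpen U) :
    IsOpen ((extChartAt 𝓘(ℝ, F) c).target ∩ (extChartAt 𝓘(ℝ, F) c).symm ⁻¹' U) :=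
  (continuousOn_extChartAt_symm c).isOpen_inter_preimage (isOpen_extChartAt_target c) hU

theorem mapD_id (x : M) (v : E) : mapD (id : M → M) x v = v :=
  DFunLike.congr_fun (mfderiv_id (I := 𝓘(ℝ, E)) (x := x)) v

variable [IsManifold 𝓘(ℝ, E) ∞ M] [IsManifold 𝓘(ℝ, F) ∞ N]

/-- The transformation law of the Christoffel symbols. -/
theorem secondForm_isometry [FiniteDimensional ℝ E] {G G' : E → E →L[ℝ] E →L[ℝ] ℝ}
    {V V' W : Set E} {χ : E → E} (hG : IsLorentzOn G V) (hχ : IsMapInto G' V' χ W) {y : E}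
    (hyV : y ∈ V) (hyW : y ∈ W)
    (hiso : ∀ᶠ z in 𝓝 y, ∀ v w, G z v w = G' (χ z) (fderiv ℝ χ z v) (fderiv ℝ χ z w))
    {B : E → E} (hB : ∀ v, fderiv ℝ χ y (B v) = v) (hinj : Function.Injective (fderiv ℝ χ y))
    (u v : E) :
    secondForm G' χ y u v = fderiv ℝ χ y (leviCivita G y u v) := by
  -- The second form of `χ`, pulled back by the derivative of `χ`, is symmetric and metric for `G`;
  -- uniqueness identifies it with the Levi-Civita connection.
  rw [← hG.leviCivita_unique hyV (C := fun u v ↦ B (secondForm G' χ y u v)) ?_ ?_ u v, hB]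
  · intro u v
    exact hinj (by rw [hB, hB, hχ.secondForm_symm hyW])
  · intro u v w
    have hd : ∀ v : E, DifferentiableAt ℝ (fun z ↦ fderiv ℝ χ z v) y := fun v ↦
      (hχ.hasFDerivAt_fderiv hyW).differentiableAt.clm_apply (differentiableAt_const v)
    have hc : ∀ v, covD G' χ (fun z ↦ fderiv ℝ χ z v) y u = secondForm G' χ y u v := fun v ↦ by
      have := hχ.covD_push hyW (differentiableAt_const (x := y) v) u
      simpa only [fderiv_fun_const, Pi.zero_apply, zero_apply, map_zero, zero_add] using this
    have h := hχ.fderiv_metric hyW (hd v) (hd w) u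
    have he : (fun z ↦ G z v w) =ᶠ[𝓝 y] fun z ↦ G' (χ z) (fderiv ℝ χ z v) (fderiv ℝ χ z w) := by
      filter_upwards [hiso] with z hz using hz v w
    have h1 : fderiv ℝ (fun z ↦ G z v w) y u = fderiv ℝ G y u v w := by
      rw [(((hG.hasFDerivAt hyV).clm_apply (hasFDerivAt_const v y)).clm_apply
        (hasFDerivAt_const w y)).fderiv]
      simp
    rw [← h1, he.fderiv_eq, h, hc, hc, hiso.self_of_nhds, hiso.self_of_nhds, hB, hB]

/-- The domain of the change of charts from the chart at `c` to the chart at `c'`. -/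
def transDom (c c' : M) : Set E :=
  (extChartAt 𝓘(ℝ, E) c).target ∩
    (extChartAt 𝓘(ℝ, E) c).symm ⁻¹' (extChartAt 𝓘(ℝ, E) c').source

theorem fderiv_transition {c c' x : M} (hc : x ∈ (chartAt E c).source)
    (hc' : x ∈ (chartAt E c').source) (v : E) :
    fderiv ℝ (chartRep (id : M → M) c c') (extChartAt 𝓘(ℝ, E) c x) (chartD c x v) =
      chartD c' x v := by
  rw [fderiv_chartRep contMDiff_id hc hc', mapD_id]
  rfl

theorem fderiv_transition' {c c' x : M} (hc : x ∈ (chartAt E c).source)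
    (hc' : x ∈ (chartAt E c').source) (v : E) :
    fderiv ℝ (chartRep (id : M → M) c c') (extChartAt 𝓘(ℝ, E) c x) v =
      chartD c' x (chartDsymm c (extChartAt 𝓘(ℝ, E) c x) v) := by
  rw [← fderiv_transition hc hc', chartD_chartDsymm' hc]

variable [FiniteDimensional ℝ E]

theorem isMapInto_transition (g : LorentzMetric E M) (c c' : M) :
    IsMapInto (chartMetric g c') (extChartAt 𝓘(ℝ, E) c').target
      (chartRep (id : M → M) c c') (transDom (E := E) c c') where
  metric := isLorentzOn_chartMetric g c'
  isOpen := isOpen_preimage_chart (isOpen_extChartAt_source c')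
  mapsTo y hy := (extChartAt 𝓘(ℝ, E) c').map_source hy.2
  contDiffOn y hy := (contDiffAt_chartRep (E := E) (h := (id : M → M)) (contMDiff_id (I := 𝓘(ℝ, E))) hy.1
    (by simpa using hy.2)).contDiffWithinAt

/-- A change of charts is an isometry between the two chart metrics, so the transformation law of
the Christoffel symbols applies. -/
theorem secondForm_transition (g : LorentzMetric E M) {c c' x : M}
    (hc : x ∈ (chartAt E c).source) (hc' : x ∈ (chartAt E c').source) (u v : E) :
    secondForm (chartMetric g c') (chartRep (id : M → M) c c') (extChartAt 𝓘(ℝ, E) c x) u v =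
      fderiv ℝ (chartRep (id : M → M) c c') (extChartAt 𝓘(ℝ, E) c x)
        (leviCivita (chartMetric g c) (extChartAt 𝓘(ℝ, E) c x) u v) := by
  have hcs : x ∈ (extChartAt 𝓘(ℝ, E) c).source := by simpa using hc
  have hcs' : x ∈ (extChartAt 𝓘(ℝ, E) c').source := by simpa using hc'
  have hy : extChartAt 𝓘(ℝ, E) c x ∈ transDom (E := E) c c' :=
    ⟨(extChartAt 𝓘(ℝ, E) c).map_source hcs,
      by rwa [Set.mem_preimage, (extChartAt 𝓘(ℝ, E) c).left_inv hcs]⟩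
  have hχ := isMapInto_transition g c c'
  refine secondForm_isometry (isLorentzOn_chartMetric g c) hχ hy.1 hy ?_
    (B := fun v ↦ chartD c x (chartDsymm c' (extChartAt 𝓘(ℝ, E) c' x) v)) (fun v ↦ ?_) ?_ u v
  · filter_upwards [hχ.isOpen.mem_nhds hy] with z hz v w
    have h1 : (extChartAt 𝓘(ℝ, E) c).symm z ∈ (chartAt E c).source := by
      simpa using (extChartAt 𝓘(ℝ, E) c).map_target hz.1
    have h2 : (extChartAt 𝓘(ℝ, E) c).symm z ∈ (chartAt E c').source := by simpa using hz.2
    have hz' := (extChartAt 𝓘(ℝ, E) c).right_inv hz.1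
    have h3 := fderiv_transition' h1 h2
    have h4 := chartMetric_chartD g h1
    have h5 := chartD_chartDsymm hz.1
    rw [hz'] at h3 h4
    rw [h3, h3]
    conv_lhs => rw [← h5 v, ← h5 w]
    rw [h4]
    exact (chartMetric_chartD g h2 _ _).symm
  · rw [fderiv_transition hc hc', chartD_chartDsymm' hc']
  · intro a b hab
    rw [fderiv_transition' hc hc', fderiv_transition' hc hc'] at hab
    have h := congrArg (chartDsymm c' (extChartAt 𝓘(ℝ, E) c' x)) hab
    rw [chartDsymm_chartD hc', chartDsymm_chartD hc'] at h
    rw [← chartD_chartDsymm' hc a, h, chartD_chartDsymm' hc]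

/-- The components, in the charts at `p₀` and at `c`, of a vector field along `ι`. -/
def compAlong (ι : N → M) (p₀ : N) (c : M) (V : ∀ p : N, TangentSpace 𝓘(ℝ, E) (ι p)) (y : F) : E :=
  chartD (E := E) c (ι ((extChartAt 𝓘(ℝ, F) p₀).symm y)) (V ((extChartAt 𝓘(ℝ, F) p₀).symm y))

/-- The covariant derivative along `ι` may be computed in any charts. -/
theorem chartD_covAlong (g : LorentzMetric E M) {ι : N → M} (hι : ContMDiff 𝓘(ℝ, F) 𝓘(ℝ, E) ∞ ι)
    {p₀ p : N} {c : M} (hp : p ∈ (chartAt F p₀).source) (hc : ι p ∈ (chartAt E c).source)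
    (V : ∀ p : N, TangentSpace 𝓘(ℝ, E) (ι p))
    (hV : DifferentiableAt ℝ (compAlong ι p₀ c V) (extChartAt 𝓘(ℝ, F) p₀ p)) (X : F) :
    chartD (E := E) c (ι p) (covAlong g ι V p X) =
      covD (chartMetric g c) (chartRep ι p₀ c) (compAlong ι p₀ c V) (extChartAt 𝓘(ℝ, F) p₀ p)
        (chartD p₀ p X) := by
  have hps : p ∈ (extChartAt 𝓘(ℝ, F) p₀).source := by simpa using hp
  set x := ι p with hx
  set y := extChartAt 𝓘(ℝ, F) p₀ p with hy
  have hyt : y ∈ (extChartAt 𝓘(ℝ, F) p₀).target := (extChartAt 𝓘(ℝ, F) p₀).map_source hps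
  have hyp : (extChartAt 𝓘(ℝ, F) p₀).symm y = p := (extChartAt 𝓘(ℝ, F) p₀).left_inv hps
  have hxx : x ∈ (chartAt E x).source := mem_chart_source E x
  let χ : E → E := chartRep (id : M → M) c x
  let f : F → E := chartRep ι p₀ c
  let U : F → E := compAlong ι p₀ c V
  have hfy : f y = extChartAt 𝓘(ℝ, E) c x := by simp only [f, chartRep, hyp, hx]
  have hxs : x ∈ (extChartAt 𝓘(ℝ, E) c).source := by simpa using hc
  have hfd : HasFDerivAt f (fderiv ℝ f y) y :=
    ((contDiffAt_chartRep hι hyt (by rwa [hyp])).differentiableAt (by simp)).hasFDerivAt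
  have hχW : f y ∈ transDom (E := E) c x := by
    rw [hfy]
    refine ⟨(extChartAt 𝓘(ℝ, E) c).map_source hxs, ?_⟩
    rw [Set.mem_preimage, (extChartAt 𝓘(ℝ, E) c).left_inv hxs]
    exact mem_extChartAt_source x
  have hχ := isMapInto_transition g c x
  have hfX : fderiv ℝ f y (chartD p₀ p X) = chartD c x (mapD ι p X) := fderiv_chartRep hι hp hc X
  -- the components in the chart at `ι p`
  have hev : (fun z ↦ chartD (E := E) x (ι ((extChartAt 𝓘(ℝ, F) p₀).symm z))
      (V ((extChartAt 𝓘(ℝ, F) p₀).symm z))) =ᶠ[𝓝 y] fun z ↦ fderiv ℝ χ (f z) (U z) := by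
    have hcont : ContinuousAt (fun z ↦ ι ((extChartAt 𝓘(ℝ, F) p₀).symm z)) y :=
      (hι.continuous.continuousAt).comp (contMDiffAt_chart_symm hyt).continuousAt
    have h1 := hcont.preimage_mem_nhds ((chartAt E c).open_source.mem_nhds (by rwa [hyp]))
    have h2 := hcont.preimage_mem_nhds ((chartAt E x).open_source.mem_nhds (by rwa [hyp]))
    filter_upwards [h1, h2] with z hz1 hz2
    exact (fderiv_transition hz1 hz2 _).symm
  have hd : HasFDerivAt (fun z ↦ fderiv ℝ χ (f z) (U z)) _ y :=
    ((hχ.hasFDerivAt_fderiv hχW).comp y hfd).clm_apply hV.hasFDerivAt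
  have hV' := mfderiv_eq_fderiv_chart (u := fun q ↦ chartD (E := E) x (ι q) (V q)) hp
    (hd.congr_of_eventuallyEq hev).differentiableAt X
  rw [(hd.congr_of_eventuallyEq hev).fderiv] at hV'
  have hUy : U y = chartD (E := E) c x (V p) :=
    congrArg (fun q ↦ chartD (E := E) c (ι q) (V q)) hyp
  -- The second derivative of `χ`, which appears on differentiating the transformed components, is
  -- absorbed by this law.
  have hsecond := secondForm_transition g hc hxx (fderiv ℝ f y (chartD p₀ p X)) (U y)
  rw [← hfy, secondForm_apply] at hsecond
  have hχx : χ (f y) = extChartAt 𝓘(ℝ, E) x x := by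
    simp only [χ, chartRep, hfy, (extChartAt 𝓘(ℝ, E) c).left_inv hxs, id]
  have e1 : fderiv ℝ χ (f y) (fderiv ℝ f y (chartD p₀ p X)) = chartD x x (mapD ι p X) := by
    rw [hfX, hfy]; exact fderiv_transition hc hxx _
  have e2 : fderiv ℝ χ (f y) (U y) = chartD (E := E) x x (V p) := by
    rw [hUy, hfy]; exact fderiv_transition hc hxx _
  -- Holds by `rfl`, as `christoffel` in a chart unfolds to the same term as `leviCivita` of
  -- `chartMetric`.
  have hcov' : covAlong g ι V p X = (mfderiv 𝓘(ℝ, E) 𝓘(ℝ, E) (extChartAt 𝓘(ℝ, E) x) x).inverse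
      (mapD (E := E) (fun q ↦ chartD (E := E) x (ι q) (V q)) p X
        + leviCivita (chartMetric g x) (extChartAt 𝓘(ℝ, E) x x) (chartD x x (mapD ι p X))
          (chartD (E := E) x x (V p))) := rfl
  have hcov : covAlong g ι V p X = (mfderiv 𝓘(ℝ, E) 𝓘(ℝ, E) (extChartAt 𝓘(ℝ, E) x) x).inverse
      (fderiv ℝ χ (f y) (covD (chartMetric g c) f U y (chartD p₀ p X))) := by
    rw [hcov', hV', covD_apply, map_add, ← hsecond, ← e1, ← e2, ← hχx]
    congr 1
    simp only [add_apply, ContinuousLinearMap.comp_apply, ContinuousLinearMap.flip_apply,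
      Function.comp_apply]
    abel
  have hinv : (mfderiv 𝓘(ℝ, E) 𝓘(ℝ, E) (extChartAt 𝓘(ℝ, E) x) x).inverse =
      ContinuousLinearMap.id ℝ E := by
    rw [mfderiv_extChartAt_self]
    exact ContinuousLinearMap.inverse_id
  rw [hcov, hinv, hfy, fderiv_transition' hc hxx, chartD_self]
  exact chartD_chartDsymm' hc _

end ChangeOfCharts

end NullSurface

end

noncomputable section

namespace NullSurface

/-! ### The null surface and its null fields as a local hypersurface -/

section SurfaceCharts

variable {E : Type*} [NormedAddCommGroup E] [NormedSpace ℝ E]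
  {M : Type*} [TopologicalSpace M] [ChartedSpace E M]
  {F : Type*} [NormedAddCommGroup F] [NormedSpace ℝ F]
  {N : Type*} [TopologicalSpace N] [ChartedSpace F N]
  {G : E → E →L[ℝ] E →L[ℝ] ℝ} {V : Set E} {f : F → E} {W W' : Set F} {ℓ : F → F}

theorem IsHypersurface.mono (hS : IsHypersurface G V f W) (hW' : IsOpen W') (h : W' ⊆ W) :
    IsHypersurface G V f W' where
  metric := hS.metric
  isOpen := hW'
  mapsTo y hy := hS.mapsTo y (h hy)
  contDiffOn := hS.contDiffOn.mono h
  injective y hy := hS.injective y (h hy)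
  finrank := hS.finrank

/-- The domain on which `ι` is expressed in the charts at `p₀` and at `ι p₀`. -/
def surfDom (E : Type*) [NormedAddCommGroup E] [NormedSpace ℝ E] [ChartedSpace E M]
    (ι : N → M) (p₀ : N) : Set F :=
  (extChartAt 𝓘(ℝ, F) p₀).target ∩
    (extChartAt 𝓘(ℝ, F) p₀).symm ⁻¹' (ι ⁻¹' (extChartAt 𝓘(ℝ, E) (ι p₀)).source)

/-- The part of the chart at `p₀` on which a field is defined and does not vanish. -/
def fieldDom (E : Type*) [NormedAddCommGroup E] [NormedSpace ℝ E] [ChartedSpace E M]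
    (ι : N → M) (p₀ : N) (U : Set N) (Y : ∀ p : N, TangentSpace 𝓘(ℝ, F) p) : Set F :=
  {y | y ∈ surfDom E ι p₀ ∧ (extChartAt 𝓘(ℝ, F) p₀).symm y ∈ U ∧ chartField Y p₀ y ≠ 0}

theorem mem_surfDom (ι : N → M) (p₀ : N) : extChartAt 𝓘(ℝ, F) p₀ p₀ ∈ surfDom E ι p₀ := by
  refine ⟨mem_extChartAt_target p₀, ?_⟩
  rw [Set.mem_preimage, extChartAt_to_inv, Set.mem_preimage]
  exact mem_extChartAt_source (I := 𝓘(ℝ, E)) (ι p₀)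

theorem surfDom_source {ι : N → M} {p₀ : N} {y : F} (hy : y ∈ surfDom E ι p₀) :
    (extChartAt 𝓘(ℝ, F) p₀).symm y ∈ (chartAt F p₀).source ∧
      ι ((extChartAt 𝓘(ℝ, F) p₀).symm y) ∈ (chartAt E (ι p₀)).source :=
  ⟨by simpa using (extChartAt 𝓘(ℝ, F) p₀).map_target hy.1, by simpa using hy.2⟩

theorem isOpen_surfDom {ι : N → M} (hι : Continuous ι) (p₀ : N) :
    IsOpen (surfDom (F := F) E ι p₀) :=
  isOpen_preimage_chart ((isOpen_extChartAt_source (ι p₀)).preimage hι)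

section

variable [IsManifold 𝓘(ℝ, E) ∞ M]

/-- The induced metric as a bilinear form on the model space. -/
def inducedForm (g : LorentzMetric E M) (ι : N → M) (p : N) : F →L[ℝ] F →L[ℝ] ℝ :=
  inducedMetric g ι p

/-- The degenerate direction is null, and a null tangent vector is orthogonal to it, hence
proportional to it. So every null tangent vector lies in the radical, and `q(ℓ, ℓ) = 0` suffices to
define null fields. -/
theorem inducedForm_null {g : LorentzMetric E M} {ι : N → M}
    (hnull : IsNullImmersion (F := F) g ι) {p : N} {v : F} (hv : inducedForm g ι p v v = 0)
    (X : F) : inducedForm g ι p v X = 0 := by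
  obtain ⟨d, hd0, hd⟩ : ∃ d : F, d ≠ 0 ∧ ∀ w, inducedForm g ι p d w = 0 := hnull.degenerate p
  have hinj : Function.Injective (mapD (E := E) (F := F) ι p) := hnull.injective p
  have hd1 : mapD (E := E) (F := F) ι p d ≠ 0 := fun h ↦ hd0 (hinj (by rw [h, map_zero]))
  obtain ⟨r, hr⟩ := (g.isLorentz (ι p)).exists_smul_eq_of_null hd1 (hd d) (c := mapD ι p v)
    (le_of_eq hv) (hd v)
  have : v = r • d := hinj (by rw [hr, map_smul])
  rw [this, map_smul, smul_apply, hd, smul_zero]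

end

variable [IsManifold 𝓘(ℝ, F) ∞ N]

theorem contDiffOn_chartField {U : Set N} (hU : IsOpen U) {Y : ∀ p : N, TangentSpace 𝓘(ℝ, F) p}
    (hY : IsSmoothFieldOn U Y) (p₀ : N) :
    ContDiffOn ℝ ∞ (chartField Y p₀)
      ((extChartAt 𝓘(ℝ, F) p₀).target ∩ (extChartAt 𝓘(ℝ, F) p₀).symm ⁻¹' U) := by
  intro y hy
  refine ContDiffAt.contDiffWithinAt ?_
  have hs : (extChartAt 𝓘(ℝ, F) p₀).symm y ∈ (chartAt F p₀).source := by
    simpa using (extChartAt 𝓘(ℝ, F) p₀).map_target hy.1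
  have h1 := hY.contMDiffAt (hU.mem_nhds hy.2)
  have h2 := ((trivializationAt F (TangentSpace 𝓘(ℝ, F)) p₀).contMDiffAt_section_iff
    (IB := 𝓘(ℝ, F)) (by simpa using hs)).1 h1
  have h3 := h2.comp y (contMDiffAt_chart_symm hy.1)
  refine (contMDiffAt_iff_contDiffAt.1 h3).congr_of_eventuallyEq ?_
  filter_upwards [(isOpen_extChartAt_target (I := 𝓘(ℝ, F)) p₀).mem_nhds hy.1] with z hz
  have hzs : (extChartAt 𝓘(ℝ, F) p₀).symm z ∈ (chartAt F p₀).source := by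
    simpa using (extChartAt 𝓘(ℝ, F) p₀).map_target hz
  have h := TangentBundle.continuousLinearMapAt_trivializationAt (I := 𝓘(ℝ, F)) hzs
  have h' := DFunLike.congr_fun h (Y ((extChartAt 𝓘(ℝ, F) p₀).symm z))
  rw [Bundle.Trivialization.continuousLinearMapAt_apply,
    Bundle.Trivialization.coe_linearMapAt_of_mem _ (by simpa using hzs)] at h'
  exact h'.symm

theorem isOpen_fieldDom {ι : N → M} (hι : Continuous ι) {U : Set N} (hU : IsOpen U)
    {Y : ∀ p : N, TangentSpace 𝓘(ℝ, F) p} (hY : IsSmoothFieldOn U Y) (p₀ : N) :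
    IsOpen (fieldDom E ι p₀ U Y) := by
  have h1 := (contDiffOn_chartField hU hY p₀).continuousOn.isOpen_inter_preimage
    (isOpen_preimage_chart hU) (isOpen_ne (x := (0 : F)))
  have h2 := (isOpen_surfDom (E := E) (F := F) hι p₀).inter h1
  convert h2 using 1
  ext y
  exact ⟨fun h ↦ ⟨h.1, ⟨h.1.1, h.2.1⟩, h.2.2⟩, fun h ↦ ⟨h.1, h.2.1.2, h.2.2⟩⟩

theorem chartDsymm_chartField (Y : ∀ p : N, TangentSpace 𝓘(ℝ, F) p) {p₀ : N} {y : F}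
    (hy : y ∈ (extChartAt 𝓘(ℝ, F) p₀).target) :
    chartDsymm p₀ y (chartField Y p₀ y) = Y ((extChartAt 𝓘(ℝ, F) p₀).symm y) := by
  have hs : (extChartAt 𝓘(ℝ, F) p₀).symm y ∈ (chartAt F p₀).source := by
    simpa using (extChartAt 𝓘(ℝ, F) p₀).map_target hy
  have h := chartDsymm_chartD hs (Y ((extChartAt 𝓘(ℝ, F) p₀).symm y))
  rw [(extChartAt 𝓘(ℝ, F) p₀).right_inv hy] at h
  exact h

variable [IsManifold 𝓘(ℝ, E) ∞ M]

theorem fderiv_chartRep' {ι : N → M} (hι : ContMDiff 𝓘(ℝ, F) 𝓘(ℝ, E) ∞ ι) {p₀ : N}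
    {y : F} (hy : y ∈ surfDom E ι p₀) (X : F) :
    fderiv ℝ (chartRep (E := E) ι p₀ (ι p₀)) y X =
      chartD (ι p₀) (ι ((extChartAt 𝓘(ℝ, F) p₀).symm y))
        (mapD ι ((extChartAt 𝓘(ℝ, F) p₀).symm y) (chartDsymm p₀ y X)) := by
  have h := fderiv_chartRep hι (surfDom_source hy).1 (surfDom_source hy).2 (chartDsymm p₀ y X)
  rwa [(extChartAt 𝓘(ℝ, F) p₀).right_inv hy.1, chartD_chartDsymm hy.1] at h

theorem metric_chartRep (g : LorentzMetric E M) {ι : N → M}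
    (hι : ContMDiff 𝓘(ℝ, F) 𝓘(ℝ, E) ∞ ι) {p₀ : N} {y : F} (hy : y ∈ surfDom E ι p₀) (X Y : F) :
    chartMetric g (ι p₀) (chartRep (E := E) ι p₀ (ι p₀) y) (fderiv ℝ (chartRep (E := E) ι p₀ (ι p₀)) y X)
      (fderiv ℝ (chartRep (E := E) ι p₀ (ι p₀)) y Y) =
      inducedForm g ι ((extChartAt 𝓘(ℝ, F) p₀).symm y) (chartDsymm p₀ y X) (chartDsymm p₀ y Y) := by
  rw [fderiv_chartRep' hι hy, fderiv_chartRep' hι hy]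
  exact chartMetric_chartD g (surfDom_source hy).2 _ _

theorem compAlong_push {ι : N → M} (hι : ContMDiff 𝓘(ℝ, F) 𝓘(ℝ, E) ∞ ι) {p₀ : N}
    (Y : ∀ p : N, TangentSpace 𝓘(ℝ, F) p) {y : F} (hy : y ∈ surfDom E ι p₀) :
    compAlong ι p₀ (ι p₀) (push ι Y) y =
      fderiv ℝ (chartRep (E := E) ι p₀ (ι p₀)) y (chartField Y p₀ y) := by
  rw [fderiv_chartRep' hι hy, chartDsymm_chartField Y hy.1]
  rfl

theorem isNullFieldIn_chartField {g : LorentzMetric E M} {ι : N → M}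
    (hnull : IsNullImmersion (F := F) g ι) {U : Set N}
    {ℓ : ∀ p : N, TangentSpace 𝓘(ℝ, F) p} (hℓ : IsNullFieldOn g ι U ℓ) (p₀ : N) :
    IsNullFieldIn (chartMetric g (ι p₀)) (chartRep (E := E) ι p₀ (ι p₀)) (fieldDom E ι p₀ U ℓ)
      (chartField ℓ p₀) where
  contDiffOn := (contDiffOn_chartField hℓ.isOpen hℓ.smooth p₀).mono fun _ h ↦ ⟨h.1.1, h.2.1⟩
  ne_zero _ hy := hy.2.2
  null y hy X := by
    rw [metric_chartRep g hnull.contMDiff hy.1, chartDsymm_chartField ℓ hy.1.1]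
    exact inducedForm_null hnull (hℓ.null _ hy.2.1) _

variable [FiniteDimensional ℝ E]

theorem isHypersurface_chartRep {g : LorentzMetric E M} {ι : N → M}
    (hnull : IsNullImmersion (F := F) g ι)
    (hdim : Module.finrank ℝ E = Module.finrank ℝ F + 1) (p₀ : N) :
    IsHypersurface (chartMetric g (ι p₀)) (extChartAt 𝓘(ℝ, E) (ι p₀)).target
      (chartRep (E := E) ι p₀ (ι p₀)) (surfDom (F := F) E ι p₀) where
  metric := isLorentzOn_chartMetric g _
  isOpen := isOpen_surfDom hnull.contMDiff.continuous p₀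
  mapsTo y hy := (extChartAt 𝓘(ℝ, E) (ι p₀)).map_source hy.2
  contDiffOn y hy := (contDiffAt_chartRep hnull.contMDiff hy.1
    (surfDom_source hy).2).contDiffWithinAt
  injective y hy := by
    have hinj : Function.Injective (mapD (E := E) (F := F) ι ((extChartAt 𝓘(ℝ, F) p₀).symm y)) :=
      hnull.injective _
    intro a b hab
    rw [fderiv_chartRep' hnull.contMDiff hy, fderiv_chartRep' hnull.contMDiff hy] at hab
    have h1 := congrArg (chartDsymm (ι p₀)
      (extChartAt 𝓘(ℝ, E) (ι p₀) (ι ((extChartAt 𝓘(ℝ, F) p₀).symm y)))) hab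
    rw [chartDsymm_chartD (surfDom_source hy).2, chartDsymm_chartD (surfDom_source hy).2] at h1
    have h2 := hinj h1
    rw [← chartD_chartDsymm hy.1 a, h2, chartD_chartDsymm hy.1]
  finrank := hdim

theorem isHypersurface_fieldDom {g : LorentzMetric E M} {ι : N → M}
    (hnull : IsNullImmersion (F := F) g ι)
    (hdim : Module.finrank ℝ E = Module.finrank ℝ F + 1) {U : Set N}
    {ℓ : ∀ p : N, TangentSpace 𝓘(ℝ, F) p} (hℓ : IsNullFieldOn g ι U ℓ) (p₀ : N) :
    IsHypersurface (chartMetric g (ι p₀)) (extChartAt 𝓘(ℝ, E) (ι p₀)).target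
      (chartRep (E := E) ι p₀ (ι p₀)) (fieldDom E ι p₀ U ℓ) :=
  (isHypersurface_chartRep hnull hdim p₀).mono
    (isOpen_fieldDom hnull.contMDiff.continuous hℓ.isOpen hℓ.smooth p₀) fun _ h ↦ h.1

theorem chartD_covAlong_push (g : LorentzMetric E M) {ι : N → M}
    (hι : ContMDiff 𝓘(ℝ, F) 𝓘(ℝ, E) ∞ ι) {p₀ : N} {y : F} (hy : y ∈ surfDom E ι p₀)
    (Y : ∀ p : N, TangentSpace 𝓘(ℝ, F) p) (hY : DifferentiableAt ℝ (chartField Y p₀) y) (X : F) :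
    chartD (E := E) (ι p₀) (ι ((extChartAt 𝓘(ℝ, F) p₀).symm y))
      (covAlong g ι (push ι Y) ((extChartAt 𝓘(ℝ, F) p₀).symm y) X) =
      covD (chartMetric g (ι p₀)) (chartRep (E := E) ι p₀ (ι p₀))
        (fun z ↦ fderiv ℝ (chartRep (E := E) ι p₀ (ι p₀)) z (chartField Y p₀ z)) y
        (chartD p₀ ((extChartAt 𝓘(ℝ, F) p₀).symm y) X) := by
  have hev : compAlong (E := E) ι p₀ (ι p₀) (push ι Y) =ᶠ[𝓝 y]
      fun z ↦ fderiv ℝ (chartRep (E := E) ι p₀ (ι p₀)) z (chartField Y p₀ z) := by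
    filter_upwards [(isOpen_surfDom hι.continuous p₀).mem_nhds hy] with z hz
      using compAlong_push hι Y hz
  have hf : DifferentiableAt ℝ (fderiv ℝ (chartRep (E := E) ι p₀ (ι p₀))) y :=
    ((contDiffAt_chartRep hι hy.1 (surfDom_source hy).2).fderiv_right (m := ∞)
      (by simp)).differentiableAt (by simp)
  have hd : DifferentiableAt ℝ (compAlong (E := E) ι p₀ (ι p₀) (push ι Y)) y :=
    (hf.clm_apply hY).congr_of_eventuallyEq hev
  have hr := (extChartAt 𝓘(ℝ, F) p₀).right_inv hy.1
  have h := chartD_covAlong g hι (surfDom_source hy).1 (surfDom_source hy).2 (push ι Y)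
    (by rwa [hr]) X
  rw [h, hr, covD_congr hev]

end SurfaceCharts

end NullSurface

end

noncomputable section

namespace NullSurface

/-! ### Field equations and total geodesy -/

section NullSurfaceGeometry

variable {E : Type*} [NormedAddCommGroup E] [NormedSpace ℝ E]
  {M : Type*} [TopologicalSpace M] [ChartedSpace E M]
  {F : Type*} [NormedAddCommGroup F] [NormedSpace ℝ F]
  {N : Type*} [TopologicalSpace N] [ChartedSpace F N]

theorem chartRep_self (ι : N → M) (p : N) :
    chartRep (E := E) ι p (ι p) (extChartAt 𝓘(ℝ, F) p p) = extChartAt 𝓘(ℝ, E) (ι p) (ι p) := by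
  rw [chartRep, extChartAt_to_inv]

section

variable [IsManifold 𝓘(ℝ, E) ∞ M]

theorem ricci_eq_ricciAt [FiniteDimensional ℝ E] (g : LorentzMetric E M) (ι : N → M) (p : N)
    (v w : E) :
    (show E →L[ℝ] E →L[ℝ] ℝ from ricci g (ι p)) v w =
      ricciAt (chartMetric g (ι p)) (chartRep (E := E) ι p (ι p) (extChartAt 𝓘(ℝ, F) p p)) v w := by
  rw [chartRep_self]
  change ricciAt (chartMetric g (ι p)) (extChartAt 𝓘(ℝ, E) (ι p) (ι p))
    (chartD (ι p) (ι p) v) (chartD (ι p) (ι p) w) = _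
  rw [chartD_self, chartD_self]

variable {g : LorentzMetric E M} {ι : N → M} [FiniteDimensional ℝ E]
variable {Λ : ℝ} {T : ∀ x : M, TangentSpace 𝓘(ℝ, E) x →L[ℝ] TangentSpace 𝓘(ℝ, E) x →L[ℝ] ℝ}

/-- The energy-momentum tensor as a bilinear form on the model space. -/
def stressForm (T : ∀ x : M, TangentSpace 𝓘(ℝ, E) x →L[ℝ] TangentSpace 𝓘(ℝ, E) x →L[ℝ] ℝ) (x : M) :
    E →L[ℝ] E →L[ℝ] ℝ := T x

/-- On an orthogonal pair the terms proportional to the metric, with scalar curvature and `Λ`, drop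
out of the Einstein equations. -/
theorem ricciAt_eq_stress (hEin : EinsteinOn g ι Λ T) (p : N) {v w : E}
    (h : g.form (ι p) v w = 0) :
    ricciAt (chartMetric g (ι p)) (chartRep (E := E) ι p (ι p) (extChartAt 𝓘(ℝ, F) p p)) v w =
      stressForm T (ι p) v w := by
  have h1 : einstein g (ι p) v w = (-(Λ • g.val (ι p)) + T (ι p)) v w := by rw [hEin p]
  have h2 : (show E →L[ℝ] E →L[ℝ] ℝ from ricci g (ι p)) v w
      - (scalarCurvature g (ι p) / 2) * g.form (ι p) v w =
      -(Λ * g.form (ι p) v w) + stressForm T (ι p) v w := h1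
  rw [h] at h2
  rw [← ricci_eq_ricciAt]
  linarith

end

variable [IsManifold 𝓘(ℝ, F) ∞ N]

theorem chartDsymm_self (p : N) (X : F) : chartDsymm p (extChartAt 𝓘(ℝ, F) p p) X = X := by
  have h := chartDsymm_chartD (mem_chart_source F p) X
  rwa [chartD_self] at h

theorem chartField_self (Y : ∀ p : N, TangentSpace 𝓘(ℝ, F) p) (p : N) :
    chartField Y p (extChartAt 𝓘(ℝ, F) p p) = Y p := by
  rw [← chartDsymm_self p (chartField Y p (extChartAt 𝓘(ℝ, F) p p)),
    chartDsymm_chartField Y (mem_extChartAt_target p), extChartAt_to_inv]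

theorem mem_fieldDom {ι : N → M} {U : Set N} {Y : ∀ p : N, TangentSpace 𝓘(ℝ, F) p} {p₀ : N} {y : F}
    (hy : y ∈ surfDom E ι p₀) (hU : (extChartAt 𝓘(ℝ, F) p₀).symm y ∈ U)
    (h0 : Y ((extChartAt 𝓘(ℝ, F) p₀).symm y) ≠ 0) : y ∈ fieldDom E ι p₀ U Y := by
  refine ⟨hy, hU, fun h ↦ h0 ?_⟩
  rw [← chartDsymm_chartField Y hy.1, h, map_zero]
  rfl

theorem mem_fieldDom_self {ι : N → M} {U : Set N} {Y : ∀ p : N, TangentSpace 𝓘(ℝ, F) p} {p : N}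
    (hU : p ∈ U) (h0 : Y p ≠ 0) : extChartAt 𝓘(ℝ, F) p p ∈ fieldDom E ι p U Y := by
  refine mem_fieldDom (mem_surfDom ι p) ?_ ?_ <;> rwa [extChartAt_to_inv]

variable [IsManifold 𝓘(ℝ, E) ∞ M]

theorem fderiv_chartRep_self {ι : N → M} (hι : ContMDiff 𝓘(ℝ, F) 𝓘(ℝ, E) ∞ ι) (p : N) (X : F) :
    fderiv ℝ (chartRep (E := E) ι p (ι p)) (extChartAt 𝓘(ℝ, F) p p) X = mapD ι p X := by
  have h := fderiv_chartRep hι (mem_chart_source F p) (mem_chart_source E (ι p)) X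
  rwa [chartD_self, chartD_self] at h

theorem chartMetric_self (g : LorentzMetric E M) (x : M) (v w : E) :
    chartMetric g x (extChartAt 𝓘(ℝ, E) x x) v w = g.form x v w := by
  have h := chartMetric_chartD g (mem_chart_source E x) v w
  rwa [chartD_self, chartD_self] at h

variable {g : LorentzMetric E M} {ι : N → M} [FiniteDimensional ℝ E]

/-- The hypothesis offers at each point some null field without expansion, possibly a different one
each time, whereas Raychaudhuri's equation needs one fixed `ℓ` on a neighbourhood. The expansion is
tensorial in the field, and at each point `ℓ` is a multiple of the field offered there. -/
theorem nonExpanding_chart (hnull : IsNullImmersion (F := F) g ι)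
    (hdim : Module.finrank ℝ E = Module.finrank ℝ F + 1)
    (hexp : IsNonExpanding (F := F) g ι) {U : Set N} {ℓ : ∀ p : N, TangentSpace 𝓘(ℝ, F) p}
    (hℓ : IsNullFieldOn g ι U ℓ) {p₀ : N} {y : F} (hy : y ∈ fieldDom E ι p₀ U ℓ) :
    ∃ e : Fin (Module.finrank ℝ F - 1) → F,
      (∀ A B, chartMetric g (ι p₀) (chartRep (E := E) ι p₀ (ι p₀) y)
        (fderiv ℝ (chartRep (E := E) ι p₀ (ι p₀)) y (e A))
        (fderiv ℝ (chartRep (E := E) ι p₀ (ι p₀)) y (e B)) = if A = B then 1 else 0) ∧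
      ∑ A, chartMetric g (ι p₀) (chartRep (E := E) ι p₀ (ι p₀) y)
        (fderiv ℝ (chartRep (E := E) ι p₀ (ι p₀)) y (chartField ℓ p₀ y))
        (secondForm (chartMetric g (ι p₀)) (chartRep (E := E) ι p₀ (ι p₀)) y (e A) (e A)) = 0 := by
  set q := (extChartAt 𝓘(ℝ, F) p₀).symm y with hq
  obtain ⟨U', ℓ', hℓ', hqU', h0, hθ⟩ := hexp q
  obtain ⟨e, he, hsum⟩ : ∃ e : Fin (Module.finrank ℝ F - 1) → F,
    (∀ A B, inducedForm g ι q (e A) (e B) = if A = B then 1 else 0) ∧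
    ∑ A, derivTensor g ι ℓ' q (e A) (e A) = 0 := hθ
  have hyS := hy.1
  have hy' : y ∈ fieldDom E ι p₀ U' ℓ' := mem_fieldDom hyS hqU' h0
  have hS' := isHypersurface_fieldDom hnull hdim hℓ' p₀
  have hn' := isNullFieldIn_chartField hnull hℓ' p₀
  have hn := isNullFieldIn_chartField hnull hℓ p₀
  have hqs : q ∈ (chartAt F p₀).source := (surfDom_source hyS).1
  have hr : extChartAt 𝓘(ℝ, F) p₀ q = y := (extChartAt 𝓘(ℝ, F) p₀).right_inv hyS.1
  have hsymm : ∀ X, chartDsymm p₀ y (chartD p₀ q X) = X := fun X ↦ by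
    have := chartDsymm_chartD hqs X
    rwa [hr] at this
  obtain ⟨r, hr'⟩ := hS'.exists_smul_of_orthogonal hn' hy' (hn.null y hy (chartField ℓ p₀ y))
  refine ⟨fun A ↦ chartD (E := F) p₀ q (e A), fun A B ↦ ?_, ?_⟩
  · rw [metric_chartRep g hnull.contMDiff hyS, hsymm, hsymm, he]
  · have key : ∀ X : F, derivTensor g ι ℓ' q X X =
        -chartMetric g (ι p₀) (chartRep (E := E) ι p₀ (ι p₀) y)
          (fderiv ℝ (chartRep (E := E) ι p₀ (ι p₀)) y (chartField ℓ' p₀ y))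
          (secondForm (chartMetric g (ι p₀)) (chartRep (E := E) ι p₀ (ι p₀)) y (chartD p₀ q X)
            (chartD p₀ q X)) := fun X ↦ by
      rw [← hS'.metric_covD_push hn' hy', ← chartD_covAlong_push g hnull.contMDiff hyS ℓ'
        ((hn'.contDiffOn.contDiffAt (hS'.isOpen.mem_nhds hy')).differentiableAt (by simp)) X,
        fderiv_chartRep' hnull.contMDiff hyS, hsymm]
      refine Eq.trans ?_ (chartMetric_chartD g (surfDom_source hyS).2 _ _).symm
      exact g.symm _ _ _
    rw [hr']
    simp only [map_smul, smul_apply, ← Finset.smul_sum]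
    rw [← neg_eq_zero, ← smul_neg, ← Finset.sum_neg_distrib]
    refine smul_eq_zero_of_right _ ?_
    rw [← hsum]
    exact Finset.sum_congr rfl fun A _ ↦ (key (e A)).symm

variable {Λ : ℝ} {T : ∀ x : M, TangentSpace 𝓘(ℝ, E) x →L[ℝ] TangentSpace 𝓘(ℝ, E) x →L[ℝ] ℝ}

variable [FiniteDimensional ℝ F]

/-- The null surface is totally geodesic and the Ricci tensor vanishes on its null direction. -/
theorem totally_geodesic (hnull : IsNullImmersion (F := F) g ι)
    (hdim : Module.finrank ℝ E = Module.finrank ℝ F + 1)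
    (hexp : IsNonExpanding (F := F) g ι) (hEin : EinsteinOn g ι Λ T)
    (hT : NullEnergyCondition (F := F) g ι T)
    {U : Set N} {ℓ : ∀ p : N, TangentSpace 𝓘(ℝ, F) p}
    (hℓ : IsNullFieldOn g ι U ℓ) {p : N} (hp : p ∈ U) (h0 : ℓ p ≠ 0) :
    stressForm T (ι p) (mapD (E := E) (F := F) ι p (ℓ p)) (mapD (E := E) (F := F) ι p (ℓ p)) = 0 ∧
    ∀ X Y : F, g.form (ι p) (mapD (E := E) (F := F) ι p (ℓ p))
      (secondForm (chartMetric g (ι p)) (chartRep (E := E) ι p (ι p)) (extChartAt 𝓘(ℝ, F) p p) X Y)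
        = 0 := by
  have hS := isHypersurface_fieldDom hnull hdim hℓ p
  have hn := isNullFieldIn_chartField hnull hℓ p
  have hy := mem_fieldDom_self (E := E) (ι := ι) hp h0
  have hgk : g.form (ι p) (mapD (E := E) (F := F) ι p (ℓ p)) (mapD (E := E) (F := F) ι p (ℓ p)) = 0 :=
    hℓ.null p hp
  have hk : fderiv ℝ (chartRep (E := E) ι p (ι p)) (extChartAt 𝓘(ℝ, F) p p)
      (chartField ℓ p (extChartAt 𝓘(ℝ, F) p p)) = mapD (E := E) (F := F) ι p (ℓ p) :=
    (congrArg _ (chartField_self ℓ p)).trans (fderiv_chartRep_self hnull.contMDiff p (ℓ p))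
  -- Zero expansion enters on a whole neighbourhood, the sign of the Ricci tensor only at `p`.
  have h := hS.shear_free hn hy (by
    filter_upwards [hS.isOpen.mem_nhds hy] with z hz
      using nonExpanding_chart hnull hdim hexp hℓ hz)
  rw [hk, ricciAt_eq_stress hEin p hgk] at h
  obtain ⟨h1, h2⟩ := h (hT p (ℓ p) (hℓ.null p hp))
  refine ⟨h1, fun X Y ↦ ?_⟩
  rw [← h2 X Y, chartRep_self]
  exact (chartMetric_self g (ι p) _ _).symm

end NullSurfaceGeometry

end NullSurface

end

noncomputable section

namespace NullSurface

/-! ### Induced connection and rotation potential -/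

section RotationPotential

variable {E : Type*} [NormedAddCommGroup E] [NormedSpace ℝ E]
  {M : Type*} [TopologicalSpace M] [ChartedSpace E M] [IsManifold 𝓘(ℝ, E) ∞ M]
  {F : Type*} [NormedAddCommGroup F] [NormedSpace ℝ F]
  {N : Type*} [TopologicalSpace N] [ChartedSpace F N]
  {g : LorentzMetric E M} {ι : N → M}

/-- The value of a 1-form as a functional on the model space. -/
def oneFormAt (α : ∀ p : N, TangentSpace 𝓘(ℝ, F) p →L[ℝ] ℝ) (p : N) : F →L[ℝ] ℝ := α p

theorem chartOneForm_apply (α : ∀ p : N, TangentSpace 𝓘(ℝ, F) p →L[ℝ] ℝ) (c : N) (y X : F) :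
    chartOneForm α c y X = oneFormAt α ((extChartAt 𝓘(ℝ, F) c).symm y) (chartDsymm c y X) :=
  rfl

theorem mapD_inducedDeriv_of_exists {Y : ∀ p : N, TangentSpace 𝓘(ℝ, F) p} {p : N} {X : F}
    (h : ∃ Z : F, mapD (E := E) (F := F) ι p Z = covAlong g ι (push ι Y) p X) :
    mapD (E := E) (F := F) ι p (inducedDeriv g ι Y p X) = covAlong g ι (push ι Y) p X :=
  Classical.epsilon_spec (p := fun Z : TangentSpace 𝓘(ℝ, F) p ↦
    mfderiv 𝓘(ℝ, F) 𝓘(ℝ, E) ι p Z = covAlong g ι (push ι Y) p X) h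

theorem mapD_injective (hnull : IsNullImmersion (F := F) g ι) (p : N) :
    Function.Injective (mapD (E := E) (F := F) ι p) :=
  hnull.injective p

variable [FiniteDimensional ℝ E] [IsManifold 𝓘(ℝ, F) ∞ N]

/-- The covariant derivative along `ι` of a tangent field, computed in the charts at the point. -/
theorem covAlong_push_self (hι : ContMDiff 𝓘(ℝ, F) 𝓘(ℝ, E) ∞ ι) (p : N)
    (Y : ∀ p : N, TangentSpace 𝓘(ℝ, F) p)
    (hY : DifferentiableAt ℝ (chartField Y p) (extChartAt 𝓘(ℝ, F) p p)) (X : F) :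
    covAlong g ι (push ι Y) p X =
      covD (chartMetric g (ι p)) (chartRep (E := E) ι p (ι p))
        (fun z ↦ fderiv ℝ (chartRep (E := E) ι p (ι p)) z (chartField Y p z))
        (extChartAt 𝓘(ℝ, F) p p) X := by
  have h := chartD_covAlong_push g hι (mem_surfDom ι p) Y hY
  rw [extChartAt_to_inv] at h
  have h' := h X
  rw [chartD_self] at h'
  exact (chartD_self (E := E) (ι p) _).symm.trans h'

variable {Λ : ℝ} {T : ∀ x : M, TangentSpace 𝓘(ℝ, E) x →L[ℝ] TangentSpace 𝓘(ℝ, E) x →L[ℝ] ℝ}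

theorem differentiableAt_chartField {U : Set N} (hU : IsOpen U)
    {Y : ∀ p : N, TangentSpace 𝓘(ℝ, F) p} (hY : IsSmoothFieldOn U Y) {p : N} (hp : p ∈ U) :
    DifferentiableAt ℝ (chartField Y p) (extChartAt 𝓘(ℝ, F) p p) := by
  refine (ContDiffOn.contDiffAt (contDiffOn_chartField hU hY p) ?_).differentiableAt (by simp)
  refine (isOpen_preimage_chart hU).mem_nhds ⟨mem_extChartAt_target p, ?_⟩
  rwa [Set.mem_preimage, extChartAt_to_inv]

variable [FiniteDimensional ℝ F]

/-- The induced covariant derivative is well defined. -/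
theorem mapD_inducedDeriv (hnull : IsNullImmersion (F := F) g ι)
    (hdim : Module.finrank ℝ E = Module.finrank ℝ F + 1)
    (hexp : IsNonExpanding (F := F) g ι) (hEin : EinsteinOn g ι Λ T)
    (hT : NullEnergyCondition (F := F) g ι T) {p : N} {Y : ∀ p : N, TangentSpace 𝓘(ℝ, F) p}
    (hY : DifferentiableAt ℝ (chartField Y p) (extChartAt 𝓘(ℝ, F) p p)) (X : F) :
    mapD (E := E) (F := F) ι p (inducedDeriv g ι Y p X) = covAlong g ι (push ι Y) p X := by
  obtain ⟨U, ℓ, hℓ, hp, h0, -⟩ := hexp p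
  refine mapD_inducedDeriv_of_exists ?_
  have hS := isHypersurface_chartRep hnull hdim p
  -- Only the second-form term of `∇_X Y` could leave the tangent space; it is orthogonal to the
  -- null normal, hence tangent.
  obtain ⟨Z, hZ⟩ := (g.isLorentz (ι p)).mem_range_of_orthogonal (A := mapD (E := E) (F := F) ι p)
    (mapD_injective hnull p) hdim (k := mapD (E := E) (F := F) ι p (ℓ p))
    (fun h ↦ h0 (mapD_injective hnull p (h.trans (map_zero _).symm)))
    (fun X ↦ inducedForm_null hnull (hℓ.null p hp) X)
    ((totally_geodesic hnull hdim hexp hEin hT hℓ hp h0).2 X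
      (chartField Y p (extChartAt 𝓘(ℝ, F) p p)))
  rw [covAlong_push_self hnull.contMDiff p Y hY, hS.covD_push (mem_surfDom ι p) hY,
    fderiv_chartRep_self hnull.contMDiff, ← hZ, ← map_add]
  exact ⟨_, rfl⟩

/-- `∇_X ℓ` is tangent, and orthogonal to all tangent vectors because the second form is orthogonal
to `ℓ`; such a vector is a multiple of `ℓ`. -/
theorem inducedDeriv_null (hnull : IsNullImmersion (F := F) g ι)
    (hdim : Module.finrank ℝ E = Module.finrank ℝ F + 1)
    (hexp : IsNonExpanding (F := F) g ι) (hEin : EinsteinOn g ι Λ T)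
    (hT : NullEnergyCondition (F := F) g ι T)
    {U : Set N} {ℓ : ∀ p : N, TangentSpace 𝓘(ℝ, F) p}
    (hℓ : IsNullFieldOn g ι U ℓ) {p : N} (hp : p ∈ U) (h0 : ℓ p ≠ 0)
    (X : TangentSpace 𝓘(ℝ, F) p) :
    inducedDeriv g ι ℓ p X = rotationForm g ι ℓ p X • ℓ p := by
  have hS := isHypersurface_fieldDom hnull hdim hℓ p
  have hn := isNullFieldIn_chartField hnull hℓ p
  have hy := mem_fieldDom_self (E := E) (ι := ι) hp h0
  have hd := differentiableAt_chartField hℓ.isOpen hℓ.smooth hp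
  set y := extChartAt 𝓘(ℝ, F) p p with hydef
  set A := covD (chartMetric g (ι p)) (chartRep (E := E) ι p (ι p))
    (fun z ↦ fderiv ℝ (chartRep (E := E) ι p (ι p)) z (chartField ℓ p z)) y with hA
  have hk : fderiv ℝ (chartRep (E := E) ι p (ι p)) y (chartField ℓ p y) =
      mapD (E := E) (F := F) ι p (ℓ p) :=
    (congrArg _ (chartField_self ℓ p)).trans (fderiv_chartRep_self hnull.contMDiff p (ℓ p))
  have hgeo := (totally_geodesic hnull hdim hexp hEin hT hℓ hp h0).2
  have hAX : ∀ X, ∃ r : ℝ, A X = r • mapD (E := E) (F := F) ι p (ℓ p) := fun X ↦ by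
    obtain ⟨Z, hZ⟩ := hS.exists_covD_eq hn hy X
    have hZ0 : chartMetric g (ι p) (chartRep (E := E) ι p (ι p) y)
        (fderiv ℝ (chartRep (E := E) ι p (ι p)) y Z)
        (fderiv ℝ (chartRep (E := E) ι p (ι p)) y Z) = 0 := by
      nth_rewrite 1 [hZ]
      rw [hS.metric_covD_push hn hy, hk, hydef, chartRep_self, chartMetric_self, hgeo, neg_zero]
    obtain ⟨r, hr⟩ := hS.exists_smul_of_orthogonal hn hy hZ0
    exact ⟨r, by rw [hA, ← hZ, hr, map_smul, hk]⟩
  have hk0 : mapD (E := E) (F := F) ι p (ℓ p) ≠ 0 := hk ▸ hS.push_ne_zero hn hy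
  -- A functional with value 1 on the image of `ℓ` reads off the coefficient, which shows it to be
  -- linear and continuous in `X`.
  obtain ⟨lam, hlam⟩ := SeparatingDual.exists_eq_one (R := ℝ) hk0
  have key : ∀ X : F, A X = mapD (E := E) (F := F) ι p ((lam ∘L A) X • ℓ p) := fun X ↦ by
    obtain ⟨r, hr⟩ := hAX X
    have e1 : (lam ∘L A) X = r := by
      rw [ContinuousLinearMap.comp_apply, hr, map_smul, hlam, smul_eq_mul, mul_one]
    refine hr.trans (Eq.trans ?_ ((mapD (E := E) (F := F) ι p).map_smul ((lam ∘L A) X) (ℓ p)).symm)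
    rw [e1]
  have hex : ∃ α : TangentSpace 𝓘(ℝ, F) p →L[ℝ] ℝ, ∀ X, inducedDeriv g ι ℓ p X = α X • ℓ p :=
    ⟨(lam ∘L A : F →L[ℝ] ℝ), fun X ↦ mapD_injective hnull p
      ((mapD_inducedDeriv hnull hdim hexp hEin hT hd X).trans
        ((covAlong_push_self hnull.contMDiff p ℓ hd X).trans (key X)))⟩
  exact Classical.epsilon_spec hex X

/-- Carries the pointwise relation `D ℓ = ω ℓ` into one fixed chart at all nearby points, where it
can be differentiated. -/
theorem covD_push_rotationForm (hnull : IsNullImmersion (F := F) g ι)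
    (hdim : Module.finrank ℝ E = Module.finrank ℝ F + 1)
    (hexp : IsNonExpanding (F := F) g ι) (hEin : EinsteinOn g ι Λ T)
    (hT : NullEnergyCondition (F := F) g ι T)
    {U : Set N} {ℓ : ∀ p : N, TangentSpace 𝓘(ℝ, F) p}
    (hℓ : IsNullFieldOn g ι U ℓ) {p₀ : N} {y : F} (hy : y ∈ fieldDom E ι p₀ U ℓ) (X : F) :
    covD (chartMetric g (ι p₀)) (chartRep (E := E) ι p₀ (ι p₀))
        (fun z ↦ fderiv ℝ (chartRep (E := E) ι p₀ (ι p₀)) z (chartField ℓ p₀ z)) y X =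
      chartOneForm (rotationForm g ι ℓ) p₀ y X •
        fderiv ℝ (chartRep (E := E) ι p₀ (ι p₀)) y (chartField ℓ p₀ y) := by
  have hS := isHypersurface_fieldDom hnull hdim hℓ p₀
  have hn := isNullFieldIn_chartField hnull hℓ p₀
  have hd : DifferentiableAt ℝ (chartField ℓ p₀) y :=
    (hn.contDiffOn.contDiffAt (hS.isOpen.mem_nhds hy)).differentiableAt (by simp)
  have h := chartD_covAlong_push g hnull.contMDiff hy.1 ℓ hd (chartDsymm p₀ y X)
  rw [chartD_chartDsymm hy.1.1] at h
  rw [← h, fderiv_chartRep' hnull.contMDiff hy.1, chartDsymm_chartField ℓ hy.1.1]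
  have hU := hy.2.1
  have h0 : ℓ ((extChartAt 𝓘(ℝ, F) p₀).symm y) ≠ 0 := fun h ↦ hy.2.2 (by
    change chartD (E := F) p₀ _ (ℓ ((extChartAt 𝓘(ℝ, F) p₀).symm y)) = 0
    rw [h]
    exact map_zero (chartD (E := F) p₀ _))
  rw [chartOneForm_apply]
  generalize (extChartAt 𝓘(ℝ, F) p₀).symm y = q at *
  have h1 := mapD_inducedDeriv hnull hdim hexp hEin hT
    (differentiableAt_chartField hℓ.isOpen hℓ.smooth hU) (chartDsymm p₀ y X)
  have h2 := (h1.symm.trans (congrArg (mapD (E := E) (F := F) ι q)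
    (inducedDeriv_null hnull hdim hexp hEin hT hℓ hU h0 (chartDsymm p₀ y X)))).trans
    ((mapD (E := E) (F := F) ι q).map_smul (oneFormAt (rotationForm g ι ℓ) q (chartDsymm p₀ y X))
      (ℓ q))
  rw [← (chartD (E := E) (ι p₀) (ι q)).map_smul]
  exact congrArg (chartD (E := E) (ι p₀) (ι q)) h2

/-- Pairing `∇k = ω k` with a functional `lam` that does not vanish on `k` gives `ω = lam(∇k) /
lam(k)`, a quotient of smooth expressions. -/
theorem contDiffAt_rotationForm (hnull : IsNullImmersion (F := F) g ι)
    (hdim : Module.finrank ℝ E = Module.finrank ℝ F + 1)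
    (hexp : IsNonExpanding (F := F) g ι) (hEin : EinsteinOn g ι Λ T)
    (hT : NullEnergyCondition (F := F) g ι T)
    {U : Set N} {ℓ : ∀ p : N, TangentSpace 𝓘(ℝ, F) p}
    (hℓ : IsNullFieldOn g ι U ℓ) {p₀ : N} {y : F} (hy : y ∈ fieldDom E ι p₀ U ℓ) :
    ContDiffAt ℝ ∞ (chartOneForm (rotationForm g ι ℓ) p₀) y := by
  have hS := isHypersurface_fieldDom hnull hdim hℓ p₀
  have hn := isNullFieldIn_chartField hnull hℓ p₀
  set k : F → E := fun z ↦ fderiv ℝ (chartRep (E := E) ι p₀ (ι p₀)) z (chartField ℓ p₀ z) with hk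
  have hkd : ContDiffAt ℝ ∞ k y := hS.contDiffAt_push hn hy
  obtain ⟨lam, hlam⟩ := SeparatingDual.exists_ne_zero (R := ℝ) (hS.push_ne_zero hn hy)
  have hlk : ContDiffAt ℝ ∞ (fun z ↦ lam (k z)) y := lam.contDiff.contDiffAt.comp y hkd
  have h1 : ContDiffAt ℝ ∞ (fun z ↦ (lam (k z))⁻¹ • (lam ∘L
      covD (chartMetric g (ι p₀)) (chartRep (E := E) ι p₀ (ι p₀)) k z)) y :=
    (hlk.inv hlam).smul (contDiffAt_const.clm_comp (hS.contDiffAt_covD hy hkd))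
  refine h1.congr_of_eventuallyEq ?_
  filter_upwards [hS.isOpen.mem_nhds hy, hlk.continuousAt.eventually_ne hlam] with z hz hz0
  ext X
  have h2 := congrArg lam (covD_push_rotationForm hnull hdim hexp hEin hT hℓ hz X)
  rw [map_smul, smul_eq_mul] at h2
  simp only [smul_apply, ContinuousLinearMap.comp_apply, smul_eq_mul]
  rw [eq_inv_mul_iff_mul_eq₀ hz0, mul_comm]
  exact h2.symm

end RotationPotential

end NullSurface

end

noncomputable section

namespace NullSurface

/-! ### Exterior derivative and smoothness of forms in charts -/

section SmoothForms

variable {F : Type*} [NormedAddCommGroup F] [NormedSpace ℝ F]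
  {N : Type*} [TopologicalSpace N] [ChartedSpace F N]

/-- A `(0,2)` tensor field as a bilinear form on the model space. -/
def twoTensorAt (β : ∀ p : N, TangentSpace 𝓘(ℝ, F) p →L[ℝ] TangentSpace 𝓘(ℝ, F) p →L[ℝ] ℝ)
    (p : N) : F →L[ℝ] F →L[ℝ] ℝ := β p

theorem chartTwoTensor_apply
    (β : ∀ p : N, TangentSpace 𝓘(ℝ, F) p →L[ℝ] TangentSpace 𝓘(ℝ, F) p →L[ℝ] ℝ) (c : N) (y X Y : F) :
    chartTwoTensor β c y X Y =
      twoTensorAt β ((extChartAt 𝓘(ℝ, F) c).symm y) (chartDsymm c y X) (chartDsymm c y Y) :=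
  rfl

/-- The exterior derivative of a 1-form at `p`, as a bilinear form on the model space. -/
def dForm (α : ∀ p : N, TangentSpace 𝓘(ℝ, F) p →L[ℝ] ℝ) (p : N) : F →L[ℝ] F →L[ℝ] ℝ :=
  fderiv ℝ (chartOneForm α p) (extChartAt 𝓘(ℝ, F) p p) -
    (fderiv ℝ (chartOneForm α p) (extChartAt 𝓘(ℝ, F) p p)).flip

theorem dForm_apply (α : ∀ p : N, TangentSpace 𝓘(ℝ, F) p →L[ℝ] ℝ) (p : N) (X Y : F) :
    dForm α p X Y = fderiv ℝ (chartOneForm α p) (extChartAt 𝓘(ℝ, F) p p) X Y -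
      fderiv ℝ (chartOneForm α p) (extChartAt 𝓘(ℝ, F) p p) Y X :=
  rfl

variable [IsManifold 𝓘(ℝ, F) ∞ N]

theorem extDerivOneForm_eq (α : ∀ p : N, TangentSpace 𝓘(ℝ, F) p →L[ℝ] ℝ) (p : N) (X Y : F) :
    extDerivOneForm α p X Y = dForm α p X Y := by
  change fderiv ℝ (chartOneForm α p) (extChartAt 𝓘(ℝ, F) p p) (chartD p p X) (chartD p p Y) -
    fderiv ℝ (chartOneForm α p) (extChartAt 𝓘(ℝ, F) p p) (chartD p p Y) (chartD p p X) = _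
  rw [chartD_self, chartD_self, dForm_apply]

/-- The exterior derivative of a 1-form may be computed in any chart. -/
theorem fderiv_chartOneForm_sub (α : ∀ p : N, TangentSpace 𝓘(ℝ, F) p →L[ℝ] ℝ) {p₀ q : N}
    (hq : q ∈ (chartAt F p₀).source)
    (hα : DifferentiableAt ℝ (chartOneForm α q) (extChartAt 𝓘(ℝ, F) q q)) (X Y : F) :
    fderiv ℝ (chartOneForm α p₀) (extChartAt 𝓘(ℝ, F) p₀ q) X Y -
      fderiv ℝ (chartOneForm α p₀) (extChartAt 𝓘(ℝ, F) p₀ q) Y X =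
      dForm α q (chartDsymm p₀ (extChartAt 𝓘(ℝ, F) p₀ q) X)
        (chartDsymm p₀ (extChartAt 𝓘(ℝ, F) p₀ q) Y) := by
  have hqs : q ∈ (extChartAt 𝓘(ℝ, F) p₀).source := by simpa using hq
  set y := extChartAt 𝓘(ℝ, F) p₀ q with hy
  have hyt : y ∈ (extChartAt 𝓘(ℝ, F) p₀).target := (extChartAt 𝓘(ℝ, F) p₀).map_source hqs
  have hyq : (extChartAt 𝓘(ℝ, F) p₀).symm y = q := (extChartAt 𝓘(ℝ, F) p₀).left_inv hqs
  let χ : F → F := chartRep (E := F) (id : N → N) p₀ q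
  have hχy : χ y = extChartAt 𝓘(ℝ, F) q q := by simp only [χ, chartRep, hyq, id]
  have hχd : ContDiffAt ℝ ∞ χ y := contDiffAt_chartRep contMDiff_id hyt (by
    rw [hyq]; exact mem_chart_source F q)
  have hDχ : ∀ X, fderiv ℝ χ y X = chartDsymm p₀ y X := fun X ↦ by
    rw [hy, fderiv_transition' hq (mem_chart_source F q), chartD_self]
  have hχ1 : HasFDerivAt χ (fderiv ℝ χ y) y := (hχd.differentiableAt (by simp)).hasFDerivAt
  have hχ2 : HasFDerivAt (fderiv ℝ χ) (fderiv ℝ (fderiv ℝ χ) y) y :=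
    ((hχd.fderiv_right (m := ∞) (by simp)).differentiableAt (by simp)).hasFDerivAt
  have hα' : HasFDerivAt (chartOneForm α q)
      (fderiv ℝ (chartOneForm α q) (extChartAt 𝓘(ℝ, F) q q)) (χ y) := hχy ▸ hα.hasFDerivAt
  have hsrc : ∀ᶠ z in 𝓝 y, z ∈ transDom (E := F) p₀ q :=
    (isOpen_preimage_chart (isOpen_extChartAt_source q)).mem_nhds
      ⟨hyt, by rw [Set.mem_preimage, hyq]; exact mem_extChartAt_source q⟩
  have hev : chartOneForm α p₀ =ᶠ[𝓝 y] fun z ↦ (chartOneForm α q (χ z)) ∘L fderiv ℝ χ z := by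
    filter_upwards [hsrc] with z hz
    ext Z
    have h1 : (extChartAt 𝓘(ℝ, F) p₀).symm z ∈ (chartAt F p₀).source := by
      simpa using (extChartAt 𝓘(ℝ, F) p₀).map_target hz.1
    have h2 : (extChartAt 𝓘(ℝ, F) p₀).symm z ∈ (chartAt F q).source := by simpa using hz.2
    have h3 := fderiv_transition' h1 h2 Z
    rw [(extChartAt 𝓘(ℝ, F) p₀).right_inv hz.1] at h3
    rw [ContinuousLinearMap.comp_apply, h3, chartOneForm_apply, chartOneForm_apply]
    have h4 := chartDsymm_chartD h2 (chartDsymm p₀ z Z)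
    have h5 : χ z = extChartAt 𝓘(ℝ, F) q ((extChartAt 𝓘(ℝ, F) p₀).symm z) := rfl
    rw [h5, h4, (extChartAt 𝓘(ℝ, F) q).left_inv (by simpa using h2)]
  have hd := (hα'.comp y hχ1).clm_comp hχ2
  -- The second derivative of the change of charts is symmetric and disappears on antisymmetrizing.
  have key : ∀ X Y, fderiv ℝ (chartOneForm α p₀) y X Y =
      fderiv ℝ (chartOneForm α q) (extChartAt 𝓘(ℝ, F) q q) (chartDsymm p₀ y X) (chartDsymm p₀ y Y)
        + chartOneForm α q (χ y) (fderiv ℝ (fderiv ℝ χ) y X Y) := fun X Y ↦ by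
    have h : fderiv ℝ (fun z ↦ (chartOneForm α q (χ z)) ∘L fderiv ℝ χ z) y = _ := hd.fderiv
    rw [hev.fderiv_eq, h, ← hDχ, ← hDχ]
    simp
    ring
  rw [key, key, dForm_apply, (hχd.isSymmSndFDerivAt minSmoothness_two_le) X Y]
  ring

theorem chartDsymm_eq_symmL {p q : N} (hq : q ∈ (chartAt F p).source) (X : F) :
    (trivializationAt F (TangentSpace 𝓘(ℝ, F)) p).symmL ℝ q X =
      chartDsymm p (extChartAt 𝓘(ℝ, F) p q) X := by
  have h := TangentBundle.symmL_trivializationAt (I := 𝓘(ℝ, F)) hq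
  simp only [ModelWithCorners.range_eq_univ, mfderivWithin_univ] at h
  exact DFunLike.congr_fun h X

/-- Smoothness at a point may be tested in the trivialization centred there, in which the form is
given by its chart components. -/
theorem isSmoothOneFormOn_of_chart {U : Set N} {α : ∀ p : N, TangentSpace 𝓘(ℝ, F) p →L[ℝ] ℝ}
    (hα : ∀ p ∈ U, ContDiffAt ℝ ∞ (chartOneForm α p) (extChartAt 𝓘(ℝ, F) p p)) :
    IsSmoothOneFormOn U α := by
  intro p hp
  refine ContMDiffAt.contMDiffWithinAt ((Bundle.contMDiffAt_section p).2 ?_)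
  have h1 := (hα p hp).contMDiffAt.comp p (contMDiffAt_extChartAt (I := 𝓘(ℝ, F)) (n := ∞))
  refine h1.congr_of_eventuallyEq ?_
  filter_upwards [(chartAt F p).open_source.mem_nhds (mem_chart_source F p)] with q hq
  ext X
  rw [Function.comp_apply, chartOneForm_apply, (extChartAt 𝓘(ℝ, F) p).left_inv (by simpa using hq),
    ← chartDsymm_eq_symmL hq]
  simp only [hom_trivializationAt_apply, ContinuousLinearMap.inCoordinates,
    ContinuousLinearMap.comp_apply]
  exact DFunLike.congr_fun (Bundle.Trivial.continuousLinearMapAt_trivialization ℝ N ℝ q) _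

theorem isSmoothTwoTensor_of_chart
    {β : ∀ p : N, TangentSpace 𝓘(ℝ, F) p →L[ℝ] TangentSpace 𝓘(ℝ, F) p →L[ℝ] ℝ}
    (hβ : ∀ p, ContDiffAt ℝ ∞ (chartTwoTensor β p) (extChartAt 𝓘(ℝ, F) p p)) :
    IsSmoothTwoTensor β := by
  intro p
  refine (Bundle.contMDiffAt_section p).2 ?_
  have h1 := (hβ p).contMDiffAt.comp p (contMDiffAt_extChartAt (I := 𝓘(ℝ, F)) (n := ∞))
  refine h1.congr_of_eventuallyEq ?_
  filter_upwards [(chartAt F p).open_source.mem_nhds (mem_chart_source F p)] with q hq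
  ext X Y
  rw [Function.comp_apply, chartTwoTensor_apply,
    (extChartAt 𝓘(ℝ, F) p).left_inv (by simpa using hq), ← chartDsymm_eq_symmL hq,
    ← chartDsymm_eq_symmL hq]
  simp only [hom_trivializationAt_apply]
  rw [inCoordinates_apply_eq₂ hq hq (by simp)]
  refine (DFunLike.congr_fun (Bundle.Trivial.linearMapAt_trivialization ℝ N ℝ q) _).trans ?_
  have h := fun Z ↦ (trivializationAt F (TangentSpace 𝓘(ℝ, F)) p).symmL_apply (R := ℝ) hq Z
  exact congrArg₂ (fun a b ↦ twoTensorAt β q a b) (h X).symm (h Y).symm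

end SmoothForms

end NullSurface

end

noncomputable section

namespace NullSurface

/-! ### Exact 2-forms on the model space -/

section Curl

variable {F : Type*} [NormedAddCommGroup F] [NormedSpace ℝ F]

/-- The exterior derivative `(X, Y) ↦ ∂_X α(Y) - ∂_Y α(X)` of a 1-form on a normed space. -/
def curl (α : F → F →L[ℝ] ℝ) (y : F) : F →L[ℝ] F →L[ℝ] ℝ :=
  fderiv ℝ α y - (fderiv ℝ α y).flip

theorem curl_apply (α : F → F →L[ℝ] ℝ) (y X Y : F) :
    curl α y X Y = fderiv ℝ α y X Y - fderiv ℝ α y Y X :=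
  rfl

theorem curl_antisymm (α : F → F →L[ℝ] ℝ) (y X Y : F) : curl α y X Y = -curl α y Y X := by
  rw [curl_apply, curl_apply, neg_sub]

theorem contDiffAt_curl {α : F → F →L[ℝ] ℝ} {y : F} (hα : ContDiffAt ℝ ∞ α y) :
    ContDiffAt ℝ ∞ (curl α) y := by
  have h : ContDiffAt ℝ ∞ (fderiv ℝ α) y := hα.fderiv_right (by simp)
  exact h.sub ((ContinuousLinearMap.flipₗᵢ ℝ F F ℝ).toContinuousLinearEquiv.contDiff.contDiffAt.comp
    y h)

theorem fderiv_curl_apply {α : F → F →L[ℝ] ℝ} {y : F} (hα : ContDiffAt ℝ ∞ α y) (X Y Z : F) :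
    fderiv ℝ (curl α) y X Y Z =
      fderiv ℝ (fderiv ℝ α) y X Y Z - fderiv ℝ (fderiv ℝ α) y X Z Y := by
  have h : HasFDerivAt (fderiv ℝ α) (fderiv ℝ (fderiv ℝ α) y) y :=
    ((hα.fderiv_right (m := ∞) (by simp)).differentiableAt (by simp)).hasFDerivAt
  have h1 := (((contDiffAt_curl hα).differentiableAt (by simp)).hasFDerivAt.clm_apply
    (hasFDerivAt_const Y y)).clm_apply (hasFDerivAt_const Z y)
  have h2 := ((h.clm_apply (hasFDerivAt_const Y y)).clm_apply (hasFDerivAt_const Z y)).sub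
    ((h.clm_apply (hasFDerivAt_const Z y)).clm_apply (hasFDerivAt_const Y y))
  simpa using DFunLike.congr_fun (h1.unique h2) X

/-- The exterior derivative is closed. -/
theorem fderiv_curl_cyclic {α : F → F →L[ℝ] ℝ} {y : F} (hα : ContDiffAt ℝ ∞ α y) (X Y Z : F) :
    fderiv ℝ (curl α) y X Y Z + fderiv ℝ (curl α) y Y Z X + fderiv ℝ (curl α) y Z X Y = 0 := by
  have h := hα.isSymmSndFDerivAt minSmoothness_two_le
  rw [fderiv_curl_apply hα, fderiv_curl_apply hα, fderiv_curl_apply hα, h X Y, h Y Z, h Z X]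
  ring

/-- A 2-form that is exact and annihilated by a vector field is Lie dragged by that field. -/
theorem lie_curl_eq_zero {α : F → F →L[ℝ] ℝ} {y : F} (hα : ContDiffAt ℝ ∞ α y) {ℓ : F → F}
    (hℓ : DifferentiableAt ℝ ℓ y) (h0 : ∀ᶠ z in 𝓝 y, ∀ X, curl α z (ℓ z) X = 0) (X Y : F) :
    fderiv ℝ (curl α) y (ℓ y) X Y + curl α y (fderiv ℝ ℓ y X) Y + curl α y X (fderiv ℝ ℓ y Y)
      = 0 := by
  -- Derivative of the identity `dα(ℓ, Y) = 0`; inserted into closedness for `ℓ, X, Y`, it yields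
  -- the Lie derivative.
  have key : ∀ X Y, fderiv ℝ (curl α) y X (ℓ y) Y + curl α y (fderiv ℝ ℓ y X) Y = 0 := fun X Y ↦ by
    have h1 := (((contDiffAt_curl hα).differentiableAt (by simp)).hasFDerivAt.clm_apply
      hℓ.hasFDerivAt).clm_apply (hasFDerivAt_const Y y)
    have h2 : (fun z ↦ curl α z (ℓ z) Y) =ᶠ[𝓝 y] fun _ ↦ 0 := by
      filter_upwards [h0] with z hz using hz Y
    simpa [add_comm] using DFunLike.congr_fun
      (h1.unique ((hasFDerivAt_const (0 : ℝ) y).congr_of_eventuallyEq h2)) X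
  have hc := fderiv_curl_cyclic hα (ℓ y) X Y
  have h1 := key X Y
  have h2 := key Y X
  have h3 : fderiv ℝ (curl α) y X Y (ℓ y) = -fderiv ℝ (curl α) y X (ℓ y) Y := by
    rw [fderiv_curl_apply hα, fderiv_curl_apply hα, neg_sub]
  rw [curl_antisymm α y X]
  linarith

end Curl

/-! ### Cartan's formula on the surface -/

section LieDerivative

variable {F : Type*} [NormedAddCommGroup F] [NormedSpace ℝ F]
  {N : Type*} [TopologicalSpace N] [ChartedSpace F N] [IsManifold 𝓘(ℝ, F) ∞ N]

/-- Cartan's formula for a 1-form whose exterior derivative is annihilated by the field. -/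
theorem lieOneForm_eq_mfderiv {ℓ : ∀ p : N, TangentSpace 𝓘(ℝ, F) p}
    {α : ∀ p : N, TangentSpace 𝓘(ℝ, F) p →L[ℝ] ℝ} {p : N}
    (hℓ : DifferentiableAt ℝ (chartField ℓ p) (extChartAt 𝓘(ℝ, F) p p))
    (hα : DifferentiableAt ℝ (chartOneForm α p) (extChartAt 𝓘(ℝ, F) p p)) (X : F)
    (h0 : dForm α p (ℓ p) X = 0) :
    lieOneForm ℓ α p X = mapD (E := ℝ) (fun q ↦ oneFormAt α q (ℓ q)) p X := by
  set y := extChartAt 𝓘(ℝ, F) p p with hy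
  have hev : (fun z ↦ oneFormAt α ((extChartAt 𝓘(ℝ, F) p).symm z)
      (ℓ ((extChartAt 𝓘(ℝ, F) p).symm z))) =ᶠ[𝓝 y]
      fun z ↦ chartOneForm α p z (chartField ℓ p z) := by
    filter_upwards [(isOpen_extChartAt_target p).mem_nhds (mem_extChartAt_target p)] with z hz
    rw [chartOneForm_apply, chartDsymm_chartField ℓ hz]
  have hd := hα.hasFDerivAt.clm_apply hℓ.hasFDerivAt
  have hm := mfderiv_eq_fderiv_chart (E := ℝ) (u := fun q ↦ oneFormAt α q (ℓ q))
    (mem_chart_source F p) (hd.congr_of_eventuallyEq hev).differentiableAt X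
  rw [hm, hev.fderiv_eq, chartD_self, hd.fderiv]
  change fderiv ℝ (chartOneForm α p) y (chartField ℓ p y) (chartD p p X) +
    chartOneForm α p y (fderiv ℝ (chartField ℓ p) y (chartD p p X)) = _
  rw [chartD_self]
  -- The Lie derivative of `α` and the derivative of `α(ℓ)` differ exactly by `dα(ℓ, X)`.
  have h1 : fderiv ℝ (chartOneForm α p) y (chartField ℓ p y) X -
      fderiv ℝ (chartOneForm α p) y X (chartField ℓ p y) = 0 := by
    rw [hy, chartField_self]
    exact h0
  simp
  linarith

end LieDerivative

/-! ### Energy conditions, the zeroth law and the rotation 2-form -/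

section ZerothLaw

variable {E : Type*} [NormedAddCommGroup E] [NormedSpace ℝ E]
  {M : Type*} [TopologicalSpace M] [ChartedSpace E M] [IsManifold 𝓘(ℝ, E) ∞ M]
  {F : Type*} [NormedAddCommGroup F] [NormedSpace ℝ F]
  {N : Type*} [TopologicalSpace N] [ChartedSpace F N]
  {g : LorentzMetric E M} {ι : N → M}
  {Λ : ℝ} {T : ∀ x : M, TangentSpace 𝓘(ℝ, E) x →L[ℝ] TangentSpace 𝓘(ℝ, E) x →L[ℝ] ℝ}

theorem exists_smul_eq_null (hnull : IsNullImmersion (F := F) g ι) {p : N} {v w : F} (hw0 : w ≠ 0)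
    (hw : inducedForm g ι p w w = 0) (hv : inducedForm g ι p v v = 0) : ∃ r : ℝ, v = r • w := by
  have hw1 : mapD (E := E) (F := F) ι p w ≠ 0 := fun h ↦
    hw0 (mapD_injective hnull p (by rw [h, map_zero]))
  obtain ⟨r, hr⟩ := (g.isLorentz (ι p)).exists_smul_eq_of_null hw1 hw (c := mapD ι p v)
    hv.le (inducedForm_null hnull hw v)
  exact ⟨r, mapD_injective hnull p (by rw [hr, map_smul])⟩

variable [FiniteDimensional ℝ E]

/-- The raised covector `-T(k, ·)` is causal, and orthogonal to the null `k` because `T(k, k) = 0`.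
It is therefore a multiple of `k`, which is orthogonal to all tangent vectors. -/
theorem stressForm_future (τ : TimeOrientation g) (hnull : IsNullImmersion (F := F) g ι)
    (hSEC : StrongerEnergyCondition (F := F) g τ ι T) {p : N} {v : F}
    (hv : inducedForm g ι p v v = 0)
    (hT : stressForm T (ι p) (mapD ι p v) (mapD ι p v) = 0)
    (hτ : g.form (ι p) (τ.field (ι p)) (mapD ι p v) < 0) (Y : F) :
    stressForm T (ι p) (mapD ι p v) (mapD ι p Y) = 0 := by
  have hL := g.isLorentz (ι p)
  set k : E := mapD ι p v with hk
  have hk0 : k ≠ 0 := fun h ↦ by simp [h] at hτ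
  set R : E := -((g.form (ι p)).inverse (stressForm T (ι p) k)) with hR
  have hRR : g.form (ι p) R R ≤ 0 := (hSEC p v hv hτ).1
  have hgR : ∀ w, g.form (ι p) R w = -stressForm T (ι p) k w := fun w ↦ by
    rw [hR, map_neg, hL.isInvertible.self_apply_inverse]
    rfl
  obtain ⟨r, hr⟩ := hL.exists_smul_eq_of_null hk0 hv hRR (by rw [hL.symm, hgR, hT, neg_zero])
  have h := hgR (mapD ι p Y)
  have h2 : g.form (ι p) k (mapD ι p Y) = 0 := inducedForm_null hnull hv Y
  rw [hr, map_smul, smul_apply, h2, smul_zero] at h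
  linarith

/-- The stronger energy condition makes `T(ℓ, ·)` vanish on the null surface. -/
theorem stressForm_tangent (τ : TimeOrientation g) (hnull : IsNullImmersion (F := F) g ι)
    (hSEC : StrongerEnergyCondition (F := F) g τ ι T) {p : N} {v : F} (hv0 : v ≠ 0)
    (hv : inducedForm g ι p v v = 0)
    (hT : stressForm T (ι p) (mapD ι p v) (mapD ι p v) = 0) (Y : F) :
    stressForm T (ι p) (mapD ι p v) (mapD ι p Y) = 0 := by
  have hk0 : mapD (E := E) (F := F) ι p v ≠ 0 := fun h ↦
    hv0 (mapD_injective hnull p (by rw [h, map_zero]))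
  have hne : g.form (ι p) (τ.field (ι p)) (mapD ι p v) ≠ 0 :=
    (g.isLorentz (ι p)).timelike_null_ne_zero hk0 hv (τ.timelike (ι p))
  rcases hne.lt_or_gt with h | h
  · exact stressForm_future τ hnull hSEC hv hT h Y
  -- The energy condition concerns future-directed vectors; the conclusion is linear in `v`, so `-v`
  -- serves.
  · have := stressForm_future τ hnull hSEC (p := p) (v := -v) (by simpa using hv)
      (by simpa using hT) (by simpa using h) Y
    simpa using this

variable [IsManifold 𝓘(ℝ, F) ∞ N] [FiniteDimensional ℝ F]

/-- The exterior derivative of the rotation 1-form is annihilated by the null direction. -/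
theorem dForm_rotationForm_null (τ : TimeOrientation g) (hnull : IsNullImmersion (F := F) g ι)
    (hdim : Module.finrank ℝ E = Module.finrank ℝ F + 1)
    (hexp : IsNonExpanding (F := F) g ι) (hEin : EinsteinOn g ι Λ T)
    (hT : NullEnergyCondition (F := F) g ι T) (hSEC : StrongerEnergyCondition (F := F) g τ ι T)
    {U : Set N} {ℓ : ∀ p : N, TangentSpace 𝓘(ℝ, F) p}
    (hℓ : IsNullFieldOn g ι U ℓ) {p : N} (hp : p ∈ U) (h0 : ℓ p ≠ 0) (Y : F) :
    dForm (rotationForm g ι ℓ) p (ℓ p) Y = 0 := by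
  have hS := isHypersurface_fieldDom hnull hdim hℓ p
  have hn := isNullFieldIn_chartField hnull hℓ p
  have hy := mem_fieldDom_self (E := E) (ι := ι) hp h0
  have h := hS.ricciAt_of_rotation hn hy
    ((contDiffAt_rotationForm hnull hdim hexp hEin hT hℓ hy).differentiableAt (by simp))
    (by filter_upwards [hS.isOpen.mem_nhds hy] with z hz
          using covD_push_rotationForm hnull hdim hexp hEin hT hℓ hz) Y
  have hk : fderiv ℝ (chartRep (E := E) ι p (ι p)) (extChartAt 𝓘(ℝ, F) p p)
      (chartField ℓ p (extChartAt 𝓘(ℝ, F) p p)) = mapD (E := E) (F := F) ι p (ℓ p) :=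
    (congrArg _ (chartField_self ℓ p)).trans (fderiv_chartRep_self hnull.contMDiff p (ℓ p))
  have hric : ricciAt (chartMetric g (ι p))
      (chartRep (E := E) ι p (ι p) (extChartAt 𝓘(ℝ, F) p p))
      (mapD (E := E) (F := F) ι p (ℓ p)) (mapD (E := E) (F := F) ι p Y) = 0 :=
    (ricciAt_eq_stress hEin p (v := mapD (E := E) (F := F) ι p (ℓ p))
      (w := mapD (E := E) (F := F) ι p Y) (inducedForm_null hnull (hℓ.null p hp) Y)).trans
      (stressForm_tangent τ hnull hSEC h0 (hℓ.null p hp)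
        (totally_geodesic hnull hdim hexp hEin hT hℓ hp h0).1 Y)
  -- The rotation identity has the null vector in the second slot of Ricci, the energy argument has
  -- it in the first slot of `T`; symmetry of Ricci bridges the two.
  rw [hS.metric.ricciAt_symm (hS.mapsTo _ hy), hk, fderiv_chartRep_self hnull.contMDiff, hric,
    chartField_self] at h
  exact h.symm

/-- The exterior derivative of the rotation 1-form does not depend on the null field. -/
theorem dForm_rotationForm_eq (hnull : IsNullImmersion (F := F) g ι)
    (hdim : Module.finrank ℝ E = Module.finrank ℝ F + 1)
    (hexp : IsNonExpanding (F := F) g ι) (hEin : EinsteinOn g ι Λ T)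
    (hT : NullEnergyCondition (F := F) g ι T)
    {U U' : Set N} {ℓ ℓ' : ∀ p : N, TangentSpace 𝓘(ℝ, F) p}
    (hℓ : IsNullFieldOn g ι U ℓ) (hℓ' : IsNullFieldOn g ι U' ℓ') {p : N} (hp : p ∈ U)
    (hp' : p ∈ U') (h0 : ℓ p ≠ 0) (h0' : ℓ' p ≠ 0) :
    dForm (rotationForm g ι ℓ) p = dForm (rotationForm g ι ℓ') p := by
  -- Curvature is tensorial, so `R(X, Y)ℓ = dω(X, Y) ℓ` gives proportional null vectors the same
  -- `dω`; no transformation law for `ω` is needed.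
  have key : ∀ {U : Set N} {ℓ : ∀ p : N, TangentSpace 𝓘(ℝ, F) p}, IsNullFieldOn g ι U ℓ →
      p ∈ U → ℓ p ≠ 0 → ∀ X Y,
      riemann (chartMetric g (ι p)) (chartRep (E := E) ι p (ι p) (extChartAt 𝓘(ℝ, F) p p))
        (mapD ι p X) (mapD ι p Y) (mapD (F := F) ι p (ℓ p)) =
      dForm (rotationForm g ι ℓ) p X Y • mapD (E := E) (F := F) ι p (ℓ p) := by
    intro U ℓ hℓ hp h0 X Y
    have hS := isHypersurface_fieldDom hnull hdim hℓ p
    have hn := isNullFieldIn_chartField hnull hℓ p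
    have hy := mem_fieldDom_self (E := E) (ι := ι) hp h0
    have h := hS.riemann_of_rotation hn hy
      ((contDiffAt_rotationForm hnull hdim hexp hEin hT hℓ hy).differentiableAt (by simp))
      (by filter_upwards [hS.isOpen.mem_nhds hy] with z hz
            using covD_push_rotationForm hnull hdim hexp hEin hT hℓ hz) X Y
    have hk : fderiv ℝ (chartRep (E := E) ι p (ι p)) (extChartAt 𝓘(ℝ, F) p p)
        (chartField ℓ p (extChartAt 𝓘(ℝ, F) p p)) = mapD (E := E) (F := F) ι p (ℓ p) :=
      (congrArg _ (chartField_self ℓ p)).trans (fderiv_chartRep_self hnull.contMDiff p (ℓ p))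
    rw [hk, fderiv_chartRep_self hnull.contMDiff, fderiv_chartRep_self hnull.contMDiff] at h
    exact h
  obtain ⟨r, hr⟩ := exists_smul_eq_null hnull h0 (hℓ.null p hp) (hℓ'.null p hp')
  have hk0 : mapD (E := E) (F := F) ι p (ℓ' p) ≠ 0 := fun h ↦
    h0' (mapD_injective hnull p (h.trans (map_zero _).symm))
  have hr' : mapD (E := E) (F := F) ι p (ℓ' p) = r • mapD (E := E) (F := F) ι p (ℓ p) :=
    (congrArg _ hr).trans (map_smul _ r _)
  ext X Y
  have h1 := key hℓ hp h0 X Y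
  have h2 := key hℓ' hp' h0' X Y
  refine smul_left_injective ℝ hk0 ?_
  change dForm (rotationForm g ι ℓ) p X Y • mapD (E := E) (F := F) ι p (ℓ' p) =
    dForm (rotationForm g ι ℓ') p X Y • mapD (E := E) (F := F) ι p (ℓ' p)
  rw [← h2, hr', map_smul, h1, smul_comm]

/-- A null field is chosen separately at every point; independence of the choice lets one `Ω` serve
all null fields. -/
theorem exists_rotationTwoForm (hnull : IsNullImmersion (F := F) g ι)
    (hdim : Module.finrank ℝ E = Module.finrank ℝ F + 1)
    (hexp : IsNonExpanding (F := F) g ι) (hEin : EinsteinOn g ι Λ T)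
    (hT : NullEnergyCondition (F := F) g ι T) :
    ∃ Ω : ∀ p : N, TangentSpace 𝓘(ℝ, F) p →L[ℝ] TangentSpace 𝓘(ℝ, F) p →L[ℝ] ℝ,
      ∀ (U : Set N) (ℓ : ∀ p : N, TangentSpace 𝓘(ℝ, F) p), IsNullFieldOn g ι U ℓ →
        ∀ p ∈ U, ℓ p ≠ 0 → dForm (rotationForm g ι ℓ) p = twoTensorAt Ω p := by
  have hexp' := hexp
  choose U ℓ hℓ hp h0 _ using hexp'
  exact ⟨fun p ↦ dForm (F := F) (rotationForm g ι (ℓ p)) p, fun U' ℓ' hℓ' p hp' h0' ↦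
    dForm_rotationForm_eq hnull hdim hexp hEin hT hℓ' (hℓ p) hp' (hp p) h0' (h0 p)⟩

variable {Ω : ∀ p : N, TangentSpace 𝓘(ℝ, F) p →L[ℝ] TangentSpace 𝓘(ℝ, F) p →L[ℝ] ℝ}

/-- Undoes the pointwise choice in `Ω`: locally it is the exterior derivative of the potential of a
single null field, so it is smooth and closed. -/
theorem chartTwoTensor_eq_curl (hnull : IsNullImmersion (F := F) g ι)
    (hdim : Module.finrank ℝ E = Module.finrank ℝ F + 1)
    (hexp : IsNonExpanding (F := F) g ι) (hEin : EinsteinOn g ι Λ T)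
    (hT : NullEnergyCondition (F := F) g ι T)
    (hΩ : ∀ (U : Set N) (ℓ : ∀ p : N, TangentSpace 𝓘(ℝ, F) p), IsNullFieldOn g ι U ℓ →
        ∀ p ∈ U, ℓ p ≠ 0 → dForm (rotationForm g ι ℓ) p = twoTensorAt Ω p)
    {U : Set N} {ℓ : ∀ p : N, TangentSpace 𝓘(ℝ, F) p} (hℓ : IsNullFieldOn g ι U ℓ) {p₀ : N} {y : F}
    (hy : y ∈ fieldDom E ι p₀ U ℓ) :
    chartTwoTensor Ω p₀ y = curl (chartOneForm (rotationForm g ι ℓ) p₀) y := by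
  have hyt : y ∈ (extChartAt 𝓘(ℝ, F) p₀).target := hy.1.1
  have hr := (extChartAt 𝓘(ℝ, F) p₀).right_inv hyt
  have hq := (surfDom_source hy.1).1
  have h0 : ℓ ((extChartAt 𝓘(ℝ, F) p₀).symm y) ≠ 0 := fun h ↦ hy.2.2 (by
    change chartD (E := F) p₀ _ (ℓ ((extChartAt 𝓘(ℝ, F) p₀).symm y)) = 0
    rw [h]
    exact map_zero (chartD (E := F) p₀ _))
  ext X Y
  have h := fderiv_chartOneForm_sub (rotationForm g ι ℓ) hq
    ((contDiffAt_rotationForm hnull hdim hexp hEin hT hℓ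
      (mem_fieldDom_self hy.2.1 h0)).differentiableAt (by simp)) X Y
  rw [hr, hΩ U ℓ hℓ _ hy.2.1 h0] at h
  rw [chartTwoTensor_apply, curl_apply, h]

theorem isSmoothTwoTensor_rotationTwoForm (hnull : IsNullImmersion (F := F) g ι)
    (hdim : Module.finrank ℝ E = Module.finrank ℝ F + 1)
    (hexp : IsNonExpanding (F := F) g ι) (hEin : EinsteinOn g ι Λ T)
    (hT : NullEnergyCondition (F := F) g ι T)
    (hΩ : ∀ (U : Set N) (ℓ : ∀ p : N, TangentSpace 𝓘(ℝ, F) p), IsNullFieldOn g ι U ℓ →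
        ∀ p ∈ U, ℓ p ≠ 0 → dForm (rotationForm g ι ℓ) p = twoTensorAt Ω p) :
    IsSmoothTwoTensor Ω := by
  refine isSmoothTwoTensor_of_chart fun p ↦ ?_
  obtain ⟨U, ℓ, hℓ, hp, h0, -⟩ := hexp p
  have hy := mem_fieldDom_self (E := E) (ι := ι) hp h0
  refine (contDiffAt_curl (contDiffAt_rotationForm hnull hdim hexp hEin hT hℓ
    hy)).congr_of_eventuallyEq ?_
  filter_upwards [(isHypersurface_fieldDom hnull hdim hℓ p).isOpen.mem_nhds hy] with z hz
    using chartTwoTensor_eq_curl hnull hdim hexp hEin hT hΩ hℓ hz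

/-- Phrased for a single vector, possibly zero, so as to cover null fields with zeros: `v` is a
multiple of a null field that does not vanish at `p`. -/
theorem rotationTwoForm_null (τ : TimeOrientation g) (hnull : IsNullImmersion (F := F) g ι)
    (hdim : Module.finrank ℝ E = Module.finrank ℝ F + 1)
    (hexp : IsNonExpanding (F := F) g ι) (hEin : EinsteinOn g ι Λ T)
    (hT : NullEnergyCondition (F := F) g ι T) (hSEC : StrongerEnergyCondition (F := F) g τ ι T)
    (hΩ : ∀ (U : Set N) (ℓ : ∀ p : N, TangentSpace 𝓘(ℝ, F) p), IsNullFieldOn g ι U ℓ →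
        ∀ p ∈ U, ℓ p ≠ 0 → dForm (rotationForm g ι ℓ) p = twoTensorAt Ω p)
    {p : N} {v : F} (hv : inducedForm g ι p v v = 0) (X : F) : twoTensorAt Ω p v X = 0 := by
  obtain ⟨U, ℓ, hℓ, hp, h0, -⟩ := hexp p
  obtain ⟨r, hr⟩ := exists_smul_eq_null hnull h0 (hℓ.null p hp) hv
  have h := dForm_rotationForm_null τ hnull hdim hexp hEin hT hSEC hℓ hp h0 X
  rw [hΩ U ℓ hℓ p hp h0] at h
  rw [hr]
  refine (DFunLike.congr_fun ((twoTensorAt Ω p).map_smul r (ℓ p)) X).trans ?_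
  rw [smul_apply, h, smul_zero]

theorem lieTwoTensor_rotationTwoForm (τ : TimeOrientation g) (hnull : IsNullImmersion (F := F) g ι)
    (hdim : Module.finrank ℝ E = Module.finrank ℝ F + 1)
    (hexp : IsNonExpanding (F := F) g ι) (hEin : EinsteinOn g ι Λ T)
    (hT : NullEnergyCondition (F := F) g ι T) (hSEC : StrongerEnergyCondition (F := F) g τ ι T)
    (hΩ : ∀ (U : Set N) (ℓ : ∀ p : N, TangentSpace 𝓘(ℝ, F) p), IsNullFieldOn g ι U ℓ →
        ∀ p ∈ U, ℓ p ≠ 0 → dForm (rotationForm g ι ℓ) p = twoTensorAt Ω p)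
    {U : Set N} {ℓ : ∀ p : N, TangentSpace 𝓘(ℝ, F) p} (hℓ : IsNullFieldOn g ι U ℓ) {p : N}
    (hp : p ∈ U) (X Y : F) : lieTwoTensor ℓ Ω p X Y = 0 := by
  -- `ℓ` may vanish at `p`, so the potential is taken from an auxiliary field `ℓ'` nonzero there;
  -- `ℓ` enters only through `Ω(ℓ, ·) = 0`.
  obtain ⟨U', ℓ', hℓ', hp', h0, -⟩ := hexp p
  have hy := mem_fieldDom_self (E := E) (ι := ι) hp' h0
  have hS := isHypersurface_fieldDom hnull hdim hℓ' p
  set y := extChartAt 𝓘(ℝ, F) p p with hydef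
  have hev : ∀ᶠ z in 𝓝 y, z ∈ fieldDom E ι p U' ℓ' := hS.isOpen.mem_nhds hy
  have heq : chartTwoTensor Ω p =ᶠ[𝓝 y] curl (chartOneForm (rotationForm g ι ℓ') p) := by
    filter_upwards [hev] with z hz
      using chartTwoTensor_eq_curl hnull hdim hexp hEin hT hΩ hℓ' hz
  have hU : ∀ᶠ z in 𝓝 y, (extChartAt 𝓘(ℝ, F) p).symm z ∈ U := by
    have h := (isOpen_preimage_chart (c := p) hℓ.isOpen).mem_nhds
      (show y ∈ _ from ⟨mem_extChartAt_target p, by rwa [Set.mem_preimage, extChartAt_to_inv]⟩)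
    filter_upwards [h] with z hz using hz.2
  have h := lie_curl_eq_zero (contDiffAt_rotationForm hnull hdim hexp hEin hT hℓ' hy)
    (differentiableAt_chartField hℓ.isOpen hℓ.smooth hp) (by
      filter_upwards [hev, heq, hU] with z hz hz' hzU X
      rw [← hz', chartTwoTensor_apply, chartDsymm_chartField ℓ hz.1.1]
      exact rotationTwoForm_null τ hnull hdim hexp hEin hT hSEC hΩ (hℓ.null _ hzU) _) X Y
  change fderiv ℝ (chartTwoTensor Ω p) y (chartField ℓ p y) (chartD p p X) (chartD p p Y) +
    chartTwoTensor Ω p y (fderiv ℝ (chartField ℓ p) y (chartD p p X)) (chartD p p Y) +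
    chartTwoTensor Ω p y (chartD p p X) (fderiv ℝ (chartField ℓ p) y (chartD p p Y)) = 0
  rw [chartD_self, chartD_self, heq.fderiv_eq, heq.self_of_nhds]
  exact h

end ZerothLaw

end NullSurface

end

theorem theorem2
    {n : ℕ} (hn : 2 < n)
    {E : Type*} [NormedAddCommGroup E] [NormedSpace ℝ E] [FiniteDimensional ℝ E]
    (hE : Module.finrank ℝ E = n)
    {M : Type*} [TopologicalSpace M] [ChartedSpace E M] [IsManifold 𝓘(ℝ, E) ∞ M]
    {F : Type*} [NormedAddCommGroup F] [NormedSpace ℝ F] [FiniteDimensional ℝ F]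
    (hF : Module.finrank ℝ F = n - 1)
    {N : Type*} [TopologicalSpace N] [ChartedSpace F N] [IsManifold 𝓘(ℝ, F) ∞ N]
    (g : NullSurface.LorentzMetric E M) (τ : NullSurface.TimeOrientation g)
    (ι : N → M) (hnull : NullSurface.IsNullImmersion (F := F) g ι)
    (hexp : NullSurface.IsNonExpanding (F := F) g ι)
    (Λ : ℝ)
    (T : ∀ x : M, TangentSpace 𝓘(ℝ, E) x →L[ℝ] TangentSpace 𝓘(ℝ, E) x →L[ℝ] ℝ)
    (hEin : NullSurface.EinsteinOn g ι Λ T)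
    (hT : NullSurface.NullEnergyCondition (F := F) g ι T)
    (hSEC : NullSurface.StrongerEnergyCondition (F := F) g τ ι T) :
    -- the covariant derivative induced on the surface is well defined
    (∀ (U : Set N) (Y : ∀ p : N, TangentSpace 𝓘(ℝ, F) p),
      IsOpen U → NullSurface.IsSmoothFieldOn U Y →
      ∀ p ∈ U, ∀ X : TangentSpace 𝓘(ℝ, F) p,
        mfderiv 𝓘(ℝ, F) 𝓘(ℝ, E) ι p (NullSurface.inducedDeriv g ι Y p X)
          = NullSurface.covAlong g ι (NullSurface.push ι Y) p X) ∧
    -- the rotation potential of every nowhere vanishing null field exists, and the zeroth law holds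
    (∀ (U : Set N) (ℓ : ∀ p : N, TangentSpace 𝓘(ℝ, F) p),
      NullSurface.IsNullFieldOn g ι U ℓ → (∀ p ∈ U, ℓ p ≠ 0) →
      NullSurface.IsSmoothOneFormOn U (NullSurface.rotationForm g ι ℓ) ∧
      ∀ p ∈ U, ∀ X : TangentSpace 𝓘(ℝ, F) p,
        NullSurface.inducedDeriv g ι ℓ p X = NullSurface.rotationForm g ι ℓ p X • ℓ p ∧
        NullSurface.lieOneForm ℓ (NullSurface.rotationForm g ι ℓ) p X
          = mfderiv 𝓘(ℝ, F) 𝓘(ℝ, ℝ) (NullSurface.surfaceGravity g ι ℓ) p X) ∧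
    -- the rotation 2-form is one and the same for all null fields, annihilated and Lie dragged by
    -- every null field
    (∃ Ω : ∀ p : N, TangentSpace 𝓘(ℝ, F) p →L[ℝ] TangentSpace 𝓘(ℝ, F) p →L[ℝ] ℝ,
      NullSurface.IsSmoothTwoTensor Ω ∧
      (∀ (U : Set N) (ℓ : ∀ p : N, TangentSpace 𝓘(ℝ, F) p),
        NullSurface.IsNullFieldOn g ι U ℓ → (∀ p ∈ U, ℓ p ≠ 0) →
        ∀ p ∈ U, ∀ X Y : TangentSpace 𝓘(ℝ, F) p,
          NullSurface.extDerivOneForm (NullSurface.rotationForm g ι ℓ) p X Y = Ω p X Y) ∧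
      (∀ (U : Set N) (ℓ : ∀ p : N, TangentSpace 𝓘(ℝ, F) p),
        NullSurface.IsNullFieldOn g ι U ℓ →
        ∀ p ∈ U, ∀ X Y : TangentSpace 𝓘(ℝ, F) p,
          Ω p (ℓ p) X = 0 ∧ NullSurface.lieTwoTensor ℓ Ω p X Y = 0)) := by
  -- The bound on `n` makes the truncated `n - 1` a true subtraction.
  have hdim : Module.finrank ℝ E = Module.finrank ℝ F + 1 := by omega
  obtain ⟨Ω, hΩ⟩ := NullSurface.exists_rotationTwoForm hnull hdim hexp hEin hT
  refine ⟨fun U Y hU hY p hp X ↦ NullSurface.mapD_inducedDeriv hnull hdim hexp hEin hT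
    (NullSurface.differentiableAt_chartField hU hY hp) X, fun U ℓ hℓ h0 ↦ ?_,
    Ω, NullSurface.isSmoothTwoTensor_rotationTwoForm hnull hdim hexp hEin hT hΩ,
    fun U ℓ hℓ h0 p hp X Y ↦ ?_, fun U ℓ hℓ p hp X Y ↦ ⟨?_, ?_⟩⟩
  · have hα : ∀ p ∈ U, ContDiffAt ℝ ∞ (NullSurface.chartOneForm
        (NullSurface.rotationForm g ι ℓ) p) (extChartAt 𝓘(ℝ, F) p p) := fun p hp ↦
      NullSurface.contDiffAt_rotationForm hnull hdim hexp hEin hT hℓ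
        (NullSurface.mem_fieldDom_self hp (h0 p hp))
    exact ⟨NullSurface.isSmoothOneFormOn_of_chart hα, fun p hp X ↦
      ⟨NullSurface.inducedDeriv_null hnull hdim hexp hEin hT hℓ hp (h0 p hp) X,
      NullSurface.lieOneForm_eq_mfderiv
        (NullSurface.differentiableAt_chartField hℓ.isOpen hℓ.smooth hp)
        ((hα p hp).differentiableAt (by simp)) X
        (NullSurface.dForm_rotationForm_null τ hnull hdim hexp hEin hT hSEC hℓ hp (h0 p hp) X)⟩⟩
  · exact (NullSurface.extDerivOneForm_eq (NullSurface.rotationForm g ι ℓ) p X Y).trans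
      (DFunLike.congr_fun (DFunLike.congr_fun (hΩ U ℓ hℓ p hp (h0 p hp)) X) Y)
  · exact NullSurface.rotationTwoForm_null τ hnull hdim hexp hEin hT hSEC hΩ (hℓ.null p hp) X
  · exact NullSurface.lieTwoTensor_rotationTwoForm τ hnull hdim hexp hEin hT hSEC hΩ hℓ hp X Y
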